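/- **Logic.** Let $\mathcal P$ be a set of propositions. Formulas (in negation normal form) are given by $\varphi ::= \mathtt{tt}\mid \mathtt{ff}\mid p\mid\neg p\mid\varphi\lor\varphi\mid\varphi\land\varphi\mid \mathtt X\varphi\mid\varphi\,\mathtt U\,\varphi\mid\varphi\,\mathtt R\,\varphi\mid \mathsf E\varphi\mid \mathsf A\varphi$ with $p\in\mathcal P$; the *literals* are $\mathtt{tt},\mathtt{ff},p,\neg p$. They are interpreted over paths $\pi$ of transition systems $T=(S,s^*,\to,\lambda)$, where $\to$ is total and $\lambda:S\to 2^{\mathcal P}$, with the usual semantics ($\varphi\mathtt U\psi$: some suffix $\pi^k\models\psi$ and $\pi^j\models\varphi$ for all $j<k$; $\varphi\mathtt R\psi$: for all $k$, $\pi^k\models\psi$ or $\pi^j\models\varphi$ for some $j<k$; $\mathsf E,\mathsf A$ quantify over the paths of $T$ starting in $\pi(0)$). $\vartheta$ is a *state formula* (a CTL* formula) if, in every $T$, its truth on a path depends only on the first state of the path. A state formula $\vartheta$ is *satisfiable* if $T,s^*\models\vartheta$ for some $T$. $\mathrm{FL}(\vartheta)$ is the least set containing $\vartheta$, closed under subformulas,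 and containing $\mathtt X\chi$ for each of its members $\chi$ of the form $\varphi\mathtt U\psi$ or $\varphi\mathtt R\psi$. **Configurations.** A *block* is $\mathsf A\Sigma$ (read as a disjunction) or $\mathsf E\Pi$ (read as a conjunction) with $\Sigma,\Pi\subseteq \mathrm{FL}(\vartheta)$. A *configuration* is a non-empty set of blocks and of literals from $\mathrm{FL}(\vartheta)$; it is *consistent* if among its literals there is neither $\mathtt{ff}$ nor a pair $p,\neg p$. **Game $\mathcal G_\vartheta$.** The nodes are the consistent configurations for $\vartheta$; the initial one is $\{\mathsf E\{\vartheta\}\}$. A move applies a rule instance and passes to one of its results, provided that it is a node. Each non-modal rule removes a principal block, written $\mathsf Q(\chi,\Gamma)$ for $\mathsf Q(\{\chi\}\cup\Gamma)$ with principal formula $\chi\notin\Gamma$, and adds the items on the right ("|" separates alternatives; $\ell$ is a literal; the rest of the configuration is kept): * $\mathsf A(\varphi\land\psi,\Sigma)\rightarrow \mathsf A(\varphi,\Sigma),\mathsf A(\psi,\Sigma)$; * $\mathsf A(\varphi\lor\psi,\Sigma)\rightarrow \mathsf A(\varphi,\psi,\Sigma)$; * $\mathsf A(\ell,\Sigma)\rightarrow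 \ell\mid \mathsf A\Sigma$; * $\mathsf A(\varphi\mathtt U\psi,\Sigma)\rightarrow \mathsf A(\psi,\varphi,\Sigma),\mathsf A(\psi,\mathtt X(\varphi\mathtt U\psi),\Sigma)$; * $\mathsf A(\varphi\mathtt R\psi,\Sigma)\rightarrow \mathsf A(\psi,\Sigma),\mathsf A(\varphi,\mathtt X(\varphi\mathtt R\psi),\Sigma)$; * $\mathsf A(\mathsf A\varphi,\Sigma)\rightarrow \mathsf A\{\varphi\}\mid \mathsf A\Sigma$; * $\mathsf A(\mathsf E\varphi,\Sigma)\rightarrow \mathsf E\{\varphi\}\mid \mathsf A\Sigma$; * $\mathsf E(\varphi\lor\psi,\Pi)\rightarrow \mathsf E(\varphi,\Pi)\mid \mathsf E(\psi,\Pi)$; * $\mathsf E(\varphi\land\psi,\Pi)\rightarrow \mathsf E(\varphi,\psi,\Pi)$; * $\mathsf E(\ell,\Pi)\rightarrow \mathsf E\Pi,\ell$; * $\mathsf E(\varphi\mathtt U\psi,\Pi)\rightarrow \mathsf E(\psi,\Pi)\mid \mathsf E(\varphi,\mathtt X(\varphi\mathtt U\psi),\Pi)$; * $\mathsf E(\varphi\mathtt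 R\psi,\Pi)\rightarrow \mathsf E(\psi,\varphi,\Pi)\mid \mathsf E(\psi,\mathtt X(\varphi\mathtt R\psi),\Pi)$; * $\mathsf E(\mathsf E\varphi,\Pi)\rightarrow \mathsf E\{\varphi\},\mathsf E\Pi$; * $\mathsf E(\mathsf A\varphi,\Pi)\rightarrow \mathsf A\{\varphi\},\mathsf E\Pi$; * moreover, a block $\mathsf E\emptyset$ may be deleted. The modal rules, with $\Lambda$ a set of literals, are: $(\mathtt X_0)$ from $\mathsf A\mathtt X\Sigma_1,\dots,\mathsf A\mathtt X\Sigma_m,\Lambda$ with $m\ge1$ to $\mathsf A\Sigma_1,\dots,\mathsf A\Sigma_m$; and $(\mathtt X_1)$ from $\mathsf E\mathtt X\Pi_1,\dots,\mathsf E\mathtt X\Pi_n,\mathsf A\mathtt X\Sigma_1,\dots,\mathsf A\mathtt X\Sigma_m,\Lambda$ with $n\ge1$, $m\ge 0$ and all $\Pi_i\neq\emptyset$ to $\mathsf E\Pi_i,\mathsf A\Sigma_1,\dots,\mathsf A\Sigma_m$ for any one $i$. Player 1 owns the configurations to which $(\mathtt X_1)$ applies, player 0 all others. A strategy of player 0 chooses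 a move (rule instance and result) at each of her nodes that has one, depending on the sequence of nodes visited so far; it is winning if she wins every maximal play conforming to it. **Winning condition.** Within a move, a block that is not principal is connected to its copy, and the principal block of a non-modal rule is connected to each block displayed on the right of the chosen alternative; displayed blocks count as different occurrences even if they are equal as sets. Along such a connection each formula of a copied block is connected to itself; for a displayed block, the principal formula $\chi$ is connected to the formulas displayed there explicitly, and each side formula in $\Gamma$ to itself if $\Gamma$ is displayed there. In the modal rules the surviving blocks $\mathsf Q\mathtt X\Gamma$ are connected to $\mathsf Q\Gamma$, and $\mathtt X\psi$ to $\psi$. A *trace* of an infinite play is an infinite sequence of connected blocks, one in each configuration of the play; a *thread* in a trace is an infinite sequence of formulas, one in each block, connected along the connections of the trace. A $\mathtt U$-thread (an $\mathtt R$-thread) is one in which a fixed formula $\varphi\mathtt U\psi$ ($\varphi\mathtt R\psi$) from $\mathrm{FL}(\vartheta)$ occurs infinitely often. A trace is *bad* if its blocks are $\mathsf E$-blocks from some point on and it contains a $\mathtt U$-thread, or if they are $\mathsf A$-blocks from some point on and it contains no $\mathtt R$-thread. Player 0 wins the finite (maximal) plays that end in a consistent set of literals and the infinite plays that contain no bad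 trace. **Theorem.** For every state formula $\vartheta$: $\vartheta$ is satisfiable if and only if player 0 has a winning strategy in $\mathcal G_\vartheta$. -/

import Mathlib

universe u w z

namespace CTLStar

/-! ### Syntax and semantics -/

/-- Branching-time temporal formulas in negation normal form over the propositions `P`. -/
inductive Formula (P : Type) : Type
  | tt : Formula P
  | ff : Formula P
  | atom (p : P) : Formula P
  | natom (p : P) : Formula P
  | disj (φ ψ : Formula P) : Formula P
  | conj (φ ψ : Formula P) : Formula P
  | next (φ : Formula P) : Formula P
  | untl (φ ψ : Formula P) : Formula P
  | rels (φ ψ : Formula P) : Formula P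
  | ex (φ : Formula P) : Formula P
  | all (φ : Formula P) : Formula P

/-- The literals: `tt`, `ff`, `p` and `¬ p`. -/
def Formula.IsLiteral {P : Type} : Formula P → Prop
  | .tt => True
  | .ff => True
  | .atom _ => True
  | .natom _ => True
  | _ => False

/-- The Fischer-Ladner closure: the least set that contains `ϑ`, is closed under subformulas, and
contains `X χ` for each of its members `χ` of the form `φ U ψ` or `φ R ψ`. -/
inductive FL {P : Type} (ϑ : Formula P) : Formula P → Prop
  | self : FL ϑ ϑ
  | disj_left {φ ψ : Formula P} : FL ϑ (.disj φ ψ) → FL ϑ φ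
  | disj_right {φ ψ : Formula P} : FL ϑ (.disj φ ψ) → FL ϑ ψ
  | conj_left {φ ψ : Formula P} : FL ϑ (.conj φ ψ) → FL ϑ φ
  | conj_right {φ ψ : Formula P} : FL ϑ (.conj φ ψ) → FL ϑ ψ
  | next_arg {φ : Formula P} : FL ϑ (.next φ) → FL ϑ φ
  | untl_left {φ ψ : Formula P} : FL ϑ (.untl φ ψ) → FL ϑ φ
  | untl_right {φ ψ : Formula P} : FL ϑ (.untl φ ψ) → FL ϑ ψ
  | rels_left {φ ψ : Formula P} : FL ϑ (.rels φ ψ) → FL ϑ φ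
  | rels_right {φ ψ : Formula P} : FL ϑ (.rels φ ψ) → FL ϑ ψ
  | ex_arg {φ : Formula P} : FL ϑ (.ex φ) → FL ϑ φ
  | all_arg {φ : Formula P} : FL ϑ (.all φ) → FL ϑ φ
  | untl_next {φ ψ : Formula P} : FL ϑ (.untl φ ψ) → FL ϑ (.next (.untl φ ψ))
  | rels_next {φ ψ : Formula P} : FL ϑ (.rels φ ψ) → FL ϑ (.next (.rels φ ψ))

/-- Total transition systems with a starting state. -/
structure TransitionSystem (P : Type) (S : Type u) where
  start : S
  step : S → S → Prop
  label : S → Set P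
  total : ∀ s, ∃ t, step s t

/-- The (infinite) paths of a transition system. -/
def TransitionSystem.Path {P : Type} {S : Type u} (T : TransitionSystem P S) : Type u :=
  {π : ℕ → S // ∀ i, T.step (π i) (π (i + 1))}

/-- The state `π(k)`. -/
def TransitionSystem.Path.at {P : Type} {S : Type u} {T : TransitionSystem P S} (π : T.Path)
    (k : ℕ) : S := π.1 k

/-- The suffix `π^k`. -/
def TransitionSystem.Path.suffix {P : Type} {S : Type u} {T : TransitionSystem P S} (π : T.Path)
    (k : ℕ) : T.Path :=
  ⟨fun i => π.1 (k + i), fun i => π.2 (k + i)⟩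

/-- `T, π ⊨ φ`. -/
def Models {P : Type} {S : Type u} (T : TransitionSystem P S) : T.Path → Formula P → Prop
  | _, .tt => True
  | _, .ff => False
  | π, .atom p => p ∈ T.label (π.at 0)
  | π, .natom p => p ∉ T.label (π.at 0)
  | π, .disj φ ψ => Models T π φ ∨ Models T π ψ
  | π, .conj φ ψ => Models T π φ ∧ Models T π ψ
  | π, .next φ => Models T (π.suffix 1) φ
  | π, .untl φ ψ => ∃ k, Models T (π.suffix k) ψ ∧ ∀ j < k, Models T (π.suffix j) φ
  | π, .rels φ ψ => ∀ k, Models T (π.suffix k) ψ ∨ ∃ j < k, Models T (π.suffix j) φ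
  | π, .ex φ => ∃ π' : T.Path, π'.at 0 = π.at 0 ∧ Models T π' φ
  | π, .all φ => ∀ π' : T.Path, π'.at 0 = π.at 0 → Models T π' φ

/-- State formulas, i.e. the formulas of CTL*: their truth on a path depends only on its first
state. -/
def IsStateFormula {P : Type} (φ : Formula P) : Prop :=
  ∀ (S : Type u) (T : TransitionSystem P S) (π π' : T.Path), π.at 0 = π'.at 0 →
    (Models T π φ ↔ Models T π' φ)

/-- `T, s ⊨ φ` for a state formula `φ`. -/
def ModelsAt {P : Type} {S : Type u} (T : TransitionSystem P S) (s : S) (φ : Formula P) : Prop :=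
  ∀ π : T.Path, π.at 0 = s → Models T π φ

/-- Satisfiability of a state formula. -/
def Satisfiable {P : Type} (φ : Formula P) : Prop :=
  ∃ (S : Type u) (T : TransitionSystem P S), ModelsAt T T.start φ

/-! ### Games

Edges carry labels, because a move in the satisfiability game is a rule instance together with one
of its results, and two rule instances may lead to the same node. -/

/-- The board of a two-player game: its nodes, the nodes of player 0, the edges, the initial node.
Nodes without successors are allowed. -/
structure Arena (V : Type w) (M : Type z) where
  V₀ : Set V
  edge : V → M → V → Prop
  init : V

/-- A maximal play: either of length `⊤`, or of a length `n : ℕ` such that the node reached after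
`n` moves has no successor. Only `pos i` for `i ≤ length` and `move i` for `i < length` matter. -/
structure Arena.Play {V : Type w} {M : Type z} (G : Arena V M) where
  length : ℕ∞
  pos : ℕ → V
  move : ℕ → M
  pos_zero : pos 0 = G.init
  step : ∀ i : ℕ, (i : ℕ∞) < length → G.edge (pos i) (move i) (pos (i + 1))
  maximal : ∀ n : ℕ, length = n → ∀ m v, ¬ G.edge (pos n) m v

/-- A game: a board together with the set of plays won by player 0. -/
structure Game (V : Type w) (M : Type z) extends Arena V M where
  L : Set toArena.Play

/-- A strategy for player 0: given the nodes visited so far and the current node, it selects an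
outgoing edge of the current node, if this belongs to player 0 and has one. -/
structure Game.Strategy {V : Type w} {M : Type z} (G : Game V M) where
  choose : List V → V → M × V
  legal : ∀ h v, v ∈ G.V₀ → (∃ m v', G.edge v m v') →
    G.edge v (choose h v).1 (choose h v).2

/-- All moves of player 0 in the play are those prescribed by the strategy. -/
def Game.Strategy.Conforms {V : Type w} {M : Type z} {G : Game V M} (σ : G.Strategy)
    (ρ : G.toArena.Play) : Prop :=
  ∀ i : ℕ, (i : ℕ∞) < ρ.length → ρ.pos i ∈ G.V₀ →
    (ρ.move i, ρ.pos (i + 1)) = σ.choose ((List.range i).map ρ.pos) (ρ.pos i)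

/-- A strategy is winning if player 0 wins all plays that conform to it. -/
def Game.Strategy.IsWinning {V : Type w} {M : Type z} {G : Game V M} (σ : G.Strategy) : Prop :=
  ∀ ρ : G.toArena.Play, σ.Conforms ρ → ρ ∈ G.L

/-! ### Configurations -/

inductive Quantifier : Type
  | A : Quantifier
  | E : Quantifier

/-- A quantifier-bound block `A Σ` (read disjunctively) or `E Π` (read conjunctively). -/
structure Block (P : Type) : Type where
  quant : Quantifier
  body : Set (Formula P)

/-- A set of blocks together with a set of literals. -/
structure Configuration (P : Type) : Type where
  blocks : Set (Block P)
  lits : Set (Formula P)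

/-- `C` is a configuration for `ϑ`. -/
structure Configuration.IsFor {P : Type} (C : Configuration P) (ϑ : Formula P) : Prop where
  nonempty : C.blocks.Nonempty ∨ C.lits.Nonempty
  body_subset : ∀ B ∈ C.blocks, ∀ φ ∈ B.body, FL ϑ φ
  lits_subset : ∀ ℓ ∈ C.lits, FL ϑ ℓ ∧ ℓ.IsLiteral

def Configuration.Consistent {P : Type} (C : Configuration P) : Prop :=
  .ff ∉ C.lits ∧ ∀ p : P, ¬ (.atom p ∈ C.lits ∧ .natom p ∈ C.lits)

/-- The nodes of the satisfiability game: the consistent configurations for `ϑ`. -/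
def Goals {P : Type} (ϑ : Formula P) : Type :=
  {C : Configuration P // C.IsFor ϑ ∧ C.Consistent}

/-- The configuration `E ϑ`. -/
def initialGoal {P : Type} (ϑ : Formula P) : Goals ϑ :=
  ⟨⟨{⟨.E, {ϑ}⟩}, ∅⟩,
    ⟨Or.inl ⟨_, rfl⟩, by
      rintro B hB φ hφ
      obtain rfl : B = ⟨.E, {ϑ}⟩ := hB
      obtain rfl : φ = ϑ := hφ
      exact FL.self, fun _ h => h.elim⟩,
    ⟨fun h => h.elim, fun _ h => h.1.elim⟩⟩

/-! ### Rules -/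

/-- One block displayed above the line of a non-modal rule: its quantifier, the formulas into which
the principal formula is transformed, and whether the side formulas (the rest of the principal
block) are kept in this block. -/
structure Descendant (P : Type) : Type where
  quant : Quantifier
  fresh : Set (Formula P)
  keeps : Bool

/-- The block that a descendant denotes if `Γ` is the set of side formulas. -/
def Descendant.block {P : Type} (d : Descendant P) (Γ : Set (Formula P)) : Block P :=
  ⟨d.quant, {φ | φ ∈ d.fresh ∨ (d.keeps = true ∧ φ ∈ Γ)}⟩

/-- The non-modal rules except the one for the empty `E`-block. `Rule q χ ds ls` says: a block with
quantifier `q` and principal formula `χ` may be replaced by the blocks `ds` and the literals `ls`.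
A rule that offers a choice to player 0 appears here with its two alternatives. -/
inductive Rule {P : Type} : Quantifier → Formula P → List (Descendant P) → Set (Formula P) → Prop
  | A_conj (φ ψ : Formula P) :
      Rule .A (.conj φ ψ) [⟨.A, {φ}, true⟩, ⟨.A, {ψ}, true⟩] ∅
  | A_disj (φ ψ : Formula P) :
      Rule .A (.disj φ ψ) [⟨.A, {φ, ψ}, true⟩] ∅
  | A_lit_take (ℓ : Formula P) (hℓ : ℓ.IsLiteral) :
      Rule .A ℓ [] {ℓ}
  | A_lit_drop (ℓ : Formula P) (hℓ : ℓ.IsLiteral) :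
      Rule .A ℓ [⟨.A, ∅, true⟩] ∅
  | A_untl (φ ψ : Formula P) :
      Rule .A (.untl φ ψ)
        [⟨.A, {ψ, φ}, true⟩, ⟨.A, {ψ, .next (.untl φ ψ)}, true⟩] ∅
  | A_rels (φ ψ : Formula P) :
      Rule .A (.rels φ ψ)
        [⟨.A, {ψ}, true⟩, ⟨.A, {φ, .next (.rels φ ψ)}, true⟩] ∅
  | A_all_take (φ : Formula P) :
      Rule .A (.all φ) [⟨.A, {φ}, false⟩] ∅
  | A_all_drop (φ : Formula P) :
      Rule .A (.all φ) [⟨.A, ∅, true⟩] ∅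
  | A_ex_take (φ : Formula P) :
      Rule .A (.ex φ) [⟨.E, {φ}, false⟩] ∅
  | A_ex_drop (φ : Formula P) :
      Rule .A (.ex φ) [⟨.A, ∅, true⟩] ∅
  | E_disj_left (φ ψ : Formula P) :
      Rule .E (.disj φ ψ) [⟨.E, {φ}, true⟩] ∅
  | E_disj_right (φ ψ : Formula P) :
      Rule .E (.disj φ ψ) [⟨.E, {ψ}, true⟩] ∅
  | E_conj (φ ψ : Formula P) :
      Rule .E (.conj φ ψ) [⟨.E, {φ, ψ}, true⟩] ∅
  | E_lit (ℓ : Formula P) (hℓ : ℓ.IsLiteral) :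
      Rule .E ℓ [⟨.E, ∅, true⟩] {ℓ}
  | E_untl_now (φ ψ : Formula P) :
      Rule .E (.untl φ ψ) [⟨.E, {ψ}, true⟩] ∅
  | E_untl_later (φ ψ : Formula P) :
      Rule .E (.untl φ ψ) [⟨.E, {φ, .next (.untl φ ψ)}, true⟩] ∅
  | E_rels_now (φ ψ : Formula P) :
      Rule .E (.rels φ ψ) [⟨.E, {ψ, φ}, true⟩] ∅
  | E_rels_later (φ ψ : Formula P) :
      Rule .E (.rels φ ψ) [⟨.E, {ψ, .next (.rels φ ψ)}, true⟩] ∅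
  | E_ex (φ : Formula P) :
      Rule .E (.ex φ) [⟨.E, {φ}, false⟩, ⟨.E, ∅, true⟩] ∅
  | E_all (φ : Formula P) :
      Rule .E (.all φ) [⟨.A, {φ}, false⟩, ⟨.E, ∅, true⟩] ∅

/-- A rule instance together with the selected alternative.
* `expand q χ Γ ds ls`: a non-modal rule with principal block `q (χ, Γ)` and principal formula `χ`;
* `ett`: the deletion of the block `E ∅`;
* `modal₀`: the modal rule without `E`-blocks;
* `modal₁ Δ`: the modal rule with `E`-blocks, where `E (X Δ)` is the selected one. -/
inductive Move (P : Type) : Type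
  | expand (q : Quantifier) (χ : Formula P) (Γ : Set (Formula P)) (ds : List (Descendant P))
      (ls : Set (Formula P)) : Move P
  | ett : Move P
  | modal₀ : Move P
  | modal₁ (Δ : Set (Formula P)) : Move P

/-- `X Γ`. -/
def nextSet {P : Type} (Γ : Set (Formula P)) : Set (Formula P) := Formula.next '' Γ

/-- The blocks `A Σ` such that `A (X Σ)` is a block of `C`. -/
def Configuration.unnextA {P : Type} (C : Configuration P) : Set (Block P) :=
  {B | ∃ Γ : Set (Formula P), ⟨.A, nextSet Γ⟩ ∈ C.blocks ∧ B = ⟨.A, Γ⟩}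

/-- The configuration has the form `A (X Σ₁), …, A (X Σₘ), Λ` with `m ≥ 1`. -/
def Configuration.Modal₀Applies {P : Type} (C : Configuration P) : Prop :=
  C.blocks.Nonempty ∧ ∀ B ∈ C.blocks, ∃ Γ : Set (Formula P), B = ⟨.A, nextSet Γ⟩

/-- The configuration has the form `E (X Π₁), …, E (X Πₙ), A (X Σ₁), …, A (X Σₘ), Λ` with `n ≥ 1`
and nonempty `Πᵢ` (the block `E ∅` stands for `E tt` and has its own rule). -/
def Configuration.Modal₁Applies {P : Type} (C : Configuration P) : Prop :=
  (∃ B ∈ C.blocks, B.quant = .E) ∧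
    ∀ B ∈ C.blocks, ∃ Γ : Set (Formula P), B = ⟨.A, nextSet Γ⟩ ∨
      (Γ.Nonempty ∧ B = ⟨.E, nextSet Γ⟩)

/-- `Step C m C'`: the move `m` is possible in `C` and leads to `C'`. -/
inductive Step {P : Type} : Configuration P → Move P → Configuration P → Prop
  | expand (C : Configuration P) (q : Quantifier) (χ : Formula P) (Γ : Set (Formula P))
      (ds : List (Descendant P)) (ls : Set (Formula P)) (hr : Rule q χ ds ls) (hχ : χ ∉ Γ)
      (hC : ⟨q, insert χ Γ⟩ ∈ C.blocks) :
      Step C (.expand q χ Γ ds ls)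
        ⟨(C.blocks \ {⟨q, insert χ Γ⟩}) ∪ {B | ∃ d ∈ ds, B = d.block Γ}, C.lits ∪ ls⟩
  | ett (C : Configuration P) (hC : ⟨.E, ∅⟩ ∈ C.blocks) :
      Step C .ett ⟨C.blocks \ {⟨.E, ∅⟩}, C.lits⟩
  | modal₀ (C : Configuration P) (hC : C.Modal₀Applies) :
      Step C .modal₀ ⟨C.unnextA, ∅⟩
  | modal₁ (C : Configuration P) (Δ : Set (Formula P)) (hC : C.Modal₁Applies)
      (hΔ : ⟨.E, nextSet Δ⟩ ∈ C.blocks) :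
      Step C (.modal₁ Δ) ⟨insert ⟨.E, Δ⟩ C.unnextA, ∅⟩

/-- The board of the satisfiability game. Player 1 owns the configurations to which the modal rule
with `E`-blocks applies. -/
def satArena {P : Type} (ϑ : Formula P) : Arena (Goals ϑ) (Move P) where
  V₀ := {C | ¬ C.1.Modal₁Applies}
  edge C m C' := Step C.1 m C'.1
  init := initialGoal ϑ

/-! ### Traces and threads -/

/-- How an occurrence of a block survives a move: as a copy, as a given displayed descendant of the
principal block of a non-modal rule, or by stripping `X` in a modal rule. Recording the displayed
descendant matters if two of them happen to be equal as sets. -/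
inductive Link (P : Type) : Type
  | copy : Link P
  | descend (d : Descendant P) : Link P
  | modal : Link P

/-- `BlockConn m B k B'`: in the move `m`, the block `B` is connected to `B'` through `k`. -/
inductive BlockConn {P : Type} : Move P → Block P → Link P → Block P → Prop
  | expand_copy (q : Quantifier) (χ : Formula P) (Γ : Set (Formula P)) (ds : List (Descendant P))
      (ls : Set (Formula P)) (B : Block P) (hB : B ≠ ⟨q, insert χ Γ⟩) :
      BlockConn (.expand q χ Γ ds ls) B .copy B
  | expand_descend (q : Quantifier) (χ : Formula P) (Γ : Set (Formula P))
      (ds : List (Descendant P)) (ls : Set (Formula P)) (d : Descendant P) (hd : d ∈ ds) :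
      BlockConn (.expand q χ Γ ds ls) ⟨q, insert χ Γ⟩ (.descend d) (d.block Γ)
  | ett_copy (B : Block P) (hB : B ≠ ⟨.E, ∅⟩) : BlockConn .ett B .copy B
  | modal₀ (Γ : Set (Formula P)) : BlockConn .modal₀ ⟨.A, nextSet Γ⟩ .modal ⟨.A, Γ⟩
  | modal₁_A (Δ Γ : Set (Formula P)) :
      BlockConn (.modal₁ Δ) ⟨.A, nextSet Γ⟩ .modal ⟨.A, Γ⟩
  | modal₁_E (Δ : Set (Formula P)) :
      BlockConn (.modal₁ Δ) ⟨.E, nextSet Δ⟩ .modal ⟨.E, Δ⟩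

/-- `FormulaConn m k ψ ψ'`: along a block connection through `k` in the move `m`, the formula `ψ` of
the first block is connected to the formula `ψ'` of the second one. -/
inductive FormulaConn {P : Type} : Move P → Link P → Formula P → Formula P → Prop
  | copy (m : Move P) (ψ : Formula P) : FormulaConn m .copy ψ ψ
  | principal (q : Quantifier) (χ : Formula P) (Γ : Set (Formula P)) (ds : List (Descendant P))
      (ls : Set (Formula P)) (d : Descendant P) (ψ : Formula P) (hψ : ψ ∈ d.fresh) :
      FormulaConn (.expand q χ Γ ds ls) (.descend d) χ ψ
  | side (q : Quantifier) (χ : Formula P) (Γ : Set (Formula P)) (ds : List (Descendant P))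
      (ls : Set (Formula P)) (d : Descendant P) (hd : d.keeps = true) (ψ : Formula P)
      (hψ : ψ ∈ Γ) :
      FormulaConn (.expand q χ Γ ds ls) (.descend d) ψ ψ
  | modal (m : Move P) (ψ : Formula P) : FormulaConn m .modal (.next ψ) ψ

/-- A trace in an infinite play: an infinite sequence of connected blocks. -/
structure Trace {P : Type} {ϑ : Formula P} (ρ : (satArena ϑ).Play) where
  block : ℕ → Block P
  link : ℕ → Link P
  mem : ∀ i, block i ∈ (ρ.pos i).1.blocks
  conn : ∀ i, BlockConn (ρ.move i) (block i) (link i) (block (i + 1))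

def Trace.IsETrace {P : Type} {ϑ : Formula P} {ρ : (satArena ϑ).Play} (ξ : Trace ρ) : Prop :=
  ∃ i, ∀ j ≥ i, (ξ.block j).quant = .E

def Trace.IsATrace {P : Type} {ϑ : Formula P} {ρ : (satArena ϑ).Play} (ξ : Trace ρ) : Prop :=
  ∃ i, ∀ j ≥ i, (ξ.block j).quant = .A

/-- A thread in a trace: an infinite sequence of connected formulas. -/
structure Trace.Thread {P : Type} {ϑ : Formula P} {ρ : (satArena ϑ).Play} (ξ : Trace ρ) where
  form : ℕ → Formula P
  mem : ∀ i, form i ∈ (ξ.block i).body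
  conn : ∀ i, FormulaConn (ρ.move i) (ξ.link i) (form i) (form (i + 1))

def Trace.Thread.IsUThread {P : Type} {ϑ : Formula P} {ρ : (satArena ϑ).Play} {ξ : Trace ρ}
    (t : ξ.Thread) : Prop :=
  ∃ φ ψ : Formula P, FL ϑ (.untl φ ψ) ∧ ∀ i, ∃ j ≥ i, t.form j = .untl φ ψ

def Trace.Thread.IsRThread {P : Type} {ϑ : Formula P} {ρ : (satArena ϑ).Play} {ξ : Trace ρ}
    (t : ξ.Thread) : Prop :=
  ∃ φ ψ : Formula P, FL ϑ (.rels φ ψ) ∧ ∀ i, ∃ j ≥ i, t.form j = .rels φ ψ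

/-- Bad traces: `E`-traces with a `U`-thread, and `A`-traces without an `R`-thread. -/
def Trace.IsBad {P : Type} {ϑ : Formula P} {ρ : (satArena ϑ).Play} (ξ : Trace ρ) : Prop :=
  (ξ.IsETrace ∧ ∃ t : ξ.Thread, t.IsUThread) ∨
    (ξ.IsATrace ∧ ¬ ∃ t : ξ.Thread, t.IsRThread)

/-- The satisfiability game. Player 0 wins the finite plays that end in a (consistent) set of
literals and the infinite plays without a bad trace. -/
def satGame {P : Type} (ϑ : Formula P) : Game (Goals ϑ) (Move P) where
  toArena := satArena ϑ
  L := {ρ | (∃ n : ℕ, ρ.length = n ∧ (ρ.pos n).1.blocks = ∅) ∨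
    (ρ.length = ⊤ ∧ ¬ ∃ ξ : Trace ρ, ξ.IsBad)}

end CTLStar

namespace CTLStar

/-! ### Formulas, the Fischer-Ladner closure, paths -/

section Basics

variable {P : Type}

/-! From a winning strategy to a model. The states are the reached positions, histories included, at
which a modal rule is due or the play has ended; in between the strategy alone decides, and
`Step.measure_lt` bounds the number of moves. `trueBelow` shows, by induction on the nesting of path
quantifiers, that every reached block with a single formula is true in this model. For an `E`-block,
player 1 keeps selecting its descendant, which draws a path. A formula of the block that is false on
this path passes its falsity on to a descendant formula at every move, and by `thread_tail` the
resulting thread is finally confined to one fixpoint formula `χ` and `X χ`. If `χ` is a `U`-formula,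
the trace is bad. If it is an `R`-formula, it is deferred only where its right argument is true; it
is deferred at every suffix (`exists_unfolding`), hence it is true, a contradiction. For an
`A`-block all of whose formulas are false on some path, the play is steered along the path while a
trace of entirely false blocks is followed. By the same argument this trace has no `R`-thread, so it
is bad.

From a model to a winning strategy. Player 0 keeps the configuration true at a current state and
remembers for each `E`-block a path on which all its formulas hold; a `U`-formula is deferred only
where its right argument is false. Since blocks are sets, two of them may merge, and then the path
that was selected first survives. Along a trace only finitely many blocks are newly spawned
(`Trace.eventually_keeps`), and afterwards the selection times never increase. So from some point on
an `E`-trace follows a single path, where a `U`-thread would defer forever a formula that is true.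
Along an `A`-trace the visited states form a path, the formulas true on it form a thread, and this
thread cannot end in a `U`-formula, so it is an `R`-thread (`Trace.not_isBad`).
`Game.exists_strategy` recovers the memory from the nodes visited. -/

/-- The formulas `φ U ψ` and `φ R ψ`. -/
def Formula.isFix : Formula P → Bool
  | .untl _ _ => true
  | .rels _ _ => true
  | _ => false

/-- The formulas `X φ`. -/
def Formula.isNext : Formula P → Bool
  | .next _ => true
  | _ => false

/-- A size that counts the connectives which are not guarded by `X`. -/
def Formula.weight : Formula P → ℕ
  | .disj φ ψ => weight φ + weight ψ + 1
  | .conj φ ψ => weight φ + weight ψ + 1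
  | .untl φ ψ => weight φ + weight ψ + 1
  | .rels φ ψ => weight φ + weight ψ + 1
  | .ex φ => weight φ + 1
  | .all φ => weight φ + 1
  | .next _ => 0
  | _ => 1

/-- A size that does not change when a formula `φ U ψ` or `φ R ψ` is prefixed by `X`. -/
def Formula.rank : Formula P → ℕ
  | .disj φ ψ => rank φ + rank ψ + 1
  | .conj φ ψ => rank φ + rank ψ + 1
  | .untl φ ψ => rank φ + rank ψ + 1
  | .rels φ ψ => rank φ + rank ψ + 1
  | .ex φ => rank φ + 1
  | .all φ => rank φ + 1
  | .next φ => rank φ + if φ.isFix then 0 else 1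
  | _ => 0

/-- The nesting depth of path quantifiers. -/
def Formula.depth : Formula P → ℕ
  | .disj φ ψ => max (depth φ) (depth ψ)
  | .conj φ ψ => max (depth φ) (depth ψ)
  | .untl φ ψ => max (depth φ) (depth ψ)
  | .rels φ ψ => max (depth φ) (depth ψ)
  | .ex φ => depth φ + 1
  | .all φ => depth φ + 1
  | .next φ => depth φ
  | _ => 0

/-- An inductively computed superset of the Fischer-Ladner closure. -/
def Formula.closure : Formula P → Set (Formula P)
  | .disj φ ψ => insert (.disj φ ψ) (closure φ ∪ closure ψ)
  | .conj φ ψ => insert (.conj φ ψ) (closure φ ∪ closure ψ)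
  | .untl φ ψ => insert (.untl φ ψ) (insert (.next (.untl φ ψ)) (closure φ ∪ closure ψ))
  | .rels φ ψ => insert (.rels φ ψ) (insert (.next (.rels φ ψ)) (closure φ ∪ closure ψ))
  | .ex φ => insert (.ex φ) (closure φ)
  | .all φ => insert (.all φ) (closure φ)
  | .next φ => insert (.next φ) (closure φ)
  | .tt => {.tt}
  | .ff => {.ff}
  | .atom p => {.atom p}
  | .natom p => {.natom p}

theorem Formula.self_mem_closure (φ : Formula P) : φ ∈ φ.closure := by
  cases φ <;> simp [closure]

theorem Formula.closure_finite (φ : Formula P) : φ.closure.Finite := by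
  induction φ <;> simp_all [closure]

/-- Transitivity makes the recursively computed set closed under every generator of `FL`; finiteness
of `FL` follows. -/
theorem Formula.closure_subset {φ χ : Formula P} (h : χ ∈ φ.closure) :
    χ.closure ⊆ φ.closure := by
  induction φ with
  | tt | ff | atom | natom => simp only [closure, Set.mem_singleton_iff] at h; subst h; rfl
  | next φ ih | ex φ ih | all φ ih =>
    rcases h with rfl | h
    · rfl
    · exact (ih h).trans (Set.subset_insert _ _)
  | disj φ ψ ih₁ ih₂ | conj φ ψ ih₁ ih₂ =>
    rcases h with rfl | h | h
    · rfl
    · exact (ih₁ h).trans (by intro x hx; simp [closure, hx])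
    · exact (ih₂ h).trans (by intro x hx; simp [closure, hx])
  | untl φ ψ ih₁ ih₂ | rels φ ψ ih₁ ih₂ =>
    rcases h with rfl | rfl | h | h
    · rfl
    · intro x hx
      simp only [closure, Set.mem_insert_iff, Set.mem_union] at hx ⊢
      tauto
    · exact (ih₁ h).trans (by intro x hx; simp [closure, hx])
    · exact (ih₂ h).trans (by intro x hx; simp [closure, hx])

theorem FL.mem_closure {ϑ φ : Formula P} (h : FL ϑ φ) : φ ∈ ϑ.closure := by
  induction h with
  | self => exact ϑ.self_mem_closure
  | _ _ ih =>
    exact Formula.closure_subset ih (by simp [Formula.closure, Formula.self_mem_closure])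

theorem FL.finite (ϑ : Formula P) : {φ | FL ϑ φ}.Finite :=
  ϑ.closure_finite.subset fun _ h => h.mem_closure

theorem FL.depth_le {ϑ φ : Formula P} (h : FL ϑ φ) : φ.depth ≤ ϑ.depth := by
  induction h <;> simp_all [Formula.depth] <;> omega

end Basics

/-! ### Suffixes, fixpoint expansions and construction of paths -/

section Paths

variable {P : Type} {S : Type u} {T : TransitionSystem P S}

theorem TransitionSystem.Path.suffix_zero (π : T.Path) : π.suffix 0 = π :=
  Subtype.ext (funext fun i => by simp [TransitionSystem.Path.suffix])

theorem TransitionSystem.Path.suffix_suffix (π : T.Path) (a b : ℕ) :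
    (π.suffix a).suffix b = π.suffix (a + b) :=
  Subtype.ext (funext fun i => by simp [TransitionSystem.Path.suffix, Nat.add_assoc])

theorem TransitionSystem.Path.step (π : T.Path) (i : ℕ) : T.step (π.at i) (π.at (i + 1)) :=
  π.2 i

theorem models_untl_iff (π : T.Path) (φ ψ : Formula P) :
    Models T π (.untl φ ψ) ↔ Models T π ψ ∨ Models T π φ ∧ Models T π (.next (.untl φ ψ)) := by
  constructor
  · rintro ⟨k, hk, h⟩
    rcases k with _ | k
    · exact .inl (by rwa [π.suffix_zero] at hk)
    · refine .inr ⟨by simpa [π.suffix_zero] using h 0 (by omega), k, ?_, fun j hj => ?_⟩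
      · rwa [π.suffix_suffix, Nat.add_comm]
      · rw [π.suffix_suffix, Nat.add_comm]
        exact h _ (by omega)
  · rintro (h | ⟨h, k, hk, h'⟩)
    · exact ⟨0, by rwa [π.suffix_zero], by simp⟩
    · refine ⟨k + 1, by rwa [π.suffix_suffix, Nat.add_comm] at hk, fun j hj => ?_⟩
      rcases j with _ | j
      · rwa [π.suffix_zero]
      · have := h' j (by omega)
        rwa [π.suffix_suffix, Nat.add_comm] at this

theorem models_rels_iff (π : T.Path) (φ ψ : Formula P) :
    Models T π (.rels φ ψ) ↔ Models T π ψ ∧ (Models T π φ ∨ Models T π (.next (.rels φ ψ))) := by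
  constructor
  · intro h
    refine ⟨by simpa [π.suffix_zero] using h 0, ?_⟩
    by_cases hφ : Models T π φ
    · exact .inl hφ
    · refine .inr fun k => ?_
      rcases h (k + 1) with h | ⟨j, hj, h⟩
      · exact .inl (by rwa [π.suffix_suffix, Nat.add_comm])
      · rcases j with _ | j
        · exact absurd (by rwa [π.suffix_zero] at h) hφ
        · exact .inr ⟨j, by omega, by rwa [π.suffix_suffix, Nat.add_comm]⟩
  · rintro ⟨h, h'⟩ k
    rcases k with _ | k
    · exact .inl (by rwa [π.suffix_zero])
    · rcases h' with h' | h'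
      · exact .inr ⟨0, by omega, by rwa [π.suffix_zero]⟩
      · rcases h' k with h | ⟨j, hj, h⟩
        · exact .inl (by rwa [π.suffix_suffix, Nat.add_comm] at h)
        · exact .inr ⟨j + 1, by omega, by rwa [π.suffix_suffix, Nat.add_comm] at h⟩

/-- Literals and quantified formulas are state formulas. -/
theorem models_congr_of_at_eq {π π' : T.Path} (h : π.at 0 = π'.at 0) {φ : Formula P}
    (hφ : φ.IsLiteral ∨ (∃ ψ, φ = .ex ψ) ∨ ∃ ψ, φ = .all ψ) :
    Models T π φ ↔ Models T π' φ := by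
  rcases hφ with hφ | ⟨ψ, rfl⟩ | ⟨ψ, rfl⟩
  · cases φ <;> simp_all [Formula.IsLiteral, Models]
  · simp [Models, h]
  · simp [Models, h]

theorem exists_path (T : TransitionSystem P S) (s : S) : ∃ π : T.Path, π.at 0 = s := by
  choose f hf using T.total
  refine ⟨⟨fun n => f^[n] s, fun i => ?_⟩, rfl⟩
  simp only [Function.iterate_succ_apply']
  exact hf _

/-- A sequence of states that either stutters or moves along a transition, the latter infinitely
often, yields paths. -/
theorem exists_paths_of_stutter (T : TransitionSystem P S) (s : ℕ → S) (M : ℕ → Prop)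
    (hM : ∀ i, ∃ j ≥ i, M j) (h₁ : ∀ i, M i → T.step (s i) (s (i + 1)))
    (h₀ : ∀ i, ¬ M i → s (i + 1) = s i) :
    ∃ π : ℕ → T.Path, (∀ i, (π i).at 0 = s i) ∧ (∀ i, M i → π (i + 1) = (π i).suffix 1) ∧
      ∀ i, ¬ M i → π (i + 1) = π i := by
  classical
  -- The index just after the next genuine step. The path from `i` visits `s` at the iterates of
  -- `g`, which skips the stuttering.
  let g : ℕ → ℕ := fun i => Nat.find (hM i) + 1
  have g₁ : ∀ i, M i → g i = i + 1 := fun i hi => by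
    have : Nat.find (hM i) = i := (Nat.find_eq_iff _).2 ⟨⟨le_rfl, hi⟩, fun n hn h => by omega⟩
    simp [g, this]
  have g₀ : ∀ i, ¬ M i → g i = g (i + 1) := fun i hi => by
    have h := Nat.find_spec (hM (i + 1))
    have : Nat.find (hM i) = Nat.find (hM (i + 1)) := by
      refine (Nat.find_eq_iff _).2 ⟨⟨by omega, h.2⟩, fun n hn h' => ?_⟩
      have hne : n ≠ i := fun e => hi (e ▸ h'.2)
      exact Nat.find_min (hM (i + 1)) hn ⟨by omega, h'.2⟩
    simp [g, this]
  -- Induction on the number `k` of stuttering steps before the genuine one.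
  have hstep : ∀ k i, g i = i + k + 1 → T.step (s i) (s (g i)) := by
    intro k
    induction k with
    | zero =>
      intro i hi
      by_cases hMi : M i
      · rw [hi]; exact h₁ i hMi
      · have := Nat.find_spec (hM (i + 1))
        have := g₀ i hMi
        simp only [g] at *
        omega
    | succ k ih =>
      intro i hi
      by_cases hMi : M i
      · have := g₁ i hMi
        omega
      · rw [g₀ i hMi, ← h₀ i hMi]
        exact ih _ (by rw [← g₀ i hMi]; omega)
  have hstep' : ∀ i, T.step (s i) (s (g i)) := fun i => by
    have := Nat.find_spec (hM i)
    exact hstep (g i - i - 1) i (by simp only [g]; omega)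
  refine ⟨fun i => ⟨fun k => s (g^[k] i), fun k => ?_⟩, fun i => rfl, fun i hi => ?_,
    fun i hi => ?_⟩
  · show T.step (s (g^[k] i)) (s (g^[k + 1] i))
    rw [Function.iterate_succ_apply']
    exact hstep' _
  · refine Subtype.ext (funext fun k => ?_)
    show s (g^[k] (i + 1)) = s (g^[1 + k] i)
    rw [Nat.add_comm 1 k, Function.iterate_succ_apply, g₁ i hi]
  · refine Subtype.ext (funext fun k => ?_)
    rcases k with _ | k
    · exact h₀ i hi
    · simp only [Function.iterate_succ_apply]
      rw [g₀ i hi]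

end Paths

/-! ### Sequences -/

/-- Dependent choice with an invariant `p`. It builds the runs, threads and traces below. -/
theorem exists_seq {α : Type*} {p : ℕ → α → Prop} {r : ℕ → α → α → Prop}
    (h : ∀ i x, p i x → ∃ y, p (i + 1) y ∧ r i x y) {x : α} (hx : p 0 x) :
    ∃ f : ℕ → α, f 0 = x ∧ (∀ i, p i (f i)) ∧ ∀ i, r i (f i) (f (i + 1)) := by
  choose! F hF using h
  let f : ℕ → α := fun n => Nat.rec x (fun i y => F i y) n
  have hf : ∀ i, p i (f i) := fun i => by
    induction i with
    | zero => exact hx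
    | succ i ih => exact (hF i _ ih).1
  exact ⟨f, rfl, hf, fun i => (hF i _ (hf i)).2⟩

/-- The least value attained from `i` on is never left again. It is applied to ranks of formulas, to
measures of configurations and to selection times of paths. -/
theorem eventually_const_of_antitone {f : ℕ → ℕ} {i : ℕ} (h : ∀ j ≥ i, f (j + 1) ≤ f j) :
    ∃ k ≥ i, ∀ j ≥ k, f j = f k := by
  classical
  have hmono : ∀ j ≥ i, ∀ d, f (j + d) ≤ f j := fun j hj d => by
    induction d with
    | zero => exact le_rfl
    | succ d ih => exact (h (j + d) (by omega)).trans ih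
  have hex : ∃ v, ∃ j ≥ i, f j = v := ⟨_, i, le_rfl, rfl⟩
  obtain ⟨k, hk, hv⟩ := Nat.find_spec hex
  refine ⟨k, hk, fun j hj => le_antisymm ?_ ?_⟩
  · simpa [Nat.add_sub_cancel' hj] using hmono k hk (j - k)
  · rw [hv]
    exact Nat.find_min' hex ⟨j, by omega, rfl⟩

/-- A thread with infinitely many modal steps is eventually confined to `χ` and `X χ` for a formula
`χ` of the form `φ U ψ` or `φ R ψ`. -/
theorem thread_tail {P : Type} {f : ℕ → Formula P} {M : ℕ → Prop} (hM : ∀ i, ∃ j ≥ i, M j)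
    (h₁ : ∀ i, M i → f i = .next (f (i + 1)))
    (h₀ : ∀ i, ¬ M i → f (i + 1) = f i ∨ (f (i + 1)).rank < (f i).rank ∨
      ((f i).isFix ∧ f (i + 1) = .next (f i))) :
    ∃ χ i, χ.isFix ∧ f i = χ ∧ ∀ j ≥ i, f j = χ ∨ f j = .next χ := by
  have hle : ∀ i, (f (i + 1)).rank ≤ (f i).rank := fun i => by
    by_cases hi : M i
    · rw [h₁ i hi]; simp [Formula.rank]
    · rcases h₀ i hi with h | h | ⟨h, h'⟩
      · rw [h]
      · exact h.le
      · rw [h']; simp [Formula.rank, h]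
  obtain ⟨k, -, hk⟩ := eventually_const_of_antitone (f := fun i => (f i).rank) (i := 0)
    fun j _ => hle j
  obtain ⟨i, hi, hMi⟩ := hM k
  -- Stripping `X` lowers the rank by one unless a fixpoint formula is underneath; the rank is
  -- already constant here.
  have hfix : (f (i + 1)).isFix := by
    have h1 := hk i hi
    have h2 := hk (i + 1) (by omega)
    simp only [h₁ i hMi, Formula.rank] at h1
    by_contra hc
    simp only [hc] at h1
    simp at h1
    omega
  refine ⟨f (i + 1), i + 1, hfix, rfl, fun j hj => ?_⟩
  induction j, hj using Nat.le_induction with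
  | base => exact .inl rfl
  | succ j hj ih =>
    by_cases hMj : M j
    · have := h₁ j hMj
      rcases ih with ih | ih
      · rw [← ih, this] at hfix
        simp [Formula.isFix] at hfix
      · rw [ih] at this
        exact .inl (by injection this with h; exact h.symm)
    · rcases h₀ j hMj with h | h | ⟨h, h'⟩
      · rwa [h]
      · have h1 := hk j (by omega)
        have h2 := hk (j + 1) (by omega)
        omega
      · rcases ih with ih | ih
        · exact .inr (by rw [h', ih])
        · rw [ih] at h
          simp [Formula.isFix] at h

/-- A thread confined to `χ` and `X χ` unfolds `χ` at every suffix of the path. -/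
theorem exists_unfolding {P : Type} {S : Type u} {T : TransitionSystem P S} {f : ℕ → Formula P}
    {M : ℕ → Prop} (hM : ∀ i, ∃ j ≥ i, M j) (h₁ : ∀ i, M i → f i = .next (f (i + 1)))
    {χ : Formula P} (hχ : χ.isFix) {i : ℕ} (hi : f i = χ) (hf : ∀ j ≥ i, f j = χ ∨ f j = .next χ)
    {π : ℕ → T.Path} (hπ₁ : ∀ j ≥ i, M j → π (j + 1) = (π j).suffix 1)
    (hπ₀ : ∀ j ≥ i, ¬ M j → π (j + 1) = π j) (k : ℕ) :
    ∃ j ≥ i, f j = χ ∧ f (j + 1) = .next χ ∧ π j = (π i).suffix k := by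
  classical
  have hne : χ ≠ .next χ := by rintro h; rw [h] at hχ; simp [Formula.isFix] at hχ
  -- Up to the next modal step `l` the path rests. At `l` the formula must be `X χ`, since a
  -- fixpoint formula has no `X` to strip, so the passage from `χ` to `X χ` happened on this very
  -- path.
  have key : ∀ j ≥ i, f j = χ → (∃ l ≥ j, f l = χ ∧ f (l + 1) = .next χ ∧ π l = π j) ∧
      ∃ l ≥ j, f l = χ ∧ π l = (π j).suffix 1 := by
    intro j hj hfj
    obtain ⟨hl, hMl⟩ := Nat.find_spec (hM j)
    set l := Nat.find (hM j) with hldef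
    have hnM : ∀ n, j ≤ n → n < l → ¬ M n := fun n hn hnl hMn =>
      Nat.find_min (hM j) hnl ⟨hn, hMn⟩
    have hconst : ∀ n, j ≤ n → n ≤ l → π n = π j := by
      intro n hn
      induction n, hn using Nat.le_induction with
      | base => exact fun _ => rfl
      | succ n hn ih =>
        intro hnl
        rw [hπ₀ n (by omega) (hnM n hn (by omega))]
        exact ih (by omega)
    have hfl : f l = .next χ := by
      rcases hf l (by omega) with h | h
      · have := h₁ l hMl
        rw [h] at this
        rw [this] at hχ
        simp [Formula.isFix] at hχ
      · exact h
    refine ⟨?_, l + 1, by omega, ?_, ?_⟩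
    · by_contra hc
      push Not at hc
      have : ∀ n, j ≤ n → n ≤ l → f n = χ := by
        intro n hn
        induction n, hn using Nat.le_induction with
        | base => exact fun _ => hfj
        | succ n hn ih =>
          intro hnl
          rcases hf (n + 1) (by omega) with h | h
          · exact h
          · exact absurd (hconst n hn (by omega)) (hc n hn (ih (by omega)) h)
      rw [this l hl le_rfl] at hfl
      exact hne hfl
    · have := h₁ l hMl
      rw [hfl] at this
      injection this with h
      exact h.symm
    · rw [hπ₁ l (by omega) hMl, hconst l hl le_rfl]
  have : ∀ k, ∃ j ≥ i, f j = χ ∧ π j = (π i).suffix k := by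
    intro k
    induction k with
    | zero => exact ⟨i, le_rfl, hi, ((π i).suffix_zero).symm⟩
    | succ k ih =>
      obtain ⟨j, hj, hfj, hπj⟩ := ih
      obtain ⟨-, l, hl, hfl, hπl⟩ := key j hj hfj
      exact ⟨l, by omega, hfl, by rw [hπl, hπj, (π i).suffix_suffix]⟩
  obtain ⟨j, hj, hfj, hπj⟩ := this k
  obtain ⟨⟨l, hl, hfl, hfl', hπl⟩, -⟩ := key j hj hfj
  exact ⟨l, by omega, hfl, hfl', hπl.trans hπj⟩

/-! ### Rules, moves and connections -/

section Rules

variable {P : Type}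

/-- The rank is designed so that deferring a fixpoint formula is the only way in which a principal
formula does not lose rank, as `thread_tail` requires. -/
theorem Rule.rank_lt {q : Quantifier} {χ : Formula P} {ds ls} (h : Rule q χ ds ls)
    {d : Descendant P} (hd : d ∈ ds) {f : Formula P} (hf : f ∈ d.fresh) :
    f.rank < χ.rank ∨ (χ.isFix ∧ f = .next χ) := by
  cases h <;> simp at hd
  case A_conj | A_untl | A_rels | E_ex | E_all =>
    rcases hd with rfl | rfl <;> simp at hf <;> (try rcases hf with rfl | rfl) <;>
      simp_all [Formula.rank, Formula.isFix]
  all_goals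
    subst hd
    simp at hf
    try rcases hf with rfl | rfl
  all_goals simp_all [Formula.rank, Formula.isFix]

theorem Formula.IsLiteral.weight_pos {ℓ : Formula P} (h : ℓ.IsLiteral) : 0 < ℓ.weight := by
  cases ℓ <;> simp_all [IsLiteral, weight]

theorem Rule.weight_pos {q : Quantifier} {χ : Formula P} {ds ls} (h : Rule q χ ds ls) :
    0 < χ.weight := by
  cases h <;> first | exact Nat.succ_pos _ | exact Formula.IsLiteral.weight_pos ‹_›

/-- Formulas `X φ` weigh nothing, so unfolding a fixpoint formula loses weight too. The sum runs
over a set because the two fresh formulas may coincide. -/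
theorem Rule.weight_lt {q : Quantifier} {χ : Formula P} {ds ls} (h : Rule q χ ds ls)
    {d : Descendant P} (hd : d ∈ ds) :
    ∃ s : Finset (Formula P), d.fresh = (s : Set (Formula P)) ∧ ∑ f ∈ s, f.weight < χ.weight := by
  classical
  have hpair : ∀ φ ψ : Formula P, ∑ f ∈ ({φ, ψ} : Finset _), f.weight ≤ φ.weight + ψ.weight :=
    fun φ ψ => by
      by_cases e : φ = ψ
      · simp [e]
      · rw [Finset.sum_pair e]
  have h1 : ∀ φ : Formula P, φ.weight < χ.weight →
      ∃ s : Finset (Formula P), ({φ} : Set _) = (s : Set (Formula P)) ∧ ∑ f ∈ s, f.weight < χ.weight :=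
    fun φ hφ => ⟨{φ}, by simp, by simpa⟩
  have h2 : ∀ φ ψ : Formula P, φ.weight + ψ.weight < χ.weight →
      ∃ s : Finset (Formula P), ({φ, ψ} : Set _) = (s : Set (Formula P)) ∧ ∑ f ∈ s, f.weight < χ.weight :=
    fun φ ψ hφ => ⟨{φ, ψ}, by simp, (hpair φ ψ).trans_lt hφ⟩
  have h0 : 0 < χ.weight →
      ∃ s : Finset (Formula P), (∅ : Set _) = (s : Set (Formula P)) ∧ ∑ f ∈ s, f.weight < χ.weight :=
    fun hφ => ⟨∅, by simp, by simpa⟩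
  cases h <;> simp only [List.mem_cons, List.not_mem_nil, or_false] at hd
  case A_lit_drop hℓ => subst hd; exact h0 hℓ.weight_pos
  case E_lit hℓ => subst hd; exact h0 hℓ.weight_pos
  case A_conj | A_untl | A_rels | E_ex | E_all =>
    rcases hd with rfl | rfl <;>
    first
      | exact h1 _ (by simp only [Formula.weight]; omega)
      | exact h2 _ _ (by simp only [Formula.weight]; omega)
      | exact h0 (by simp only [Formula.weight]; omega)
  all_goals
    subst hd
    first
      | exact h1 _ (by simp only [Formula.weight]; omega)
      | exact h2 _ _ (by simp only [Formula.weight]; omega)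
      | exact h0 (by simp only [Formula.weight]; omega)

theorem Rule.length_le {q : Quantifier} {χ : Formula P} {ds ls} (h : Rule q χ ds ls) :
    ds.length ≤ 2 := by
  cases h <;> simp

theorem Rule.isNext_eq_false {q : Quantifier} {χ : Formula P} {ds ls} (h : Rule q χ ds ls) :
    χ.isNext = false := by
  cases h <;> first | rfl | (cases χ <;> simp_all [Formula.IsLiteral, Formula.isNext])

theorem Rule.fl {ϑ : Formula P} {q : Quantifier} {χ : Formula P} {ds ls} (h : Rule q χ ds ls)
    (hχ : FL ϑ χ) {d : Descendant P} (hd : d ∈ ds) {f : Formula P} (hf : f ∈ d.fresh) :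
    FL ϑ f := by
  cases h <;> simp at hd
  case A_conj =>
    rcases hd with rfl | rfl <;> simp at hf <;> subst hf
    · exact hχ.conj_left
    · exact hχ.conj_right
  case A_untl =>
    rcases hd with rfl | rfl <;> simp at hf <;> rcases hf with rfl | rfl
    exacts [hχ.untl_right, hχ.untl_left, hχ.untl_right, hχ.untl_next]
  case A_rels =>
    rcases hd with rfl | rfl <;> simp at hf
    · subst hf; exact hχ.rels_right
    · rcases hf with rfl | rfl
      exacts [hχ.rels_left, hχ.rels_next]
  case E_ex =>
    rcases hd with rfl | rfl <;> simp at hf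
    subst hf; exact hχ.ex_arg
  case E_all =>
    rcases hd with rfl | rfl <;> simp at hf
    subst hf; exact hχ.all_arg
  all_goals
    subst hd
    simp at hf
    try rcases hf with rfl | rfl
  all_goals first
    | exact hχ.disj_left | exact hχ.disj_right | exact hχ.conj_left | exact hχ.conj_right
    | exact hχ.untl_left | exact hχ.untl_right | exact hχ.untl_next
    | exact hχ.rels_left | exact hχ.rels_right | exact hχ.rels_next
    | exact hχ.ex_arg | exact hχ.all_arg

theorem Rule.lits {q : Quantifier} {χ : Formula P} {ds ls} (h : Rule q χ ds ls) {ℓ : Formula P}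
    (hℓ : ℓ ∈ ls) : ℓ = χ ∧ χ.IsLiteral := by
  cases h <;> simp_all

/-- A descendant without side formulas comes from removing a path quantifier. This strict drop is
why a trace enters spawned blocks only finitely often. -/
theorem Rule.depth_le {q : Quantifier} {χ : Formula P} {ds ls} (h : Rule q χ ds ls)
    {d : Descendant P} (hd : d ∈ ds) {f : Formula P} (hf : f ∈ d.fresh) :
    f.depth ≤ χ.depth ∧ (d.keeps = false → f.depth < χ.depth) := by
  cases h <;> simp at hd
  case A_conj | A_untl | A_rels | E_ex | E_all =>
    rcases hd with rfl | rfl <;> simp at hf <;> (try rcases hf with rfl | rfl) <;>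
      simp_all [Formula.depth]
  all_goals
    subst hd
    simp at hf
    try rcases hf with rfl | rfl
  all_goals simp_all [Formula.depth]

theorem Rule.quant_eq {q : Quantifier} {χ : Formula P} {ds ls} (h : Rule q χ ds ls)
    {d : Descendant P} (hd : d ∈ ds) (hk : d.keeps = true) : d.quant = q := by
  cases h <;> simp at hd
  case A_conj | A_untl | A_rels | E_ex | E_all =>
    rcases hd with rfl | rfl <;> simp_all
  all_goals subst hd; simp_all

/-- The modal moves. -/
def Move.IsModal : Move P → Prop
  | .modal₀ => True
  | .modal₁ _ => True
  | _ => False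

/-- The links along which the side formulas survive. -/
def Link.Keeps : Link P → Prop
  | .descend d => d.keeps = true
  | _ => True

theorem nextSet_injective : Function.Injective (nextSet (P := P)) :=
  Set.image_injective.2 fun _ _ h => by injection h

theorem isNext_of_mem_nextSet {Γ : Set (Formula P)} {f : Formula P} (h : f ∈ nextSet Γ) :
    f.isNext = true := by
  obtain ⟨g, -, rfl⟩ := h
  rfl

theorem next_mem_nextSet {Γ : Set (Formula P)} {f : Formula P} :
    .next f ∈ nextSet Γ ↔ f ∈ Γ :=
  ⟨fun ⟨g, hg, e⟩ => by injection e with e; exact e ▸ hg, fun h => ⟨f, h, rfl⟩⟩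

/-- Where a modal rule applies, all formulas begin with `X` and `E ∅` is absent, so no other rule
does. The kind of a move is therefore determined by the configuration. -/
theorem Step.isModal_iff {C C' : Configuration P} {m : Move P} (h : Step C m C') :
    m.IsModal ↔ C.Modal₀Applies ∨ C.Modal₁Applies := by
  have aux : (C.Modal₀Applies ∨ C.Modal₁Applies) → ∀ B ∈ C.blocks,
      (∀ f ∈ B.body, f.isNext = true) ∧ B ≠ ⟨.E, ∅⟩ := by
    rintro (h | h) B hB
    · obtain ⟨Γ, rfl⟩ := h.2 B hB
      exact ⟨fun f hf => isNext_of_mem_nextSet hf, by simp⟩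
    · obtain ⟨Γ, rfl | ⟨hΓ, rfl⟩⟩ := h.2 B hB
      · exact ⟨fun f hf => isNext_of_mem_nextSet hf, by simp⟩
      · exact ⟨fun f hf => isNext_of_mem_nextSet hf, by simpa [nextSet] using hΓ.ne_empty⟩
  cases h with
  | expand q χ Γ ds ls hr hχ hC =>
    refine ⟨False.elim, fun h => ?_⟩
    have := (aux h _ hC).1 χ (by simp)
    rw [hr.isNext_eq_false] at this
    simp at this
  | ett hC => exact ⟨False.elim, fun h => ((aux h _ hC).2 rfl).elim⟩
  | modal₀ hC => exact ⟨fun _ => .inl hC, fun _ => trivial⟩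
  | modal₁ Δ hC hΔ => exact ⟨fun _ => .inr hC, fun _ => trivial⟩

theorem Configuration.Modal₁Applies.not_modal₀ {C : Configuration P} (h : C.Modal₁Applies) :
    ¬ C.Modal₀Applies := fun h' => by
  obtain ⟨B, hB, hq⟩ := h.1
  obtain ⟨Γ, rfl⟩ := h'.2 B hB
  simp at hq

theorem Step.eq_modal₁ {C C' : Configuration P} {m : Move P} (h : Step C m C')
    (hC : C.Modal₁Applies) : ∃ Δ, m = .modal₁ Δ ∧ ⟨.E, nextSet Δ⟩ ∈ C.blocks ∧
      C' = ⟨insert ⟨.E, Δ⟩ C.unnextA, ∅⟩ := by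
  have hm := h.isModal_iff.2 (.inr hC)
  cases h with
  | expand => exact hm.elim
  | ett => exact hm.elim
  | modal₀ h => exact absurd h hC.not_modal₀
  | modal₁ Δ hC' hΔ => exact ⟨Δ, rfl, hΔ, rfl⟩

/-- The successor determines the move of player 1. -/
theorem Step.modal₁_unique {C C' : Configuration P} {m m' : Move P} (h : Step C m C')
    (h' : Step C m' C') (hC : C.Modal₁Applies) : m = m' := by
  obtain ⟨Δ, rfl, -, e⟩ := h.eq_modal₁ hC
  obtain ⟨Δ', rfl, -, e'⟩ := h'.eq_modal₁ hC
  have : (⟨.E, Δ⟩ : Block P) ∈ insert ⟨.E, Δ'⟩ C.unnextA := by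
    have e : insert ⟨.E, Δ⟩ C.unnextA = insert ⟨.E, Δ'⟩ C.unnextA :=
      congrArg Configuration.blocks (e.symm.trans e')
    exact e ▸ Set.mem_insert _ _
  rcases this with h | ⟨Γ, -, h⟩
  · injection h with _ h
    rw [h]
  · simp at h

theorem Step.blocks_nonempty {C C' : Configuration P} {m : Move P} (h : Step C m C') :
    C.blocks.Nonempty := by
  cases h with
  | expand q χ Γ ds ls hr hχ hC => exact ⟨_, hC⟩
  | ett hC => exact ⟨_, hC⟩
  | modal₀ hC => exact hC.1
  | modal₁ Δ hC hΔ => exact ⟨_, hΔ⟩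

theorem Step.lits_subset {C C' : Configuration P} {m : Move P} (h : Step C m C')
    (hm : ¬ m.IsModal) : C.lits ⊆ C'.lits := by
  cases h with
  | expand q χ Γ ds ls hr hχ hC => exact Set.subset_union_left
  | ett hC => exact subset_rfl
  | modal₀ hC => exact (hm trivial).elim
  | modal₁ Δ hC hΔ => exact (hm trivial).elim

/-- Every block has an origin, and by `BlockConn.exists_pred` so has every formula. Traces and
threads that start late can thus be extended back to the beginning of the play. -/
theorem Step.exists_pred {C C' : Configuration P} {m : Move P} (h : Step C m C') {B' : Block P}
    (hB' : B' ∈ C'.blocks) : ∃ B ∈ C.blocks, ∃ k, BlockConn m B k B' := by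
  cases h with
  | expand q χ Γ ds ls hr hχ hC =>
    rcases hB' with h | ⟨d, hd, rfl⟩
    · exact ⟨B', h.1, .copy, .expand_copy _ _ _ _ _ _ h.2⟩
    · exact ⟨_, hC, .descend d, .expand_descend _ _ _ _ _ _ hd⟩
  | ett hC => exact ⟨B', hB'.1, .copy, .ett_copy _ hB'.2⟩
  | modal₀ hC =>
    obtain ⟨Γ, hΓ, rfl⟩ := hB'
    exact ⟨_, hΓ, .modal, .modal₀ _⟩
  | modal₁ Δ hC hΔ =>
    rcases hB' with rfl | ⟨Γ, hΓ, rfl⟩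
    · exact ⟨_, hΔ, .modal, .modal₁_E _⟩
    · exact ⟨_, hΓ, .modal, .modal₁_A _ _⟩

theorem BlockConn.exists_pred {m : Move P} {B B' : Block P} {k : Link P} (h : BlockConn m B k B')
    {f' : Formula P} (hf : f' ∈ B'.body) : ∃ f ∈ B.body, FormulaConn m k f f' := by
  cases h with
  | expand_copy => exact ⟨f', hf, .copy _ _⟩
  | ett_copy => exact ⟨f', hf, .copy _ _⟩
  | modal₀ Γ => exact ⟨.next f', next_mem_nextSet.2 hf, .modal _ _⟩
  | modal₁_A Δ Γ => exact ⟨.next f', next_mem_nextSet.2 hf, .modal _ _⟩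
  | modal₁_E Δ => exact ⟨.next f', next_mem_nextSet.2 hf, .modal _ _⟩
  | expand_descend q χ Γ ds ls d hd =>
    rcases hf with hf | ⟨hk, hf⟩
    · exact ⟨χ, .inl rfl, .principal _ _ _ _ _ _ _ hf⟩
    · exact ⟨f', .inr hf, .side _ _ _ _ _ _ hk _ hf⟩

theorem BlockConn.isModal_iff {m : Move P} {B B' : Block P} {k : Link P}
    (h : BlockConn m B k B') : m.IsModal ↔ k = .modal := by
  cases h <;> simp [Move.IsModal]

/-- The dynamics of formulas along a connection. -/
theorem Step.formula_cases {C C' : Configuration P} {m : Move P} (h : Step C m C')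
    {B B' : Block P} {k : Link P} (hB : BlockConn m B k B') {f f' : Formula P}
    (hf : FormulaConn m k f f') : (m.IsModal → f = .next f') ∧
      (¬ m.IsModal → f' = f ∨ f'.rank < f.rank ∨ (f.isFix ∧ f' = .next f)) := by
  rw [hB.isModal_iff]
  cases hf with
  | copy => simp
  | modal => simp
  | side => simp
  | principal q χ Γ ds ls d ψ hψ =>
    simp only [reduceCtorEq, IsEmpty.forall_iff, not_false_eq_true, forall_const, true_and]
    cases hB with
    | expand_descend _ _ _ _ _ _ hd =>
      cases h with
      | expand _ _ _ _ _ hr => exact .inr (hr.rank_lt hd hψ)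

end Rules

/-! ### Termination of the non-modal rules -/

section Measure

variable {P : Type}

/-- The weight of a block. -/
noncomputable def Block.weight (B : Block P) : ℕ := ∑ᶠ f ∈ B.body, f.weight

/-- A measure that decreases along the non-modal rules. -/
noncomputable def Configuration.measure (C : Configuration P) : ℕ :=
  ∑ᶠ B ∈ C.blocks, 3 ^ B.weight

theorem Configuration.IsFor.body_finite {ϑ : Formula P} {C : Configuration P} (h : C.IsFor ϑ)
    {B : Block P} (hB : B ∈ C.blocks) : B.body.Finite :=
  (FL.finite ϑ).subset (h.body_subset B hB)

theorem Configuration.IsFor.blocks_finite {ϑ : Formula P} {C : Configuration P}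
    (h : C.IsFor ϑ) : C.blocks.Finite := by
  have h1 := ((FL.finite ϑ).finite_subsets.image (Block.mk .A)).union
    ((FL.finite ϑ).finite_subsets.image (Block.mk .E))
  refine h1.subset fun B hB => ?_
  obtain ⟨q, b⟩ := B
  have := h.body_subset _ hB
  cases q
  · exact .inl ⟨b, this, rfl⟩
  · exact .inr ⟨b, this, rfl⟩

/-- Overlaps between fresh and side formulas, and omitted side formulas, can only reduce the weight
further. -/
theorem Rule.block_weight_lt {q : Quantifier} {χ : Formula P} {ds ls} (h : Rule q χ ds ls)
    {d : Descendant P} (hd : d ∈ ds) {Γ : Set (Formula P)} (hΓ : Γ.Finite) (hχ : χ ∉ Γ) :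
    (d.block Γ).weight < (⟨q, insert χ Γ⟩ : Block P).weight := by
  classical
  obtain ⟨s, hs, hlt⟩ := h.weight_lt hd
  lift Γ to Finset (Formula P) using hΓ
  have h1 : (⟨q, insert χ ↑Γ⟩ : Block P).weight = χ.weight + ∑ f ∈ Γ, f.weight := by
    simp only [Block.weight]
    rw [← Finset.coe_insert, finsum_mem_coe_finset, Finset.sum_insert (by simpa using hχ)]
  have h2 : ∃ t : Finset (Formula P), (d.block ↑Γ).body = ↑t ∧ t ⊆ s ∪ Γ := by
    have : (d.block ↑Γ).body ⊆ ↑(s ∪ Γ) := by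
      rintro f (hf | ⟨-, hf⟩)
      · rw [hs] at hf
        simp [Finset.mem_coe.1 hf]
      · simp [Finset.mem_coe.1 hf]
    obtain ⟨t, ht⟩ := ((s ∪ Γ).finite_toSet.subset this).exists_finset_coe
    exact ⟨t, ht.symm, by rw [← ht] at this; exact_mod_cast this⟩
  obtain ⟨t, ht, hsub⟩ := h2
  rw [h1, Block.weight, ht, finsum_mem_coe_finset]
  calc ∑ f ∈ t, f.weight ≤ ∑ f ∈ s ∪ Γ, f.weight := Finset.sum_le_sum_of_subset hsub
    _ ≤ ∑ f ∈ s ∪ Γ, f.weight + ∑ f ∈ s ∩ Γ, f.weight := Nat.le_add_right _ _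
    _ = ∑ f ∈ s, f.weight + ∑ f ∈ Γ, f.weight := Finset.sum_union_inter
    _ < _ := by omega

/-- A block of weight `w` is replaced by at most two lighter ones, and `2 * 3 ^ (w - 1) < 3 ^ w`;
this explains the base 3. -/
theorem Step.measure_lt {ϑ : Formula P} {C C' : Configuration P} {m : Move P} (h : Step C m C')
    (hC : C.IsFor ϑ) (hm : ¬ m.IsModal) : C'.measure < C.measure := by
  classical
  have hfin := hC.blocks_finite
  cases h with
  | modal₀ hC => exact (hm trivial).elim
  | modal₁ Δ hC hΔ => exact (hm trivial).elim
  | ett hE =>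
    simp only [Configuration.measure]
    have := finsum_mem_insert (fun B : Block P => 3 ^ B.weight) (a := ⟨.E, ∅⟩)
      (s := C.blocks \ {⟨.E, ∅⟩}) (by simp) (hfin.subset Set.sdiff_subset)
    rw [Set.insert_sdiff_singleton, Set.insert_eq_of_mem hE] at this
    rw [this]
    have : 0 < 3 ^ (⟨.E, ∅⟩ : Block P).weight := by positivity
    omega
  | expand q χ Γ ds ls hr hχ hP =>
    have hΓ : Γ.Finite := (hC.body_finite hP).subset (Set.subset_insert _ _)
    simp only [Configuration.measure]
    set p : Block P := ⟨q, insert χ Γ⟩ with hp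
    have h1 := finsum_mem_insert (fun B : Block P => 3 ^ B.weight) (a := p)
      (s := C.blocks \ {p}) (by simp) (hfin.subset Set.sdiff_subset)
    rw [Set.insert_sdiff_singleton, Set.insert_eq_of_mem hP] at h1
    set N : Finset (Block P) := (ds.map fun d => d.block Γ).toFinset with hN
    have hN' : {B | ∃ d ∈ ds, B = d.block Γ} = (N : Set (Block P)) := by
      ext B
      simp [hN, eq_comm]
    have hcard : N.card ≤ 2 := (List.toFinset_card_le _).trans (by simpa using hr.length_le)
    have hsum : ∑ B ∈ N, 3 ^ B.weight < 3 ^ p.weight := by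
      have hle : ∀ B ∈ N, 3 ^ B.weight ≤ 3 ^ (p.weight - 1) := fun B hB => by
        have : B ∈ {B | ∃ d ∈ ds, B = d.block Γ} := by rw [hN']; exact hB
        obtain ⟨d, hd, rfl⟩ := this
        have : (d.block Γ).weight < p.weight := hr.block_weight_lt hd hΓ hχ
        exact Nat.pow_le_pow_right (by norm_num) (by omega)
      have hpos : 0 < p.weight := by
        have := hr.weight_pos
        have h3 := finsum_mem_insert (fun f : Formula P => f.weight) hχ hΓ
        simp only [hp, Block.weight]
        omega
      have h4 : 3 ^ p.weight = 3 * 3 ^ (p.weight - 1) := by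
        rw [← pow_succ']
        congr 1
        omega
      have h5 := Finset.sum_le_card_nsmul N _ _ hle
      have h6 : 0 < 3 ^ (p.weight - 1) := by positivity
      simp only [smul_eq_mul] at h5
      nlinarith
    -- Only an inequality, since a new block may already be present.
    have h7 : ∑ᶠ B ∈ (C.blocks \ {p}) ∪ {B | ∃ d ∈ ds, B = d.block Γ}, 3 ^ B.weight ≤
        ∑ᶠ B ∈ C.blocks \ {p}, 3 ^ B.weight + ∑ B ∈ N, 3 ^ B.weight := by
      rw [hN', ← finsum_mem_coe_finset,
        ← finsum_mem_union_inter (hfin.subset Set.sdiff_subset) N.finite_toSet]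
      exact Nat.le_add_right _ _
    omega

end Measure

/-! ### Positions reached under a strategy -/

section Positions

variable {P : Type} {ϑ : Formula P}

/-- A node together with the list of the nodes visited before. -/
abbrev Position (ϑ : Formula P) : Type := List (Goals ϑ) × Goals ϑ

/-- The configuration at a position. -/
abbrev Position.config (p : Position ϑ) : Configuration P := p.2.1

/-- A move from `p` to `p'` that agrees with the strategy. -/
def Succ (σ : (satGame ϑ).Strategy) (p : Position ϑ) (m : Move P) (p' : Position ϑ) : Prop :=
  Step p.config m p'.config ∧ p'.1 = p.1 ++ [p.2] ∧
    (¬ p.config.Modal₁Applies → (m, p'.2) = σ.choose p.1 p.2)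

/-- The positions reached by plays that conform to the strategy. -/
inductive Reach (σ : (satGame ϑ).Strategy) : Position ϑ → Prop
  | init : Reach σ ([], initialGoal ϑ)
  | step {p q : Position ϑ} {m : Move P} : Reach σ p → Succ σ p m q → Reach σ q

/-- The sequence of blocks and links is that of a bad trace. -/
def BadSeq (ϑ : Formula P) (mv : ℕ → Move P) (blk : ℕ → Block P) (lnk : ℕ → Link P) : Prop :=
  ((∃ i, ∀ j ≥ i, (blk j).quant = .E) ∧ ∃ f : ℕ → Formula P, (∀ i, f i ∈ (blk i).body) ∧
      (∀ i, FormulaConn (mv i) (lnk i) (f i) (f (i + 1))) ∧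
      ∃ φ ψ, FL ϑ (.untl φ ψ) ∧ ∀ i, ∃ j ≥ i, f j = .untl φ ψ) ∨
    ((∃ i, ∀ j ≥ i, (blk j).quant = .A) ∧ ¬ ∃ f : ℕ → Formula P, (∀ i, f i ∈ (blk i).body) ∧
      (∀ i, FormulaConn (mv i) (lnk i) (f i) (f (i + 1))) ∧
      ∃ φ ψ, FL ϑ (.rels φ ψ) ∧ ∀ i, ∃ j ≥ i, f j = .rels φ ψ)

/-- A sequence with a new first term. -/
def consSeq {α : Type*} (a : α) (f : ℕ → α) : ℕ → α
  | 0 => a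
  | n + 1 => f n

theorem eventually_consSeq {α : Type*} {a : α} {f : ℕ → α} {p : α → Prop}
    (h : ∃ i, ∀ j ≥ i, p (f j)) : ∃ i, ∀ j ≥ i, p (consSeq a f j) := by
  obtain ⟨i, h⟩ := h
  refine ⟨i + 1, fun j hj => ?_⟩
  obtain ⟨j, rfl⟩ : ∃ k, j = k + 1 := ⟨j - 1, by omega⟩
  exact h j (by omega)

/-- Badness is a tail property: a `U`-thread extends backwards through the connection, and an
`R`-thread of the longer sequence restricts to the shorter one. -/
theorem BadSeq.cons {mv : ℕ → Move P} {blk : ℕ → Block P} {lnk : ℕ → Link P}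
    (h : BadSeq ϑ mv blk lnk) {m : Move P} {B : Block P} {k : Link P}
    (hB : BlockConn m B k (blk 0)) :
    BadSeq ϑ (consSeq m mv) (consSeq B blk) (consSeq k lnk) := by
  rcases h with ⟨hE, f, hf, hc, φ, ψ, hfl, hinf⟩ | ⟨hA, h⟩
  · obtain ⟨g, hg, hgc⟩ := hB.exists_pred (hf 0)
    refine .inl ⟨eventually_consSeq (p := fun B : Block P => B.quant = Quantifier.E) hE,
      consSeq g f, ?_, ?_, φ, ψ, hfl, fun i => ?_⟩
    · rintro (_ | i)
      exacts [hg, hf i]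
    · rintro (_ | i)
      exacts [hgc, hc i]
    · obtain ⟨j, hj, e⟩ := hinf i
      exact ⟨j + 1, by omega, e⟩
  · refine .inr ⟨eventually_consSeq (p := fun B : Block P => B.quant = Quantifier.A) hA, ?_⟩
    rintro ⟨f, hf, hc, φ, ψ, hfl, hinf⟩
    refine h ⟨fun i => f (i + 1), fun i => hf (i + 1), fun i => hc (i + 1), φ, ψ, hfl,
      fun i => ?_⟩
    obtain ⟨j, hj, e⟩ := hinf (i + 1)
    obtain ⟨j, rfl⟩ : ∃ k, j = k + 1 := ⟨j - 1, by omega⟩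
    exact ⟨j, by omega, e⟩

variable {σ : (satGame ϑ).Strategy}

/-- The recorded lists are the true histories, so a run of `Succ` from the initial position conforms
to the strategy as a play. -/
theorem history_eq {q : ℕ → Position ϑ} {mv : ℕ → Move P} {L : ℕ∞}
    (h0 : q 0 = ([], initialGoal ϑ)) (hs : ∀ i : ℕ, (i : ℕ∞) < L → Succ σ (q i) (mv i) (q (i + 1)))
    (i : ℕ) (hi : (i : ℕ∞) ≤ L) : (q i).1 = (List.range i).map fun j => (q j).2 := by
  induction i with
  | zero => simp [h0]
  | succ i ih =>
    have hlt : (i : ℕ∞) < L := lt_of_lt_of_le (by exact_mod_cast Nat.lt_succ_self i) hi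
    rw [(hs i hlt).2.1, ih hlt.le, List.range_succ, List.map_append]
    rfl

theorem exists_play {q : ℕ → Position ϑ} {mv : ℕ → Move P} {L : ℕ∞}
    (h0 : q 0 = ([], initialGoal ϑ)) (hs : ∀ i : ℕ, (i : ℕ∞) < L → Succ σ (q i) (mv i) (q (i + 1)))
    (hmax : ∀ n : ℕ, L = n → ∀ m (v : Goals ϑ), ¬ Step (q n).config m v.1) :
    ∃ ρ : (satArena ϑ).Play, (σ.Conforms (G := satGame ϑ) ρ) ∧ ρ.length = L ∧
      ρ.pos = (fun i => (q i).2) ∧ ρ.move = mv := by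
  refine ⟨⟨L, fun i => (q i).2, mv, by simp [h0]; rfl, fun i hi => (hs i hi).1, hmax⟩,
    fun i hi hV => ?_, rfl, rfl, rfl⟩
  have := (hs i hi).2.2 hV
  rw [history_eq h0 hs i hi.le] at this
  exact this

theorem Reach.exists_bad {p : Position ϑ} (h : Reach σ p) {q : ℕ → Position ϑ} {mv : ℕ → Move P}
    {blk : ℕ → Block P} {lnk : ℕ → Link P} (h0 : q 0 = p)
    (hs : ∀ i, Succ σ (q i) (mv i) (q (i + 1))) (hb : ∀ i, blk i ∈ (q i).config.blocks)
    (hc : ∀ i, BlockConn (mv i) (blk i) (lnk i) (blk (i + 1))) (hbad : BadSeq ϑ mv blk lnk) :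
    ∃ q : ℕ → Position ϑ, ∃ mv blk lnk, q 0 = ([], initialGoal ϑ) ∧
      (∀ i, Succ σ (q i) (mv i) (q (i + 1))) ∧ (∀ i, blk i ∈ (q i).config.blocks) ∧
      (∀ i, BlockConn (mv i) (blk i) (lnk i) (blk (i + 1))) ∧ BadSeq ϑ mv blk lnk := by
  induction h generalizing q mv blk lnk with
  | init => exact ⟨q, mv, blk, lnk, h0, hs, hb, hc, hbad⟩
  | @step p p' m hp hsucc ih =>
    have hb0 := hb 0
    rw [h0] at hb0
    obtain ⟨B, hB, k, hk⟩ := hsucc.1.exists_pred hb0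
    refine ih (q := consSeq p q) (mv := consSeq m mv) (blk := consSeq B blk)
      (lnk := consSeq k lnk) rfl ?_ ?_ ?_ (hbad.cons hk)
    · rintro (_ | i)
      · exact (h0.symm ▸ hsucc : Succ σ p m (q 0))
      · exact hs i
    · rintro (_ | i)
      exacts [hB, hb i]
    · rintro (_ | i)
      exacts [hk, hc i]

/-- This is what winning means from any reached position: a bad sequence starting there would be
prolonged backwards to a bad trace of a conforming play. -/
theorem not_badSeq (hσ : σ.IsWinning) {q : ℕ → Position ϑ} {mv : ℕ → Move P} {blk : ℕ → Block P}
    {lnk : ℕ → Link P} (h0 : Reach σ (q 0)) (hs : ∀ i, Succ σ (q i) (mv i) (q (i + 1)))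
    (hb : ∀ i, blk i ∈ (q i).config.blocks)
    (hc : ∀ i, BlockConn (mv i) (blk i) (lnk i) (blk (i + 1))) : ¬ BadSeq ϑ mv blk lnk := by
  intro hbad
  obtain ⟨q, mv, blk, lnk, h0, hs, hb, hc, hbad⟩ := h0.exists_bad rfl hs hb hc hbad
  obtain ⟨⟨len, pos, move, hz, hst, hm⟩, hconf, hlen, hpos, hmove⟩ := exists_play (L := ⊤) h0
    (fun i _ => hs i) (fun n h => (ENat.top_ne_natCast n h).elim)
  simp only at hlen hpos hmove
  subst hlen hpos hmove
  rcases hσ _ hconf with ⟨n, hn, -⟩ | ⟨-, hno⟩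
  · exact ENat.top_ne_natCast n hn
  · refine hno ⟨⟨blk, lnk, hb, hc⟩, ?_⟩
    rcases hbad with ⟨hE, f, hf, hfc, hU⟩ | ⟨hA, hno'⟩
    · exact .inl ⟨hE, ⟨f, hf, hfc⟩, hU⟩
    · exact .inr ⟨hA, fun ⟨⟨f, hf, hfc⟩, hR⟩ => hno' ⟨f, hf, hfc, hR⟩⟩

theorem Reach.exists_chain {p : Position ϑ} (h : Reach σ p) {q : ℕ → Position ϑ}
    {mv : ℕ → Move P} {n : ℕ} (h0 : q 0 = p) (hs : ∀ i < n, Succ σ (q i) (mv i) (q (i + 1))) :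
    ∃ q' : ℕ → Position ϑ, ∃ mv' : ℕ → Move P, ∃ n', q' 0 = ([], initialGoal ϑ) ∧ q' n' = q n ∧
      ∀ i < n', Succ σ (q' i) (mv' i) (q' (i + 1)) := by
  induction h generalizing q mv n with
  | init => exact ⟨q, mv, n, h0, rfl, hs⟩
  | @step p p' m hp hsucc ih =>
    refine ih (q := consSeq p q) (mv := consSeq m mv) (n := n + 1) rfl ?_
    rintro (_ | i) hi
    · exact (h0.symm ▸ hsucc : Succ σ p m (q 0))
    · exact hs i (by omega)

theorem Reach.blocks_eq_empty (hσ : σ.IsWinning) {p : Position ϑ} (h : Reach σ p)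
    (hp : ∀ m (v : Goals ϑ), ¬ Step p.config m v.1) : p.config.blocks = ∅ := by
  -- The chain from `p` is empty, so the moves supplied are placeholders; the result is a finite
  -- play that ends in `p`.
  obtain ⟨q, mv, n, h0, hn, hs⟩ := h.exists_chain (q := fun _ => p) (mv := fun _ => .ett) (n := 0)
    rfl (by simp)
  obtain ⟨⟨len, pos, move, hz, hst, hm⟩, hconf, hlen, hpos, hmove⟩ := exists_play (L := n) h0
    (fun i hi => hs i (by exact_mod_cast hi))
    (fun k h => by
      have : n = k := by exact_mod_cast h
      subst this
      rw [hn]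
      exact hp)
  simp only at hlen hpos hmove
  subst hlen hpos hmove
  rcases hσ _ hconf with ⟨k, hk, hb⟩ | ⟨htop, -⟩
  · have : n = k := by
      have hk' : (n : ℕ∞) = k := hk
      exact_mod_cast hk'
    subst this
    simpa [hn] using hb
  · exact (ENat.top_ne_natCast n htop.symm).elim

end Positions

/-! ### The transition system of a strategy -/

section Model

variable {P : Type} {ϑ : Formula P} (σ : (satGame ϑ).Strategy)

/-- The move prescribed by the strategy. -/
def Position.next (p : Position ϑ) : Position ϑ := (p.1 ++ [p.2], (σ.choose p.1 p.2).2)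

/-- A non-modal rule has to be applied. -/
def Position.Unsat (p : Position ϑ) : Prop :=
  ¬ p.config.Modal₁Applies ∧ ¬ p.config.Modal₀Applies ∧ ∃ m, ∃ v : Goals ϑ, Step p.config m v.1

variable {σ}

theorem exists_succ {p : Position ϑ} (h : ∃ m, ∃ v : Goals ϑ, Step p.config m v.1) :
    ∃ m p', Succ σ p m p' := by
  by_cases hm : p.config.Modal₁Applies
  · obtain ⟨m, v, h⟩ := h
    exact ⟨m, (p.1 ++ [p.2], v), h, rfl, fun h => (h hm).elim⟩
  · exact ⟨(σ.choose p.1 p.2).1, p.next σ, σ.legal p.1 p.2 hm h, rfl, fun _ => rfl⟩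

theorem Succ.eq_next {p p' : Position ϑ} {m : Move P} (h : Succ σ p m p')
    (hm : ¬ p.config.Modal₁Applies) : p' = p.next σ :=
  Prod.ext h.2.1 (congrArg Prod.snd (h.2.2 hm) :)

theorem Position.Unsat.not_isModal {p p' : Position ϑ} (hp : p.Unsat) {m : Move P}
    (h : Succ σ p m p') : ¬ m.IsModal := by
  rw [h.1.isModal_iff]
  rintro (h | h)
  exacts [hp.2.1 h, hp.1 h]

theorem Succ.isModal {p p' : Position ϑ} {m : Move P} (h : Succ σ p m p') (hp : ¬ p.Unsat) :
    m.IsModal := by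
  rw [h.1.isModal_iff]
  by_contra hc
  exact hp ⟨fun h => hc (.inr h), fun h => hc (.inl h), m, _, h.1⟩

theorem Position.Unsat.exists_succ {p : Position ϑ} (hp : p.Unsat) :
    ∃ m, Succ σ p m (p.next σ) := by
  obtain ⟨m, p', h⟩ := CTLStar.exists_succ (σ := σ) hp.2.2
  exact ⟨m, h.eq_next hp.1 ▸ h⟩

variable (σ)

theorem exists_settle (p : Position ϑ) : ∃ n, ¬ ((Position.next σ)^[n] p).Unsat := by
  induction h : p.config.measure using Nat.strong_induction_on generalizing p with
  | _ k ih =>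
    by_cases hp : p.Unsat
    · obtain ⟨m, hs⟩ := hp.exists_succ (σ := σ)
      obtain ⟨n, hn⟩ := ih _ (h ▸ hs.1.measure_lt p.2.2.1 (hp.not_isModal hs)) _ rfl
      exact ⟨n + 1, hn⟩
    · exact ⟨0, hp⟩

open Classical in
/-- The number of non-modal rules up to the next modal one. -/
noncomputable def Position.delay (p : Position ϑ) : ℕ := Nat.find (exists_settle σ p)

/-- The position at which the next modal rule is applied or the play ends. -/
noncomputable def Position.settle (p : Position ϑ) : Position ϑ :=
  (Position.next σ)^[p.delay σ] p

theorem Position.not_unsat_settle (p : Position ϑ) : ¬ (p.settle σ).Unsat := by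
  classical exact Nat.find_spec (exists_settle σ p)

variable {σ}

theorem Position.delay_eq_zero {p : Position ϑ} (hp : ¬ p.Unsat) : p.delay σ = 0 := by
  classical exact (Nat.find_eq_zero _).2 hp

theorem Position.Unsat.delay_eq {p : Position ϑ} (hp : p.Unsat) :
    p.delay σ = (p.next σ).delay σ + 1 := by
  classical exact Nat.find_comp_succ (exists_settle σ p) (exists_settle σ (p.next σ)) (by simpa)

theorem Position.settle_eq_self {p : Position ϑ} (hp : ¬ p.Unsat) : p.settle σ = p := by
  simp [settle, delay_eq_zero hp]

theorem Position.Unsat.settle_eq {p : Position ϑ} (hp : p.Unsat) :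
    p.settle σ = (p.next σ).settle σ := by
  simp only [settle, hp.delay_eq (σ := σ), Function.iterate_succ_apply]

/-- Settling uses only non-modal moves, which never discard literals. -/
theorem Reach.settle {p : Position ϑ} (hp : Reach σ p) :
    Reach σ (p.settle σ) ∧ p.config.lits ⊆ (p.settle σ).config.lits := by
  induction h : p.delay σ generalizing p with
  | zero =>
    have : p.settle σ = p := by simp [Position.settle, h]
    rw [this]
    exact ⟨hp, subset_rfl⟩
  | succ n ih =>
    have hu : p.Unsat := by
      by_contra hc
      rw [Position.delay_eq_zero hc] at h
      omega
    obtain ⟨m, hs⟩ := hu.exists_succ (σ := σ)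
    obtain ⟨h1, h2⟩ := ih (hp.step hs) (by have := hu.delay_eq (σ := σ); omega)
    rw [hu.settle_eq]
    exact ⟨h1, (hs.1.lits_subset (hu.not_isModal hs)).trans h2⟩

variable (σ)

/-- The reached positions. -/
abbrev Reached : Type := {p : Position ϑ // Reach σ p}

/-- The states of the transition system of a strategy: the reached positions at which a modal rule
is applied or the play ends. -/
def ModelState : Type u := ULift.{u} {p : Position ϑ // Reach σ p ∧ ¬ p.Unsat}

variable {σ}

/-- The position of a state. -/
def ModelState.position (s : ModelState.{u} σ) : Position ϑ := s.down.1

theorem ModelState.ext {s t : ModelState.{u} σ} (h : s.position = t.position) : s = t :=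
  ULift.ext _ _ (Subtype.ext h)

/-- The state that belongs to a reached position. -/
noncomputable def Reached.state (p : Reached σ) : ModelState.{u} σ :=
  ⟨p.1.settle σ, p.2.settle.1, p.1.not_unsat_settle σ⟩

theorem Reached.position_state (p : Reached σ) :
    (p.state : ModelState.{u} σ).position = p.1.settle σ := rfl

variable (σ)

/-- The transition system of a strategy. -/
noncomputable def model : TransitionSystem P (ModelState.{u} σ) where
  start := Reached.state ⟨_, .init⟩
  -- A successor position is settled before it counts as a state. The second alternative is a loop
  -- where the play ends, because the relation must be total.
  step s t := (∃ m, ∃ p : Reached σ, Succ σ s.position m p.1 ∧ t = p.state) ∨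
    ((∀ m p, ¬ Succ σ s.position m p) ∧ t = s)
  label s := {p | .atom p ∈ s.position.config.lits}
  total s := by
    by_cases h : ∃ m p, Succ σ s.position m p
    · obtain ⟨m, p, h⟩ := h
      exact ⟨_, .inl ⟨m, ⟨p, s.down.2.1.step h⟩, h, rfl⟩⟩
    · push Not at h
      exact ⟨s, .inr ⟨h, rfl⟩⟩

variable {σ}

/-- Labels record the positive literals of the settled configuration; its consistency takes care of
`ff` and of negative literals. -/
theorem models_of_mem_lits {p : Reached σ} {ℓ : Formula P} (hℓ : ℓ ∈ p.1.config.lits)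
    {π : (model.{u} σ).Path} (hπ : π.at 0 = p.state) : Models _ π ℓ := by
  have hmem := p.2.settle.2 hℓ
  have hlit := ((p.1.settle σ).2.2.1.lits_subset ℓ hmem).2
  have hcons := (p.1.settle σ).2.2.2
  have hlabel : ∀ a, a ∈ (model.{u} σ).label (π.at 0) ↔
      .atom a ∈ (p.1.settle σ).config.lits := fun a => by rw [hπ]; rfl
  cases ℓ <;> simp only [Formula.IsLiteral] at hlit
  case tt => trivial
  case ff => exact (hcons.1 hmem).elim
  case atom a => exact (hlabel a).2 hmem
  case natom a => exact fun h => hcons.2 a ⟨(hlabel a).1 h, hmem⟩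

/-- A run that repeats the final position of a finite play yields paths of the model. -/
theorem exists_paths_of_run {q : ℕ → Reached σ}
    (hq : ∀ i, (∃ m, Succ σ (q i).1 m (q (i + 1)).1) ∨
      ((∀ m p, ¬ Succ σ (q i).1 m p) ∧ q (i + 1) = q i)) :
    (∀ i, ∃ j ≥ i, ¬ (q j).1.Unsat) ∧ ∃ π : ℕ → (model.{u} σ).Path,
      (∀ i, (π i).at 0 = (q i).state) ∧
      (∀ i, ¬ (q i).1.Unsat → π (i + 1) = (π i).suffix 1) ∧
      ∀ i, (q i).1.Unsat → π (i + 1) = π i := by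
  have hnext : ∀ i, (q i).1.Unsat → (q (i + 1)).1 = (q i).1.next σ := fun i hi => by
    rcases hq i with ⟨m, h⟩ | ⟨h, -⟩
    · exact h.eq_next hi.1
    · obtain ⟨m, h'⟩ := hi.exists_succ (σ := σ)
      exact (h _ _ h').elim
  -- The delay until the next settled position decreases along the run.
  have hinf : ∀ i, ∃ j ≥ i, ¬ (q j).1.Unsat := by
    intro i
    induction h : (q i).1.delay σ generalizing i with
    | zero =>
      refine ⟨i, le_rfl, fun hu => ?_⟩
      have := hu.delay_eq (σ := σ)
      omega
    | succ n ih =>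
      by_cases hu : (q i).1.Unsat
      · obtain ⟨j, hj, hj'⟩ := ih (i + 1) (by
          have := hu.delay_eq (σ := σ)
          rw [hnext i hu]
          omega)
        exact ⟨j, by omega, hj'⟩
      · exact ⟨i, le_rfl, hu⟩
  obtain ⟨π, h0, h1, h2⟩ := exists_paths_of_stutter (model.{u} σ) (fun i => (q i).state)
    (fun i => ¬ (q i).1.Unsat) hinf
    (fun i hi => by
      have hpos : ((q i).state : ModelState.{u} σ).position = (q i).1 :=
        Position.settle_eq_self hi
      rcases hq i with ⟨m, h⟩ | ⟨h, e⟩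
      · exact .inl ⟨m, q (i + 1), by rwa [hpos], rfl⟩
      · exact .inr ⟨by rwa [hpos], by rw [e]⟩)
    (fun i hi => by
      refine ModelState.ext ?_
      rw [not_not] at hi
      rw [Reached.position_state, Reached.position_state, hnext i hi, hi.settle_eq])
  exact ⟨hinf, π, h0, h1, fun i hi => h2 i (not_not.2 hi)⟩

end Model

/-! ### A winning strategy yields a model -/

section FalseFormulas

variable {P : Type} {S : Type u} {T : TransitionSystem P S}

theorem Rule.exists_keeps {χ : Formula P} {ds ls} (h : Rule .E χ ds ls) :
    ∃ d ∈ ds, d.keeps = true := by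
  cases h <;> simp

theorem Formula.ne_next_self (ψ : Formula P) : ψ ≠ .next ψ := fun h => by
  have := congrArg sizeOf h
  simp at this

/-- A deferral is recognised below by the shape `.next χ` of the new formula; no direct argument of
`χ` may be mistaken for it. -/
theorem Formula.ne_next_untl_right (φ ψ : Formula P) : ψ ≠ .next (.untl φ ψ) := fun h => by
  have := congrArg Formula.rank h
  simp [Formula.rank, Formula.isFix] at this
  omega

theorem Formula.ne_next_untl_left (φ ψ : Formula P) : φ ≠ .next (.untl φ ψ) := fun h => by
  have := congrArg Formula.rank h
  simp [Formula.rank, Formula.isFix] at this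
  omega

theorem Formula.ne_next_rels_right (φ ψ : Formula P) : ψ ≠ .next (.rels φ ψ) := fun h => by
  have := congrArg Formula.rank h
  simp [Formula.rank, Formula.isFix] at this
  omega

/-- In either alternative of a rule the new formulas together imply the principal one, so falsity is
inherited. For an `R`-formula a false right argument takes precedence, whence a deferral testifies
that this argument is true. Literals and path quantifiers are listed apart, to be refuted by
`Supports`. -/
theorem Rule.exists_false_E {χ : Formula P} {ds ls} (h : Rule .E χ ds ls) {d : Descendant P}
    (hd : d ∈ ds) (hk : d.keeps = true) {π : T.Path} (hχ : ¬ Models T π χ) :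
    (∃ f ∈ d.fresh, ¬ Models T π f ∧
      ∀ φ ψ, χ = .rels φ ψ → f = .next χ → Models T π ψ) ∨ χ ∈ ls ∨
    (∃ φ, χ = .ex φ ∧ (⟨.E, {φ}, false⟩ : Descendant P) ∈ ds) ∨
    ∃ φ, χ = .all φ ∧ (⟨.A, {φ}, false⟩ : Descendant P) ∈ ds := by
  cases h
  case E_ex φ => exact .inr (.inr (.inl ⟨φ, rfl, by simp⟩))
  case E_all φ => exact .inr (.inr (.inr ⟨φ, rfl, by simp⟩))
  all_goals
    simp only [List.mem_singleton] at hd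
    subst hd
  case E_lit => exact .inr (.inl rfl)
  case E_disj_left φ ψ =>
    exact .inl ⟨φ, rfl, fun h => hχ (.inl h), by simp⟩
  case E_disj_right φ ψ =>
    exact .inl ⟨ψ, rfl, fun h => hχ (.inr h), by simp⟩
  case E_conj φ ψ =>
    by_cases hφ : Models T π φ
    · exact .inl ⟨ψ, .inr rfl, fun h => hχ ⟨hφ, h⟩, by simp⟩
    · exact .inl ⟨φ, .inl rfl, hφ, by simp⟩
  case E_untl_now φ ψ =>
    exact .inl ⟨ψ, rfl, fun h => hχ ((models_untl_iff _ _ _).2 (.inl h)), by simp⟩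
  case E_untl_later φ ψ =>
    by_cases hφ : Models T π φ
    · exact .inl ⟨_, .inr rfl, fun h => hχ ((models_untl_iff _ _ _).2 (.inr ⟨hφ, h⟩)), by simp⟩
    · exact .inl ⟨φ, .inl rfl, hφ, by simp⟩
  case E_rels_now φ ψ =>
    by_cases hψ : Models T π ψ
    · exact .inl ⟨φ, .inr rfl, fun h => hχ ((models_rels_iff _ _ _).2 ⟨hψ, .inl h⟩),
        fun φ' ψ' e _ => by injection e with _ e; exact e ▸ hψ⟩
    · exact .inl ⟨ψ, .inl rfl, hψ, fun φ' ψ' _ e => (Formula.ne_next_rels_right _ _ e).elim⟩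
  case E_rels_later φ ψ =>
    by_cases hψ : Models T π ψ
    · exact .inl ⟨_, .inr rfl, fun h => hχ ((models_rels_iff _ _ _).2 ⟨hψ, .inr h⟩),
        fun φ' ψ' e _ => by injection e with _ e; exact e ▸ hψ⟩
    · exact .inl ⟨ψ, .inl rfl, hψ, fun φ' ψ' _ e => (Formula.ne_next_rels_right _ _ e).elim⟩

/-- Dually, a false principal formula leaves some displayed block whose fresh formulas are all
false. Here the trace picks the block according to the path. -/
theorem Rule.exists_false_A {χ : Formula P} {ds ls} (h : Rule .A χ ds ls) {π : T.Path}
    (hχ : ¬ Models T π χ) :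
    (∃ d ∈ ds, d.keeps = true ∧ ∀ f ∈ d.fresh, ¬ Models T π f ∧
      ∀ φ ψ, χ = .rels φ ψ → f = .next χ → Models T π ψ) ∨ χ ∈ ls ∨
    (∃ φ, χ = .ex φ ∧ (⟨.E, {φ}, false⟩ : Descendant P) ∈ ds) ∨
    ∃ φ, χ = .all φ ∧ (⟨.A, {φ}, false⟩ : Descendant P) ∈ ds := by
  cases h
  case A_conj φ ψ =>
    by_cases hφ : Models T π φ
    · exact .inl ⟨⟨.A, {ψ}, true⟩, by simp, rfl, by
        rintro f rfl
        exact ⟨fun h => hχ ⟨hφ, h⟩, by simp⟩⟩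
    · exact .inl ⟨⟨.A, {φ}, true⟩, by simp, rfl, by
        rintro f rfl
        exact ⟨hφ, by simp⟩⟩
  case A_disj φ ψ =>
    refine .inl ⟨_, List.mem_singleton_self _, rfl, ?_⟩
    rintro f (rfl | rfl)
    · exact ⟨fun h => hχ (.inl h), by simp⟩
    · exact ⟨fun h => hχ (.inr h), by simp⟩
  case A_lit_take => exact .inr (.inl rfl)
  case A_lit_drop | A_all_drop | A_ex_drop =>
    exact .inl ⟨_, List.mem_singleton_self _, rfl, by rintro f ⟨⟩⟩
  case A_all_take φ => exact .inr (.inr (.inr ⟨φ, rfl, by simp⟩))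
  case A_ex_take φ => exact .inr (.inr (.inl ⟨φ, rfl, by simp⟩))
  case A_untl φ ψ =>
    have hψ : ¬ Models T π ψ := fun h => hχ ((models_untl_iff _ _ _).2 (.inl h))
    by_cases hφ : Models T π φ
    · refine .inl ⟨⟨.A, {ψ, .next (.untl φ ψ)}, true⟩, by simp, rfl, ?_⟩
      rintro f (rfl | rfl)
      · exact ⟨hψ, by simp⟩
      · exact ⟨fun h => hχ ((models_untl_iff _ _ _).2 (.inr ⟨hφ, h⟩)), by simp⟩
    · refine .inl ⟨⟨.A, {ψ, φ}, true⟩, by simp, rfl, ?_⟩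
      rintro f (rfl | rfl)
      · exact ⟨hψ, by simp⟩
      · exact ⟨hφ, by simp⟩
  case A_rels φ ψ =>
    by_cases hψ : Models T π ψ
    · refine .inl ⟨⟨.A, {φ, .next (.rels φ ψ)}, true⟩, by simp, rfl, fun f hf => ⟨?_,
        fun φ' ψ' e _ => by injection e with _ e; exact e ▸ hψ⟩⟩
      rcases hf with rfl | rfl
      · exact fun h => hχ ((models_rels_iff _ _ _).2 ⟨hψ, .inl h⟩)
      · exact fun h => hχ ((models_rels_iff _ _ _).2 ⟨hψ, .inr h⟩)
    · refine .inl ⟨⟨.A, {ψ}, true⟩, by simp, rfl, ?_⟩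
      rintro f rfl
      exact ⟨hψ, fun φ' ψ' _ e => (Formula.ne_next_rels_right _ _ e).elim⟩

/-- Facts about a configuration on a path, as needed for the absence of false formulas. -/
structure Configuration.Supports (C : Configuration P) (n : ℕ) (π : T.Path) : Prop where
  lits : ∀ ℓ ∈ C.lits, Models T π ℓ
  ex : ∀ φ : Formula P, φ.depth < n → ⟨.E, {φ}⟩ ∈ C.blocks → Models T π (.ex φ)
  all : ∀ φ : Formula P, φ.depth < n → ⟨.A, {φ}⟩ ∈ C.blocks → Models T π (.all φ)

theorem Descendant.block_of_not_keeps (q : Quantifier) (s Γ : Set (Formula P)) :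
    (⟨q, s, false⟩ : Descendant P).block Γ = ⟨q, s⟩ := by
  simp [Descendant.block]

/-- The bound `n` covers the block itself, so a formula under a path quantifier that is spawned from
it lies strictly below `n`, where `Supports` knows it to be true. -/
theorem Step.exists_false_E {C C' : Configuration P} {m : Move P} (h : Step C m C')
    {Γ Γ' : Set (Formula P)} {k : Link P} (hB : BlockConn m ⟨.E, Γ⟩ k ⟨.E, Γ'⟩) (hk : k.Keeps)
    {π π' : T.Path} (h₁ : m.IsModal → π' = π.suffix 1) (h₀ : ¬ m.IsModal → π' = π) {n : ℕ}
    (hC : C'.Supports n π') {f : Formula P} (hf : f ∈ Γ) (hd : f.depth ≤ n)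
    (hfalse : ¬ Models T π f) :
    ∃ f' ∈ Γ', f'.depth ≤ n ∧ ¬ Models T π' f' ∧ FormulaConn m k f f' ∧
      ∀ φ ψ, f = .rels φ ψ → f' = .next f → Models T π ψ := by
  have hcopy : ¬ m.IsModal → k = .copy → Γ = Γ' → ∃ f' ∈ Γ', f'.depth ≤ n ∧ ¬ Models T π' f' ∧
      FormulaConn m k f f' ∧ ∀ φ ψ, f = .rels φ ψ → f' = .next f → Models T π ψ := by
    rintro hm rfl rfl
    exact ⟨f, hf, hd, by rwa [h₀ hm], .copy _ _, fun φ ψ _ e => (Formula.ne_next_self _ e).elim⟩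
  generalize hb : (⟨.E, Γ⟩ : Block P) = b at hB
  generalize hb' : (⟨.E, Γ'⟩ : Block P) = b' at hB
  cases hB with
  | expand_copy =>
    exact hcopy id rfl (by have := hb.trans hb'.symm; injection this)
  | ett_copy => exact hcopy id rfl (by have := hb.trans hb'.symm; injection this)
  | modal₀ => simp at hb
  | modal₁_A => simp at hb
  | modal₁_E Δ =>
    injection hb with _ hb
    injection hb' with _ hb'
    subst hb hb'
    obtain ⟨g, hg, rfl⟩ := hf
    refine ⟨g, hg, hd, ?_, .modal _ _, fun φ ψ e => by simp at e⟩
    rw [h₁ trivial]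
    exact hfalse
  | expand_descend q χ Δ ds ls d hdmem =>
    injection hb with hq hb
    injection hb' with _ hb'
    subst hq hb
    have hπ := h₀ id
    subst hπ
    change d.keeps = true at hk
    rcases hf with rfl | hf
    · cases h with
      | expand _ _ _ _ _ hr hχ hCb =>
        rcases hr.exists_false_E hdmem hk hfalse with ⟨g, hg, hgf, hpol⟩ | hl | ⟨φ, rfl, hφ⟩ |
          ⟨φ, rfl, hφ⟩
        · refine ⟨g, ?_, ((hr.depth_le hdmem hg).1).trans hd, hgf, .principal _ _ _ _ _ _ _ hg,
            hpol⟩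
          rw [hb']
          exact .inl hg
        · exact (hfalse (hC.lits _ (.inr hl))).elim
        · exact (hfalse (hC.ex φ (by simpa [Formula.depth] using hd)
            (.inr ⟨_, hφ, (Descendant.block_of_not_keeps _ _ _).symm⟩))).elim
        · exact (hfalse (hC.all φ (by simpa [Formula.depth] using hd)
            (.inr ⟨_, hφ, (Descendant.block_of_not_keeps _ _ _).symm⟩))).elim
    · refine ⟨f, ?_, hd, hfalse, .side _ _ _ _ _ _ hk _ hf,
        fun φ ψ _ e => (Formula.ne_next_self _ e).elim⟩
      rw [hb']
      exact .inr ⟨hk, hf⟩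

theorem Step.exists_modal_A {C C' : Configuration P} {m : Move P} (h : Step C m C')
    (hm : m.IsModal) {Γ : Set (Formula P)} (hΓ : ⟨.A, Γ⟩ ∈ C.blocks) :
    ∃ Δ, Γ = nextSet Δ ∧ ⟨.A, Δ⟩ ∈ C'.blocks ∧ BlockConn m ⟨.A, Γ⟩ .modal ⟨.A, Δ⟩ := by
  cases h with
  | expand => exact hm.elim
  | ett => exact hm.elim
  | modal₀ hC =>
    obtain ⟨Δ, e⟩ := hC.2 _ hΓ
    injection e with _ e
    subst e
    exact ⟨Δ, rfl, ⟨Δ, hΓ, rfl⟩, .modal₀ _⟩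
  | modal₁ Δ₀ hC hΔ =>
    obtain ⟨Δ, e | ⟨-, e⟩⟩ := hC.2 _ hΓ
    · injection e with _ e
      subst e
      exact ⟨Δ, rfl, .inr ⟨Δ, hΓ, rfl⟩, .modal₁_A _ _⟩
    · simp at e

theorem Step.exists_false_A {C C' : Configuration P} {m : Move P} (h : Step C m C')
    {Γ : Set (Formula P)} (hΓ : ⟨.A, Γ⟩ ∈ C.blocks)
    {π π' : T.Path} (h₁ : m.IsModal → π' = π.suffix 1) (h₀ : ¬ m.IsModal → π' = π) {n : ℕ}
    (hC : C'.Supports n π') (hf : ∀ f ∈ Γ, f.depth ≤ n ∧ ¬ Models T π f) :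
    ∃ Γ' k, ⟨.A, Γ'⟩ ∈ C'.blocks ∧ BlockConn m ⟨.A, Γ⟩ k ⟨.A, Γ'⟩ ∧
      (∀ f ∈ Γ', f.depth ≤ n ∧ ¬ Models T π' f) ∧
      ∀ f f', FormulaConn m k f f' → ∀ φ ψ, f = .rels φ ψ → f' = .next f → Models T π ψ := by
  by_cases hm : m.IsModal
  · obtain ⟨Δ, rfl, hΔ, hconn⟩ := h.exists_modal_A hm hΓ
    refine ⟨Δ, .modal, hΔ, hconn, fun f hfΔ => ?_, ?_⟩
    · rw [h₁ hm]
      exact hf (.next f) (next_mem_nextSet.2 hfΔ)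
    · rintro f f' ⟨⟩ φ ψ e
      simp at e
  · have hπ := h₀ hm
    subst hπ
    have hcopy : ⟨.A, Γ⟩ ∈ C'.blocks → BlockConn m ⟨.A, Γ⟩ .copy ⟨.A, Γ⟩ →
        ∃ Γ' k, ⟨.A, Γ'⟩ ∈ C'.blocks ∧ BlockConn m ⟨.A, Γ⟩ k ⟨.A, Γ'⟩ ∧
      (∀ f ∈ Γ', f.depth ≤ n ∧ ¬ Models T π' f) ∧
      ∀ f f', FormulaConn m k f f' → ∀ φ ψ, f = .rels φ ψ → f' = .next f → Models T π' ψ := by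
      refine fun h1 h2 => ⟨Γ, .copy, h1, h2, hf, ?_⟩
      rintro f f' ⟨⟩ φ ψ _ e
      exact (Formula.ne_next_self _ e).elim
    cases h with
    | modal₀ => exact (hm trivial).elim
    | modal₁ => exact (hm trivial).elim
    | ett hE => exact hcopy ⟨hΓ, by simp⟩ (.ett_copy _ (by simp))
    | expand q χ Δ ds ls hr hχ hP =>
      by_cases hb : (⟨.A, Γ⟩ : Block P) = ⟨q, insert χ Δ⟩
      · injection hb with hq hb
        subst hq hb
        have hχf := hf χ (.inl rfl)
        rcases hr.exists_false_A hχf.2 with ⟨d, hd, hk, hg⟩ | hl | ⟨φ, rfl, hφ⟩ | ⟨φ, rfl, hφ⟩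
        · have hq := hr.quant_eq hd hk
          have hblock : d.block Δ = ⟨.A, (d.block Δ).body⟩ := by rw [← hq]; rfl
          refine ⟨(d.block Δ).body, .descend d, .inr ⟨d, hd, hblock.symm⟩, ?_, ?_, ?_⟩
          · rw [← hblock]
            exact .expand_descend _ _ _ _ _ _ hd
          · rintro f (hf' | ⟨-, hf'⟩)
            · exact ⟨(hr.depth_le hd hf').1.trans hχf.1, (hg f hf').1⟩
            · exact hf f (.inr hf')
          · intro f f' hc φ ψ e e'
            cases hc with
            | principal _ _ _ _ _ _ _ hψ => exact (hg _ hψ).2 φ ψ e e'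
            | side => exact (Formula.ne_next_self _ e').elim
        · exact (hχf.2 (hC.lits _ (.inr hl))).elim
        · exact (hχf.2 (hC.ex φ (by simpa [Formula.depth] using hχf.1)
            (.inr ⟨_, hφ, (Descendant.block_of_not_keeps _ _ _).symm⟩))).elim
        · exact (hχf.2 (hC.all φ (by simpa [Formula.depth] using hχf.1)
            (.inr ⟨_, hφ, (Descendant.block_of_not_keeps _ _ _).symm⟩))).elim
      · exact hcopy (.inl ⟨hΓ, hb⟩) (.expand_copy _ _ _ _ _ _ hb)

end FalseFormulas

/-! ### Truth of reached blocks in the model of a winning strategy -/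

section Soundness

variable {P : Type} {ϑ : Formula P}

theorem Step.isFor {C C' : Configuration P} {m : Move P} (h : Step C m C') (hC : C.IsFor ϑ)
    (hne : C'.blocks.Nonempty ∨ C'.lits.Nonempty) : C'.IsFor ϑ := by
  have hun : ∀ B ∈ C.unnextA, ∀ φ ∈ B.body, FL ϑ φ := by
    rintro B ⟨Γ, hΓ, rfl⟩ φ hφ
    exact (hC.body_subset _ hΓ _ (next_mem_nextSet.2 hφ)).next_arg
  refine ⟨hne, fun B hB φ hφ => ?_, fun ℓ hℓ => ?_⟩
  · cases h with
    | expand q χ Γ ds ls hr hχ hP =>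
      rcases hB with hB | ⟨d, hd, rfl⟩
      · exact hC.body_subset B hB.1 φ hφ
      · rcases hφ with hφ | ⟨-, hφ⟩
        · exact hr.fl (hC.body_subset _ hP χ (.inl rfl)) hd hφ
        · exact hC.body_subset _ hP φ (.inr hφ)
    | ett => exact hC.body_subset B hB.1 φ hφ
    | modal₀ => exact hun B hB φ hφ
    | modal₁ Δ hC' hΔ =>
      rcases hB with rfl | hB
      · exact (hC.body_subset _ hΔ _ (next_mem_nextSet.2 hφ)).next_arg
      · exact hun B hB φ hφ
  · cases h with
    | expand q χ Γ ds ls hr hχ hP =>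
      rcases hℓ with hℓ | hℓ
      · exact hC.lits_subset ℓ hℓ
      · obtain ⟨rfl, hl⟩ := hr.lits hℓ
        exact ⟨hC.body_subset _ hP ℓ (.inl rfl), hl⟩
    | ett => exact hC.lits_subset ℓ hℓ
    | modal₀ => exact hℓ.elim
    | modal₁ => exact hℓ.elim

/-- The result contains no literals, so it is consistent and player 1 may select any `E`-block. -/
theorem exists_step_modal₁ (v : Goals ϑ) (hv : v.1.Modal₁Applies) {Δ : Set (Formula P)}
    (hΔ : ⟨.E, nextSet Δ⟩ ∈ v.1.blocks) : ∃ v' : Goals ϑ, Step v.1 (.modal₁ Δ) v'.1 :=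
  ⟨⟨_, (Step.modal₁ v.1 Δ hv hΔ).isFor v.2.1 (.inl ⟨_, .inl rfl⟩), fun h => h.elim,
    fun _ h => h.1.elim⟩, .modal₁ v.1 Δ hv hΔ⟩

variable {σ : (satGame ϑ).Strategy}

theorem exists_succ_of_mem (hσ : σ.IsWinning) (p : Reached σ) {B : Block P}
    (hB : B ∈ p.1.config.blocks) : ∃ m p', Succ σ p.1 m p' := by
  refine exists_succ ?_
  by_contra hc
  push Not at hc
  rw [p.2.blocks_eq_empty hσ hc] at hB
  exact hB

/-- An `E`-block can be tracked until it is deleted. -/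
theorem exists_track (hσ : σ.IsWinning) (p : Reached σ) (Γ : Set (Formula P))
    (hΓ : Γ.Nonempty → ⟨.E, Γ⟩ ∈ p.1.config.blocks) :
    ∃ (p' : Reached σ) (Γ' : Set (Formula P)), (Γ'.Nonempty → ⟨.E, Γ'⟩ ∈ p'.1.config.blocks) ∧
      ((∃ m, Succ σ p.1 m p'.1) ∨ ((∀ m p', ¬ Succ σ p.1 m p') ∧ p' = p)) ∧
      (Γ.Nonempty → ∃ m k, Succ σ p.1 m p'.1 ∧ BlockConn m ⟨.E, Γ⟩ k ⟨.E, Γ'⟩ ∧ k.Keeps ∧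
        ⟨.E, Γ'⟩ ∈ p'.1.config.blocks) := by
  by_cases hne : Γ.Nonempty
  · have hB := hΓ hne
    suffices h : ∃ (m : Move P) (p' : Position ϑ) (Γ' : Set (Formula P)) (k : Link P),
        Succ σ p.1 m p' ∧ BlockConn m ⟨.E, Γ⟩ k ⟨.E, Γ'⟩ ∧ k.Keeps ∧
          ⟨.E, Γ'⟩ ∈ p'.config.blocks by
      obtain ⟨m, p', Γ', k, hs, hc, hk, hB'⟩ := h
      exact ⟨⟨p', p.2.step hs⟩, Γ', fun _ => hB', .inl ⟨m, hs⟩, fun _ => ⟨m, k, hs, hc, hk, hB'⟩⟩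
    -- At her opponent's nodes the tracked block is the one selected; elsewhere the strategy moves,
    -- and every `E`-rule retains a descendant with the side formulas.
    by_cases hm : p.1.config.Modal₁Applies
    · obtain ⟨Δ, e | ⟨-, e⟩⟩ := hm.2 _ hB
      · simp at e
      · injection e with _ e
        subst e
        obtain ⟨v, hv⟩ := exists_step_modal₁ p.1.2 hm hB
        refine ⟨_, (p.1.1 ++ [p.1.2], v), Δ, .modal, ⟨hv, rfl, fun h => (h hm).elim⟩,
          .modal₁_E _, trivial, ?_⟩
        obtain ⟨Δ', e, -, hv'⟩ := hv.eq_modal₁ hm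
        injection e with e
        subst e
        simp only [Position.config, hv']
        exact .inl rfl
    · obtain ⟨m, p', hs⟩ := exists_succ_of_mem hσ p hB
      suffices h : ∀ C C', Step C m C' → ¬ C.Modal₁Applies → ⟨.E, Γ⟩ ∈ C.blocks → ∃ Γ' k,
          BlockConn m ⟨.E, Γ⟩ k ⟨.E, Γ'⟩ ∧ k.Keeps ∧ ⟨.E, Γ'⟩ ∈ C'.blocks by
        obtain ⟨Γ', k, h⟩ := h _ _ hs.1 hm hB
        exact ⟨m, p', Γ', k, hs, h⟩
      intro C C' h hm hB
      cases h with
      | modal₁ _ hC => exact (hm hC).elim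
      | modal₀ hC =>
        obtain ⟨Δ, e⟩ := hC.2 _ hB
        simp at e
      | ett =>
        have hb : (⟨.E, Γ⟩ : Block P) ≠ ⟨.E, ∅⟩ := by simpa using hne.ne_empty
        exact ⟨Γ, .copy, .ett_copy _ hb, trivial, hB, hb⟩
      | expand q χ Δ ds ls hr hχ hP =>
        by_cases hb : (⟨.E, Γ⟩ : Block P) = ⟨q, insert χ Δ⟩
        · injection hb with hq hb
          subst hq hb
          obtain ⟨d, hd, hk⟩ := hr.exists_keeps
          have hq := hr.quant_eq hd hk
          have hblock : d.block Δ = ⟨.E, (d.block Δ).body⟩ := by rw [← hq]; rfl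
          refine ⟨(d.block Δ).body, .descend d, ?_, hk, .inr ⟨d, hd, hblock.symm⟩⟩
          rw [← hblock]
          exact .expand_descend _ _ _ _ _ _ hd
        · exact ⟨Γ, .copy, .expand_copy _ _ _ _ _ _ hb, trivial, .inl ⟨hB, hb⟩⟩
  -- Once the tracked block is empty nothing is left to verify and any continuation serves.
  · rw [Set.not_nonempty_iff_eq_empty] at hne
    subst hne
    by_cases h : ∃ m p', Succ σ p.1 m p'
    · obtain ⟨m, p', h⟩ := h
      exact ⟨⟨p', p.2.step h⟩, ∅, by simp, .inl ⟨m, h⟩, by simp⟩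
    · push Not at h
      exact ⟨p, ∅, by simp, .inr ⟨h, rfl⟩, by simp⟩

/-- Blocks with a single formula of quantifier depth less than `n` are true in the model. -/
structure TrueBelow (σ : (satGame ϑ).Strategy) (n : ℕ) : Prop where
  ex : ∀ (p : Reached σ) (φ : Formula P), φ.depth < n → ⟨.E, {φ}⟩ ∈ p.1.config.blocks →
    ∃ π : (model.{u} σ).Path, π.at 0 = p.state ∧ Models _ π φ
  all : ∀ (p : Reached σ) (φ : Formula P), φ.depth < n → ⟨.A, {φ}⟩ ∈ p.1.config.blocks →
    ∀ π : (model.{u} σ).Path, π.at 0 = p.state → Models _ π φ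

theorem TrueBelow.supports {n : ℕ} (h : TrueBelow.{u} σ n) {p : Reached σ}
    {π : (model.{u} σ).Path} (hπ : π.at 0 = p.state) : p.1.config.Supports n π := by
  refine ⟨fun ℓ hℓ => models_of_mem_lits hℓ hπ, fun φ hd hφ => ?_, fun φ hd hφ π' hπ' => ?_⟩
  · obtain ⟨π', h1, h2⟩ := h.ex p φ hd hφ
    exact ⟨π', h1.trans hπ.symm, h2⟩
  · exact h.all p φ hd hφ π' (hπ'.trans hπ)

theorem Formula.isFix_cases {χ : Formula P} (h : χ.isFix) :
    (∃ φ ψ, χ = .untl φ ψ) ∨ ∃ φ ψ, χ = .rels φ ψ := by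
  cases χ <;> simp_all [Formula.isFix]

theorem infinitely_often {f : ℕ → Formula P} {M : ℕ → Prop} (hM : ∀ i, ∃ j ≥ i, M j)
    (h₁ : ∀ i, M i → f i = .next (f (i + 1))) {χ : Formula P} {i : ℕ}
    (hf : ∀ j ≥ i, f j = χ ∨ f j = .next χ) (k : ℕ) : ∃ j ≥ k, f j = χ := by
  obtain ⟨j, hj, hMj⟩ := hM (max i k)
  have h := h₁ j hMj
  rcases hf j (by omega) with e | e
  · exact ⟨j, by omega, e⟩
  · rw [e] at h
    injection h with h
    exact ⟨j + 1, by omega, h.symm⟩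

/-- The path is drawn by the run that tracks the block. A false formula would yield either a
`U`-thread in an `E`-trace or a false `R`-formula whose right argument holds at every suffix. -/
theorem TrueBelow.exists_path {n : ℕ} (h : TrueBelow.{u} σ n) (hσ : σ.IsWinning) (p : Reached σ)
    {Γ : Set (Formula P)} (hΓ : ⟨.E, Γ⟩ ∈ p.1.config.blocks) (hn : ∀ f ∈ Γ, f.depth ≤ n) :
    ∃ π : (model.{u} σ).Path, π.at 0 = p.state ∧ ∀ f ∈ Γ, Models _ π f := by
  obtain ⟨x, hx0, hx, hstep⟩ := exists_seq
    (p := fun _ (x : Reached σ × Set (Formula P)) =>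
      x.2.Nonempty → (⟨.E, x.2⟩ : Block P) ∈ x.1.1.config.blocks)
    (r := fun _ x y => ((∃ m, Succ σ x.1.1 m y.1.1) ∨
      ((∀ m p', ¬ Succ σ x.1.1 m p') ∧ y.1 = x.1)) ∧
      (x.2.Nonempty → ∃ m k, Succ σ x.1.1 m y.1.1 ∧ BlockConn m ⟨.E, x.2⟩ k ⟨.E, y.2⟩ ∧
        k.Keeps ∧ (⟨.E, y.2⟩ : Block P) ∈ y.1.1.config.blocks))
    (fun _ x hx => by
      obtain ⟨p', Γ', h1, h2, h3⟩ := exists_track hσ x.1 x.2 hx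
      exact ⟨(p', Γ'), h1, h2, h3⟩)
    (x := (p, Γ)) (fun _ => hΓ)
  obtain ⟨hinf, π, hπ, hπ₁, hπ₀⟩ := exists_paths_of_run (q := fun i => (x i).1)
    fun i => (hstep i).1
  refine ⟨π 0, by rw [hπ, hx0], fun f₀ hf₀ => ?_⟩
  by_contra hfalse
  have hstep' := fun i => (hstep i).2
  choose m k hsucc hconn hk hmem using hstep'
  have hmod : ∀ i h, (m i h).IsModal ↔ ¬ (x i).1.1.Unsat := fun i h =>
    ⟨fun hm hu => hu.not_isModal (hsucc i h) hm, (hsucc i h).isModal⟩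
  obtain ⟨f, hf0, hf, hfc⟩ := exists_seq
    (p := fun i f => f ∈ (x i).2 ∧ f.depth ≤ n ∧ ¬ Models _ (π i) f)
    (r := fun i f f' => ∀ h, FormulaConn (m i h) (k i h) f f' ∧
      ∀ φ ψ, f = .rels φ ψ → f' = .next f → Models _ (π i) ψ)
    (fun i f ⟨hf, hd, hm⟩ => by
      have hne : (x i).2.Nonempty := ⟨f, hf⟩
      obtain ⟨f', h1, h2, h3, h4, h5⟩ := (hsucc i hne).1.exists_false_E (hconn i hne) (hk i hne)
        (fun hm => hπ₁ i ((hmod i hne).1 hm))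
        (fun hm => hπ₀ i (not_not.1 fun hc => hm ((hmod i hne).2 hc)))
        (h.supports (hπ (i + 1))) hf hd hm
      exact ⟨f', ⟨h1, h2, h3⟩, fun _ => ⟨h4, h5⟩⟩)
    (x := f₀) ⟨by rwa [hx0], hn _ hf₀, hfalse⟩
  -- The false formulas keep the block alive, so the tracked blocks form a genuine infinite trace.
  have hne : ∀ i, (x i).2.Nonempty := fun i => ⟨f i, (hf i).1⟩
  have hdyn := fun i => (hsucc i (hne i)).1.formula_cases (hconn i (hne i)) (hfc i (hne i)).1
  have h₁ : ∀ i, ¬ (x i).1.1.Unsat → f i = .next (f (i + 1)) := fun i hi =>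
    (hdyn i).1 ((hmod i (hne i)).2 hi)
  obtain ⟨χ, i₀, hχ, hi₀, htail⟩ := thread_tail (f := f) (M := fun i => ¬ (x i).1.1.Unsat) hinf
    h₁ (fun i hi => (hdyn i).2 fun hm => hi ((hmod i (hne i)).1 hm))
  rcases Formula.isFix_cases hχ with ⟨φ, ψ, rfl⟩ | ⟨φ, ψ, rfl⟩
  · refine not_badSeq hσ (q := fun i => (x i).1.1) (mv := fun i => m i (hne i))
      (blk := fun i => ⟨.E, (x i).2⟩) (lnk := fun i => k i (hne i)) (x 0).1.2
      (fun i => hsucc i (hne i)) (fun i => hx i (hne i)) (fun i => hconn i (hne i))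
      (.inl ⟨⟨0, fun _ _ => rfl⟩, f, fun i => (hf i).1, fun i => (hfc i (hne i)).1, φ, ψ, ?_,
        infinitely_often hinf h₁ htail⟩)
    exact (x i₀).1.1.2.2.1.body_subset _ (hx i₀ (hne i₀)) _ (hi₀ ▸ (hf i₀).1)
  · refine (hf i₀).2.2 ?_
    rw [hi₀]
    intro l
    obtain ⟨j, hj, hfj, hfj', hπj⟩ := exists_unfolding hinf h₁ hχ hi₀ htail
      (fun j _ hj => hπ₁ j hj) (fun j _ hj => hπ₀ j (not_not.1 hj)) l
    exact .inl (hπj ▸ (hfc j (hne j)).2 φ ψ hfj (by rw [hfj', hfj]))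

/-- The given path dictates the modal moves, and the trace runs through blocks whose formulas are
all false on the current suffix. An `R`-thread in it would consist of false formulas and yet force
its `R`-formula to be true. -/
theorem TrueBelow.exists_mem {n : ℕ} (h : TrueBelow.{u} σ n) (hσ : σ.IsWinning) (p : Reached σ)
    {Γ : Set (Formula P)} (hΓ : ⟨.A, Γ⟩ ∈ p.1.config.blocks) (hn : ∀ f ∈ Γ, f.depth ≤ n)
    {π : (model.{u} σ).Path} (hπ : π.at 0 = p.state) : ∃ f ∈ Γ, Models _ π f := by
  by_contra hfalse
  push Not at hfalse
  obtain ⟨x, hx0, hx, hstep⟩ := exists_seq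
    (p := fun _ (x : Reached σ × Set (Formula P) × (model.{u} σ).Path) =>
      (⟨.A, x.2.1⟩ : Block P) ∈ x.1.1.config.blocks ∧ x.2.2.at 0 = x.1.state ∧
        ∀ f ∈ x.2.1, f.depth ≤ n ∧ ¬ Models _ x.2.2 f)
    (r := fun _ x y => ∃ m k, Succ σ x.1.1 m y.1.1 ∧ BlockConn m ⟨.A, x.2.1⟩ k ⟨.A, y.2.1⟩ ∧
      (m.IsModal → y.2.2 = x.2.2.suffix 1) ∧ (¬ m.IsModal → y.2.2 = x.2.2) ∧
      ∀ f f', FormulaConn m k f f' → ∀ φ ψ, f = .rels φ ψ → f' = .next f → Models _ x.2.2 ψ)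
    (fun _ ⟨p, Γ, π⟩ ⟨hΓ, hπ, hf⟩ => by
      suffices hs : ∃ m, ∃ p' : Reached σ, ∃ π' : (model.{u} σ).Path, Succ σ p.1 m p'.1 ∧
          π'.at 0 = p'.state ∧ (m.IsModal → π' = π.suffix 1) ∧ (¬ m.IsModal → π' = π) by
        obtain ⟨m, p', π', hs, hπ', h₁, h₀⟩ := hs
        obtain ⟨Γ', k, h1, h2, h3, h4⟩ := hs.1.exists_false_A hΓ h₁ h₀ (h.supports hπ') hf
        exact ⟨(p', Γ', π'), ⟨h1, hπ', h3⟩, m, k, hs, h2, h₁, h₀, h4⟩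
      by_cases hu : p.1.Unsat
      · obtain ⟨m, hs⟩ := hu.exists_succ (σ := σ)
        have hm := hu.not_isModal hs
        refine ⟨m, ⟨_, p.2.step hs⟩, π, hs, hπ.trans (ModelState.ext ?_), fun h => (hm h).elim,
          fun _ => rfl⟩
        rw [Reached.position_state, Reached.position_state, hu.settle_eq]
      · have hpos : (π.at 0).position = p.1 := by
          rw [hπ, Reached.position_state, Position.settle_eq_self hu]
        rcases π.step 0 with ⟨m, p', hs, he⟩ | ⟨hno, -⟩
        · rw [hpos] at hs
          have hm := hs.isModal hu
          exact ⟨m, p', π.suffix 1, hs, he, fun _ => rfl, fun h => (h hm).elim⟩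
        -- The artificial loop occurs only at final positions, and these contain no block.
        · obtain ⟨m, p', hs⟩ := exists_succ_of_mem hσ p hΓ
          rw [hpos] at hno
          exact (hno _ _ hs).elim)
    (x := (p, Γ, π)) ⟨hΓ, hπ, fun f hf => ⟨hn f hf, hfalse f hf⟩⟩
  choose m k hsucc hconn hπ₁ hπ₀ hpol using hstep
  refine not_badSeq hσ (q := fun i => (x i).1.1) (mv := m)
    (blk := fun i => ⟨.A, (x i).2.1⟩) (lnk := k) (x 0).1.2 hsucc (fun i => (hx i).1) hconn
    (.inr ⟨⟨0, fun _ _ => rfl⟩, ?_⟩)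
  rintro ⟨f, hf, hfc, φ, ψ, hfl, hoften⟩
  have hdyn := fun i => (hsucc i).1.formula_cases (hconn i) (hfc i)
  have hinf : ∀ i, ∃ j ≥ i, (m j).IsModal := fun i => by
    obtain ⟨j, hj, hj'⟩ := (exists_paths_of_run.{u} (q := fun i => (x i).1)
      fun i => .inl ⟨m i, hsucc i⟩).1 i
    exact ⟨j, hj, (hsucc j).isModal hj'⟩
  have h₁ : ∀ i, (m i).IsModal → f i = .next (f (i + 1)) := fun i => (hdyn i).1
  obtain ⟨χ, i₀, hχ, hi₀, htail⟩ := thread_tail (f := f) (M := fun i => (m i).IsModal) hinf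
    h₁ (fun i => (hdyn i).2)
  have hχ' : χ = .rels φ ψ := by
    obtain ⟨j, hj, e⟩ := hoften i₀
    rcases htail j hj with e' | e'
    · exact e'.symm.trans e
    · rw [e'] at e
      simp at e
  subst hχ'
  refine ((hx i₀).2.2 _ (hf i₀)).2 ?_
  rw [hi₀]
  intro l
  obtain ⟨j, hj, hfj, hfj', hπj⟩ := exists_unfolding (π := fun i => (x i).2.2) hinf h₁ hχ hi₀ htail
    (fun j _ hj => hπ₁ j hj) (fun j _ hj => hπ₀ j hj) l
  exact .inl (hπj ▸ hpol j _ _ (hfc j) φ ψ hfj (by rw [hfj', hfj]))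

/-- A block `{φ}` is handled with the hypothesis at level `φ.depth`, which settles exactly the
blocks that it can spawn. -/
theorem trueBelow (hσ : σ.IsWinning) (n : ℕ) : TrueBelow.{u} σ n := by
  induction n using Nat.strong_induction_on with
  | _ n ih =>
    refine ⟨fun p φ hd hφ => ?_, fun p φ hd hφ π hπ => ?_⟩
    · obtain ⟨π, h1, h2⟩ := (ih _ hd).exists_path hσ p hφ (by rintro f rfl; exact le_rfl)
      exact ⟨π, h1, h2 φ rfl⟩
    · obtain ⟨f, rfl, h⟩ := (ih _ hd).exists_mem hσ p hφ (by rintro f rfl; exact le_rfl) hπ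
      exact h

theorem Game.Strategy.IsWinning.satisfiable (hσ : σ.IsWinning) (hϑ : IsStateFormula.{u} ϑ) :
    Satisfiable.{u} ϑ := by
  obtain ⟨π, h1, h2⟩ := (trueBelow.{u} hσ (ϑ.depth + 1)).ex ⟨_, .init⟩ ϑ (Nat.lt_succ_self _) rfl
  exact ⟨_, model σ, fun π' hπ' => (hϑ _ _ π π' (h1.trans hπ'.symm)).1 h2⟩

end Soundness

/-! ### Strategies with memory -/

/-- Player 0 can maintain an invariant that involves a memory, if this is possible in each single
move and the nodes of a play determine the moves of player 1. -/
theorem Game.exists_strategy {V : Type w} {M : Type z} [Nonempty M] (G : Game V M) {A : Type u}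
    (I : A → V → Prop) (U : A → V → M → A → V → Prop) {a₀ : A} (h₀ : I a₀ G.init)
    (hV₀ : ∀ a v, v ∈ G.V₀ → I a v → (∃ m v', G.edge v m v') →
      ∃ m v' a', G.edge v m v' ∧ I a' v' ∧ U a v m a' v')
    (hV₁ : ∀ a v, v ∉ G.V₀ → I a v → ∀ m v', G.edge v m v' → ∃ a', I a' v' ∧ U a v m a' v')
    (huniq : ∀ v, v ∉ G.V₀ → ∀ m m' v', G.edge v m v' → G.edge v m' v' → m = m') :
    ∃ σ : G.Strategy, ∀ ρ : G.toArena.Play, σ.Conforms ρ → ∃ a : ℕ → A,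
      (∀ i : ℕ, (i : ℕ∞) ≤ ρ.length → I (a i) (ρ.pos i)) ∧
      ∀ i : ℕ, (i : ℕ∞) < ρ.length → U (a i) (ρ.pos i) (ρ.move i) (a (i + 1)) (ρ.pos (i + 1)) := by
  classical
  have : Nonempty V := ⟨G.init⟩
  have : Nonempty A := ⟨a₀⟩
  choose! pm pv pa hp using hV₀
  -- The new memory may depend on the nodes only, because a strategy does not see moves; `huniq`
  -- makes this harmless.
  have hV₁' : ∀ a v v', ∃ a', v ∉ G.V₀ → I a v → ∀ m, G.edge v m v' → I a' v' ∧ U a v m a' v' := by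
    intro a v v'
    by_cases h : v ∉ G.V₀ ∧ I a v ∧ ∃ m, G.edge v m v'
    · obtain ⟨h1, h2, m, hm⟩ := h
      obtain ⟨a', ha'⟩ := hV₁ a v h1 h2 m v' hm
      exact ⟨a', fun _ _ m' hm' => huniq v h1 _ _ _ hm hm' ▸ ha'⟩
    · exact ⟨a, fun h1 h2 m hm => (h ⟨h1, h2, m, hm⟩).elim⟩
  choose na hna using hV₁'
  have hfb : ∀ v, ∃ r : M × V, (∃ m v', G.edge v m v') → G.edge v r.1 r.2 := fun v => by
    by_cases h : ∃ m v', G.edge v m v'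
    · obtain ⟨m, v', h⟩ := h
      exact ⟨(m, v'), fun _ => h⟩
    · exact ⟨(Classical.arbitrary M, v), fun h' => (h h').elim⟩
  choose fb hfb using hfb
  let next : A → V → V → A := fun a v v' => if v ∈ G.V₀ then pa a v else na a v v'
  -- The memory is recomputed from the history, read with the latest node first.
  let mem : List V → V → A := fun l => List.rec (fun _ => a₀) (fun u _ ih v => next (ih u) u v) l
  refine ⟨⟨fun h v => if I (mem h.reverse v) v then
    (pm (mem h.reverse v) v, pv (mem h.reverse v) v) else fb v, fun h v hv he => ?_⟩,
    fun ρ hρ => ?_⟩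
  · split_ifs with hI
    · exact (hp _ _ hv hI he).1
    · exact hfb v he
  · set a : ℕ → A := fun i => mem ((List.range i).map ρ.pos).reverse (ρ.pos i) with ha
    have hsucc : ∀ i, a (i + 1) = next (a i) (ρ.pos i) (ρ.pos (i + 1)) := fun i => by
      simp only [ha, List.range_succ, List.map_append, List.map_cons, List.map_nil,
        List.reverse_append, List.reverse_cons, List.reverse_nil, List.nil_append,
        List.singleton_append]
      rfl
    have key : ∀ i : ℕ, (i : ℕ∞) < ρ.length → I (a i) (ρ.pos i) →
        I (a (i + 1)) (ρ.pos (i + 1)) ∧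
          U (a i) (ρ.pos i) (ρ.move i) (a (i + 1)) (ρ.pos (i + 1)) := by
      intro i hi hI
      have hstep := ρ.step i hi
      by_cases hv : ρ.pos i ∈ G.V₀
      · have hc : (ρ.move i, ρ.pos (i + 1)) = if I (a i) (ρ.pos i) then
          (pm (a i) (ρ.pos i), pv (a i) (ρ.pos i)) else fb (ρ.pos i) := hρ i hi hv
        rw [if_pos hI, Prod.mk.injEq] at hc
        have := hp _ _ hv hI ⟨_, _, hstep⟩
        rw [hsucc i]
        simp only [next, if_pos hv]
        rw [hc.1, hc.2]
        exact this.2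
      · rw [hsucc i]
        simp only [next, if_neg hv]
        exact hna _ _ _ hv hI _ hstep
    have hI : ∀ i : ℕ, (i : ℕ∞) ≤ ρ.length → I (a i) (ρ.pos i) := by
      intro i
      induction i with
      | zero =>
        intro _
        rw [ρ.pos_zero]
        exact h₀
      | succ i ih =>
        intro hi
        have hlt : (i : ℕ∞) < ρ.length :=
          lt_of_lt_of_le (by exact_mod_cast Nat.lt_succ_self i) hi
        exact (key i hlt (ih hlt.le)).1
    exact ⟨a, hI, fun i hi => (key i hi (hI i hi.le)).2⟩

/-! ### A model yields a winning strategy -/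

section Completeness

variable {P : Type} {S : Type u} {T : TransitionSystem P S}

open Classical in
/-- The path after a move. -/
noncomputable def TransitionSystem.Path.advance (π : T.Path) (m : Move P) : T.Path :=
  if m.IsModal then π.suffix 1 else π

theorem TransitionSystem.Path.advance_of_isModal (π : T.Path) {m : Move P} (h : m.IsModal) :
    π.advance m = π.suffix 1 := by simp [advance, h]

theorem TransitionSystem.Path.advance_of_not_isModal (π : T.Path) {m : Move P}
    (h : ¬ m.IsModal) : π.advance m = π := by simp [advance, h]

/-- The memory of player 0: the number of moves made so far, the current state, and for each
`E`-block a path with the move at which this path was selected. -/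
structure Memory (T : TransitionSystem P S) where
  time : ℕ
  state : S
  birth : Set (Formula P) → ℕ
  path : Set (Formula P) → T.Path

/-- The configuration is true at the current state, as witnessed by the memorized paths. -/
structure Memory.Fits (a : Memory T) (C : Configuration P) : Prop where
  lits : ∀ ℓ ∈ C.lits, ∀ π : T.Path, π.at 0 = a.state → Models T π ℓ
  all : ∀ Γ, ⟨.A, Γ⟩ ∈ C.blocks → ∀ π : T.Path, π.at 0 = a.state → ∃ f ∈ Γ, Models T π f
  ex : ∀ Γ, ⟨.E, Γ⟩ ∈ C.blocks → (a.path Γ).at 0 = a.state ∧ ∀ f ∈ Γ, Models T (a.path Γ) f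
  birth_lt : ∀ Γ, ⟨.E, Γ⟩ ∈ C.blocks → a.birth Γ < a.time
  path_eq : ∀ Γ Γ', ⟨.E, Γ⟩ ∈ C.blocks → ⟨.E, Γ'⟩ ∈ C.blocks → a.birth Γ = a.birth Γ' →
    a.path Γ = a.path Γ'
  nonempty : C.lits.Nonempty ∨ ∃ B ∈ C.blocks, B ≠ ⟨.E, ∅⟩

/-- `EΓ'` continues the `E`-block `Γ` of `C`. -/
def Continues (C : Configuration P) (m : Move P) (Γ : Set (Formula P)) (k : Link P)
    (Γ' : Set (Formula P)) : Prop :=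
  ⟨.E, Γ⟩ ∈ C.blocks ∧ BlockConn m ⟨.E, Γ⟩ k ⟨.E, Γ'⟩ ∧ k.Keeps

/-- A move that keeps the configuration true, where `s'` is the next state. -/
structure SoundMove (a : Memory T) (C : Configuration P) (m : Move P) (C' : Configuration P)
    (s' : S) : Prop where
  step : m.IsModal → T.step a.state s'
  stay : ¬ m.IsModal → s' = a.state
  thread : ∀ Γ Γ' k, ⟨.A, Γ⟩ ∈ C.blocks → BlockConn m ⟨.A, Γ⟩ k ⟨.A, Γ'⟩ → k.Keeps →
    ∀ π : T.Path, π.at 0 = a.state → ∀ f ∈ Γ, Models T π f →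
      ∃ f' ∈ Γ', FormulaConn m k f f' ∧ Models T (π.advance m) f' ∧
        ∀ φ ψ, f = .untl φ ψ → f' = .next f → ¬ Models T π ψ
  lits : ∀ ℓ ∈ C'.lits, ∀ π : T.Path, π.at 0 = s' → Models T π ℓ
  all : ∀ Γ, ⟨.A, Γ⟩ ∈ C'.blocks → ∀ π : T.Path, π.at 0 = s' → ∃ f ∈ Γ, Models T π f
  continues : ∀ Γ k Γ', Continues C m Γ k Γ' → ((a.path Γ).advance m).at 0 = s' ∧
    ∀ f ∈ Γ', Models T ((a.path Γ).advance m) f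
  unfold : ∀ Γ k Γ', Continues C m Γ k Γ' → ∀ f f', FormulaConn m k f f' →
    ∀ φ ψ, f = .untl φ ψ → f' = .next f → ¬ Models T (a.path Γ) ψ
  fresh : ∃ π : T.Path, π.at 0 = s' ∧ ∀ Γ', ⟨.E, Γ'⟩ ∈ C'.blocks →
    (¬ ∃ Γ k, Continues C m Γ k Γ') → ∀ f ∈ Γ', Models T π f
  nonempty : C'.lits.Nonempty ∨ ∃ B ∈ C'.blocks, B ≠ ⟨.E, ∅⟩

/-- How the memory changes in a move. -/
structure Memory.Update (a : Memory T) (C : Configuration P) (m : Move P) (a' : Memory T) :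
    Prop where
  step : m.IsModal → T.step a.state a'.state
  stay : ¬ m.IsModal → a'.state = a.state
  thread : ∀ Γ Γ' k, ⟨.A, Γ⟩ ∈ C.blocks → BlockConn m ⟨.A, Γ⟩ k ⟨.A, Γ'⟩ → k.Keeps →
    ∀ π : T.Path, π.at 0 = a.state → ∀ f ∈ Γ, Models T π f →
      ∃ f' ∈ Γ', FormulaConn m k f f' ∧ Models T (π.advance m) f' ∧
        ∀ φ ψ, f = .untl φ ψ → f' = .next f → ¬ Models T π ψ
  unfold : ∀ Γ k Γ', Continues C m Γ k Γ' → ∀ f f', FormulaConn m k f f' →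
    ∀ φ ψ, f = .untl φ ψ → f' = .next f → ¬ Models T (a.path Γ) ψ
  birth_le : ∀ Γ k Γ', Continues C m Γ k Γ' → a'.birth Γ' ≤ a.birth Γ ∧
    (a'.birth Γ' = a.birth Γ → a'.path Γ' = (a.path Γ).advance m)

/-- If several `E`-blocks are merged, then the path that was selected first is kept. -/
theorem SoundMove.exists_update {a : Memory T} {C C' : Configuration P} {m : Move P} {s' : S}
    (h : SoundMove a C m C' s') (ha : a.Fits C) :
    ∃ a' : Memory T, a'.Fits C' ∧ a.Update C m a' := by
  classical
  obtain ⟨π₀, hπ₀, hfresh⟩ := h.fresh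
  have hex : ∀ Γ', ∃ r : ℕ × T.Path,
      ((∃ Γ k, Continues C m Γ k Γ') → ∃ Γ k, Continues C m Γ k Γ' ∧
        r = (a.birth Γ, (a.path Γ).advance m) ∧
        ∀ Γ₁ k₁, Continues C m Γ₁ k₁ Γ' → a.birth Γ ≤ a.birth Γ₁) ∧
      ((¬ ∃ Γ k, Continues C m Γ k Γ') → r = (a.time, π₀)) := by
    intro Γ'
    by_cases hc : ∃ Γ k, Continues C m Γ k Γ'
    · have hb : ∃ b, ∃ Γ k, Continues C m Γ k Γ' ∧ a.birth Γ = b := by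
        obtain ⟨Γ, k, h⟩ := hc
        exact ⟨_, Γ, k, h, rfl⟩
      obtain ⟨Γ, k, hΓ, e⟩ := Nat.find_spec hb
      exact ⟨_, fun _ => ⟨Γ, k, hΓ, rfl, fun Γ₁ k₁ h₁ => by
        rw [e]
        exact Nat.find_min' hb ⟨Γ₁, k₁, h₁, rfl⟩⟩, fun h => (h hc).elim⟩
    · exact ⟨_, fun h => (hc h).elim, fun _ => rfl⟩
  choose r hr hr' using hex
  refine ⟨⟨a.time + 1, s', fun Γ => (r Γ).1, fun Γ => (r Γ).2⟩,
    ⟨h.lits, h.all, fun Γ' hΓ' => ?_, fun Γ' hΓ' => ?_, fun Γ₁ Γ₂ h₁ h₂ he => ?_, h.nonempty⟩,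
    ⟨h.step, h.stay, h.thread, h.unfold, fun Γ k Γ' hc => ?_⟩⟩
  · by_cases hc : ∃ Γ k, Continues C m Γ k Γ'
    · obtain ⟨Γ, k, hk, e, -⟩ := hr Γ' hc
      simp only [e]
      exact h.continues Γ k Γ' hk
    · simp only [hr' Γ' hc]
      exact ⟨hπ₀, hfresh Γ' hΓ' hc⟩
  · by_cases hc : ∃ Γ k, Continues C m Γ k Γ'
    · obtain ⟨Γ, k, hk, e, -⟩ := hr Γ' hc
      simp only [e]
      exact (ha.birth_lt Γ hk.1).trans (Nat.lt_succ_self _)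
    · simp only [hr' Γ' hc]
      exact Nat.lt_succ_self _
  · simp only at he ⊢
    by_cases hc₁ : ∃ Γ k, Continues C m Γ k Γ₁
    · obtain ⟨Δ₁, k₁, hk₁, e₁, -⟩ := hr Γ₁ hc₁
      by_cases hc₂ : ∃ Γ k, Continues C m Γ k Γ₂
      · obtain ⟨Δ₂, k₂, hk₂, e₂, -⟩ := hr Γ₂ hc₂
        rw [e₁, e₂] at he ⊢
        exact congrArg (fun π => π.advance m) (ha.path_eq _ _ hk₁.1 hk₂.1 he)
      · rw [e₁, hr' Γ₂ hc₂] at he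
        -- An inherited stamp is older than the present time, so it cannot equal a new one.
        exact absurd he (ha.birth_lt Δ₁ hk₁.1).ne
    · by_cases hc₂ : ∃ Γ k, Continues C m Γ k Γ₂
      · obtain ⟨Δ₂, k₂, hk₂, e₂, -⟩ := hr Γ₂ hc₂
        rw [e₂, hr' Γ₁ hc₁] at he
        exact absurd he.symm (ha.birth_lt Δ₂ hk₂.1).ne
      · rw [hr' Γ₁ hc₁, hr' Γ₂ hc₂]
  · obtain ⟨Δ, k', hk', e, hmin⟩ := hr Γ' ⟨Γ, k, hc⟩
    simp only [e]
    -- Predecessors that tie for the oldest stamp carry the same path.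
    exact ⟨hmin Γ k hc, fun he => congrArg (fun π => π.advance m) (ha.path_eq _ _ hk'.1 hc.1 he)⟩

theorem Memory.Fits.consistent {a : Memory T} {C : Configuration P} (h : a.Fits C) :
    C.Consistent := by
  obtain ⟨π, hπ⟩ := exists_path T a.state
  exact ⟨fun hf => h.lits _ hf π hπ, fun p hp => h.lits _ hp.2 π hπ (h.lits _ hp.1 π hπ)⟩

theorem exists_path_cons {s : S} {π' : T.Path} (h : T.step s (π'.at 0)) :
    ∃ π : T.Path, π.at 0 = s ∧ π.suffix 1 = π' := by
  refine ⟨⟨fun n => Nat.rec s (fun i _ => π'.1 i) n, fun i => ?_⟩, rfl, ?_⟩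
  · cases i with
    | zero => exact h
    | succ i => exact π'.2 i
  · refine Subtype.ext (funext fun i => ?_)
    simp only [TransitionSystem.Path.suffix, Nat.add_comm 1 i]

end Completeness

/-! ### Moves that preserve truth in the model -/

section SoundMoves

variable {P : Type} {S : Type u} {T : TransitionSystem P S}

/-- The memorized path decides between the alternatives, and a `U`-formula is fulfilled as soon as
its right argument is true. -/
theorem Rule.exists_sound_E {χ : Formula P} (hχ : χ.isNext = false) {π : T.Path}
    (h : Models T π χ) : ∃ ds ls, Rule .E χ ds ls ∧
      (∀ d ∈ ds, d.keeps = true → ∀ f ∈ d.fresh, Models T π f ∧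
        ∀ φ ψ, χ = .untl φ ψ → f = .next χ → ¬ Models T π ψ) ∧
      ∀ d ∈ ds, d.keeps = false →
        (∃ φ, χ = .ex φ ∧ d = ⟨.E, {φ}, false⟩) ∨ ∃ φ, χ = .all φ ∧ d = ⟨.A, {φ}, false⟩ := by
  cases χ with
  | next => simp [Formula.isNext] at hχ
  | tt | ff | atom | natom => exact ⟨_, _, .E_lit _ trivial, by simp, by simp⟩
  | disj φ ψ =>
    rcases h with h | h
    · exact ⟨_, _, .E_disj_left φ ψ, by simpa, by simp⟩
    · exact ⟨_, _, .E_disj_right φ ψ, by simpa, by simp⟩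
  | conj φ ψ => exact ⟨_, _, .E_conj φ ψ, by simpa [Models] using h, by simp⟩
  | ex φ => exact ⟨_, _, .E_ex φ, by simp, by simp⟩
  | all φ => exact ⟨_, _, .E_all φ, by simp, by simp⟩
  | untl φ ψ =>
    by_cases hψ : Models T π ψ
    · refine ⟨_, _, .E_untl_now φ ψ, ?_, by simp⟩
      simpa [hψ] using Formula.ne_next_untl_right φ ψ
    · have h := (models_untl_iff π φ ψ).1 h
      refine ⟨_, _, .E_untl_later φ ψ, ?_, by simp⟩
      simp only [List.mem_singleton, forall_eq, forall_const]
      rintro f (rfl | rfl)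
      · exact ⟨by tauto, fun φ' ψ' _ e => (Formula.ne_next_untl_left _ _ e).elim⟩
      · exact ⟨by tauto, fun φ' ψ' e _ => by injection e with _ e; exact e ▸ hψ⟩
  | rels φ ψ =>
    have h := (models_rels_iff π φ ψ).1 h
    by_cases hφ : Models T π φ
    · exact ⟨_, _, .E_rels_now φ ψ, by simp [hφ, h.1], by simp⟩
    · refine ⟨_, _, .E_rels_later φ ψ, ?_, by simp⟩
      simp only [List.mem_singleton, forall_eq, forall_const]
      rintro f (rfl | rfl)
      · exact ⟨h.1, by simp⟩
      · exact ⟨h.2.resolve_left hφ, by simp⟩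

/-- Player 0 has a choice only for literals and path quantifiers, whose truth depends on the state
alone; so one choice suits all paths. In the other cases the true formula in each displayed block is
picked path by path. -/
theorem Rule.exists_sound_A (T : TransitionSystem P S) {χ : Formula P} (hχ : χ.isNext = false)
    (s : S) : ∃ ds ls, Rule .A χ ds ls ∧ (∀ ℓ ∈ ls, ∀ π : T.Path, π.at 0 = s → Models T π ℓ) ∧
      (∀ d ∈ ds, d.keeps = true → ∀ π : T.Path, π.at 0 = s → Models T π χ →
        ∃ f ∈ d.fresh, Models T π f ∧ ∀ φ ψ, χ = .untl φ ψ → f = .next χ → ¬ Models T π ψ) ∧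
      ∀ d ∈ ds, d.keeps = false →
        (∃ φ, χ = .ex φ ∧ d = ⟨.E, {φ}, false⟩ ∧ ∃ π : T.Path, π.at 0 = s ∧ Models T π φ) ∨
        ∃ φ, χ = .all φ ∧ d = ⟨.A, {φ}, false⟩ ∧
          ∀ π : T.Path, π.at 0 = s → Models T π φ := by
  have hlit : ∀ ℓ : Formula P, ℓ.IsLiteral → ∃ ds ls, Rule .A ℓ ds ls ∧
      (∀ ℓ ∈ ls, ∀ π : T.Path, π.at 0 = s → Models T π ℓ) ∧
      (∀ d ∈ ds, d.keeps = true → ∀ π : T.Path, π.at 0 = s → Models T π ℓ →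
        ∃ f ∈ d.fresh, Models T π f ∧ ∀ φ ψ, ℓ = .untl φ ψ → f = .next ℓ → ¬ Models T π ψ) ∧
      ∀ d ∈ ds, d.keeps = true := fun ℓ hℓ => by
    by_cases h : ∃ π : T.Path, π.at 0 = s ∧ Models T π ℓ
    · obtain ⟨π₀, hπ₀, h₀⟩ := h
      refine ⟨_, _, .A_lit_take ℓ hℓ, ?_, by simp, by simp⟩
      rintro _ rfl π hπ
      exact (models_congr_of_at_eq (hπ₀.trans hπ.symm) (.inl hℓ)).1 h₀
    · push Not at h
      refine ⟨_, _, .A_lit_drop ℓ hℓ, by simp, ?_, by simp⟩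
      intro d _ _ π hπ hm
      exact (h π hπ hm).elim
  by_cases hχ' : χ.IsLiteral
  · obtain ⟨ds, ls, h1, h2, h3, h4⟩ := hlit _ hχ'
    exact ⟨ds, ls, h1, h2, h3, fun d hd hk => by simp [h4 d hd] at hk⟩
  cases χ with
  | next => simp [Formula.isNext] at hχ
  | tt | ff | atom | natom => exact (hχ' trivial).elim
  | disj φ ψ =>
    refine ⟨_, _, .A_disj φ ψ, by simp, ?_, by simp⟩
    simp only [List.mem_singleton, forall_eq, forall_const]
    rintro π - (h | h)
    · exact ⟨φ, .inl rfl, h, by simp⟩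
    · exact ⟨ψ, .inr rfl, h, by simp⟩
  | conj φ ψ =>
    refine ⟨_, _, .A_conj φ ψ, by simp, ?_, by simp⟩
    rintro d hd - π - ⟨h, h'⟩
    simp only [List.mem_cons, List.not_mem_nil, or_false] at hd
    rcases hd with rfl | rfl
    · exact ⟨φ, rfl, h, by simp⟩
    · exact ⟨ψ, rfl, h', by simp⟩
  | ex φ =>
    by_cases h : ∃ π : T.Path, π.at 0 = s ∧ Models T π φ
    · exact ⟨_, _, .A_ex_take φ, by simp, by simp, fun d hd _ =>
        .inl ⟨φ, rfl, List.mem_singleton.1 hd, h⟩⟩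
    · refine ⟨_, _, .A_ex_drop φ, by simp, ?_, by simp⟩
      rintro d - - π hπ ⟨π', hπ', hm⟩
      exact (h ⟨π', hπ'.trans hπ, hm⟩).elim
  | all φ =>
    by_cases h : ∀ π : T.Path, π.at 0 = s → Models T π φ
    · exact ⟨_, _, .A_all_take φ, by simp, by simp, fun d hd _ =>
        .inr ⟨φ, rfl, List.mem_singleton.1 hd, h⟩⟩
    · refine ⟨_, _, .A_all_drop φ, by simp, ?_, by simp⟩
      intro d _ _ π hπ hm
      exact (h fun π' hπ' => hm π' (hπ'.trans hπ.symm)).elim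
  | untl φ ψ =>
    refine ⟨_, _, .A_untl φ ψ, by simp, ?_, by simp⟩
    intro d hd _ π _ h
    have h := (models_untl_iff π φ ψ).1 h
    simp only [List.mem_cons, List.not_mem_nil, or_false] at hd
    by_cases hψ : Models T π ψ
    · rcases hd with rfl | rfl <;>
        exact ⟨ψ, .inl rfl, hψ, fun _ _ _ e => (Formula.ne_next_untl_right _ _ e).elim⟩
    · have h := h.resolve_left hψ
      rcases hd with rfl | rfl
      · exact ⟨φ, .inr rfl, h.1, fun _ _ _ e => (Formula.ne_next_untl_left _ _ e).elim⟩
      · exact ⟨_, .inr rfl, h.2, fun φ' ψ' e _ => by injection e with _ e; exact e ▸ hψ⟩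
  | rels φ ψ =>
    refine ⟨_, _, .A_rels φ ψ, by simp, ?_, by simp⟩
    intro d hd _ π _ h
    have h := (models_rels_iff π φ ψ).1 h
    simp only [List.mem_cons, List.not_mem_nil, or_false] at hd
    rcases hd with rfl | rfl
    · exact ⟨ψ, rfl, h.1, by simp⟩
    · rcases h.2 with h | h
      · exact ⟨φ, .inl rfl, h, by simp⟩
      · exact ⟨_, .inr rfl, h, by simp⟩

theorem Rule.nonempty {q : Quantifier} {χ : Formula P} {ds ls} (h : Rule q χ ds ls) :
    ls.Nonempty ∨ ∃ d ∈ ds, d.quant = .A ∨ d.fresh.Nonempty := by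
  cases h <;> simp

variable {a : Memory T} {C : Configuration P}

/-- A copied block. -/
theorem thread_copy {m : Move P} (hm : ¬ m.IsModal) {Γ : Set (Formula P)} {π : T.Path}
    {f : Formula P} (hf : f ∈ Γ) (h : Models T π f) :
    ∃ f' ∈ Γ, FormulaConn m .copy f f' ∧ Models T (π.advance m) f' ∧
      ∀ φ ψ, f = .untl φ ψ → f' = .next f → ¬ Models T π ψ :=
  ⟨f, hf, .copy _ _, by rwa [π.advance_of_not_isModal hm],
    fun _ _ _ e => (Formula.ne_next_self _ e).elim⟩

theorem Memory.Fits.soundMove_ett (ha : a.Fits C) : SoundMove a C .ett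
    ⟨C.blocks \ {⟨.E, ∅⟩}, C.lits⟩ a.state := by
  obtain ⟨π₀, hπ₀⟩ := exists_path T a.state
  have hm : ¬ (Move.ett : Move P).IsModal := id
  refine ⟨fun h => h.elim, fun _ => rfl, ?_, ha.lits, fun Γ hΓ => ha.all Γ hΓ.1, ?_, ?_,
    ⟨π₀, hπ₀, fun Γ' hΓ' h => (h ⟨Γ', .copy, hΓ'.1, .ett_copy _ hΓ'.2, trivial⟩).elim⟩, ?_⟩
  · rintro Γ Γ' k hΓ ⟨⟩ - π - f hf h
    exact thread_copy hm hf h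
  · rintro Γ k Γ' ⟨hΓ, ⟨⟩, -⟩
    rw [(a.path Γ).advance_of_not_isModal hm]
    exact ha.ex Γ hΓ
  · rintro Γ k Γ' ⟨hΓ, ⟨⟩, -⟩ f f' ⟨⟩ φ ψ _ e
    exact (Formula.ne_next_self _ e).elim
  -- `Fits` asks for a literal or for a block other than `E ∅` so that this deletion does not empty
  -- the configuration.
  · rcases ha.nonempty with h | ⟨B, hB, hne⟩
    · exact .inl h
    · exact .inr ⟨B, ⟨hB, hne⟩, hne⟩

theorem Memory.Fits.soundMove_expand (ha : a.Fits C) {q : Quantifier} {χ : Formula P}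
    {Γ : Set (Formula P)} {ds : List (Descendant P)} {ls : Set (Formula P)} (hr : Rule q χ ds ls)
    (hP : ⟨q, insert χ Γ⟩ ∈ C.blocks)
    (hls : ∀ ℓ ∈ ls, ∀ π : T.Path, π.at 0 = a.state → Models T π ℓ)
    (hE : q = .E → ∀ d ∈ ds, d.keeps = true → ∀ f ∈ d.fresh, Models T (a.path (insert χ Γ)) f ∧
      ∀ φ ψ, χ = .untl φ ψ → f = .next χ → ¬ Models T (a.path (insert χ Γ)) ψ)
    (hA : q = .A → ∀ d ∈ ds, d.keeps = true → ∀ π : T.Path, π.at 0 = a.state → Models T π χ →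
      ∃ f ∈ d.fresh, Models T π f ∧ ∀ φ ψ, χ = .untl φ ψ → f = .next χ → ¬ Models T π ψ)
    (hs : ∀ d ∈ ds, d.keeps = false →
      (∃ φ, χ = .ex φ ∧ d = ⟨.E, {φ}, false⟩ ∧ ∃ π : T.Path, π.at 0 = a.state ∧ Models T π φ) ∨
      ∃ φ, χ = .all φ ∧ d = ⟨.A, {φ}, false⟩ ∧
        ∀ π : T.Path, π.at 0 = a.state → Models T π φ) :
    SoundMove a C (.expand q χ Γ ds ls)
      ⟨(C.blocks \ {⟨q, insert χ Γ⟩}) ∪ {B | ∃ d ∈ ds, B = d.block Γ}, C.lits ∪ ls⟩ a.state := by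
  have hm : ¬ (Move.expand q χ Γ ds ls).IsModal := id
  have hthread : ∀ Δ Δ' k, ⟨.A, Δ⟩ ∈ C.blocks →
      BlockConn (.expand q χ Γ ds ls) ⟨.A, Δ⟩ k ⟨.A, Δ'⟩ → k.Keeps →
      ∀ π : T.Path, π.at 0 = a.state → ∀ f ∈ Δ, Models T π f →
      ∃ f' ∈ Δ', FormulaConn (.expand q χ Γ ds ls) k f f' ∧
        Models T (π.advance (.expand q χ Γ ds ls)) f' ∧
        ∀ φ ψ, f = .untl φ ψ → f' = .next f → ¬ Models T π ψ := by
    intro Δ Δ' k hΔ hc hk π hπ f hf hmf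
    generalize hb : (⟨.A, Δ⟩ : Block P) = b at hc
    generalize hb' : (⟨.A, Δ'⟩ : Block P) = b' at hc
    cases hc with
    | expand_copy =>
      have := hb.trans hb'.symm
      injection this with _ e
      subst e
      exact thread_copy hm hf hmf
    | expand_descend _ _ _ _ _ d hd =>
      injection hb with hq hb
      injection hb' with _ hb'
      subst hb hb'
      rw [π.advance_of_not_isModal hm]
      rcases hf with rfl | hf
      · obtain ⟨g, hg, h1, h2⟩ := hA hq.symm d hd hk π hπ hmf
        exact ⟨g, .inl hg, .principal _ _ _ _ _ _ _ hg, h1, h2⟩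
      · exact ⟨f, .inr ⟨hk, hf⟩, .side _ _ _ _ _ _ hk _ hf, hmf,
          fun _ _ _ e => (Formula.ne_next_self _ e).elim⟩
  -- Only an `ex` formula spawns an `E`-block, and its witness is the path to memorize; otherwise
  -- any path will do.
  obtain ⟨π₀, hπ₀, hπ₀'⟩ : ∃ π : T.Path, π.at 0 = a.state ∧ ∀ d ∈ ds, d.keeps = false →
      d.quant = .E → ∀ f ∈ d.fresh, Models T π f := by
    by_cases hex : ∃ φ, χ = .ex φ ∧ ∃ π : T.Path, π.at 0 = a.state ∧ Models T π φ
    · obtain ⟨φ, rfl, π, hπ, h⟩ := hex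
      refine ⟨π, hπ, fun d hd hk hq f hf => ?_⟩
      rcases hs d hd hk with ⟨φ', e, rfl, -⟩ | ⟨φ', e, -⟩
      · injection e with e
        subst e
        exact hf ▸ h
      · simp at e
    · obtain ⟨π, hπ⟩ := exists_path T a.state
      refine ⟨π, hπ, fun d hd hk hq f hf => ?_⟩
      rcases hs d hd hk with ⟨φ', e, -, h⟩ | ⟨φ', -, rfl, -⟩
      · exact (hex ⟨φ', e, h⟩).elim
      · simp at hq
  refine ⟨fun h => h.elim, fun _ => rfl, hthread, ?_, ?_, ?_, ?_, ⟨π₀, hπ₀, ?_⟩, ?_⟩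
  · rintro ℓ (hℓ | hℓ)
    exacts [ha.lits ℓ hℓ, hls ℓ hℓ]
  · rintro Δ (hΔ | ⟨d, hd, e⟩) π hπ
    · exact ha.all Δ hΔ.1 π hπ
    · cases hk : d.keeps with
      | false =>
        rcases hs d hd hk with ⟨φ, -, rfl, -⟩ | ⟨φ, -, rfl, h⟩
        · simp [Descendant.block] at e
        · rw [Descendant.block_of_not_keeps] at e
          injection e with _ e
          subst e
          exact ⟨φ, rfl, h π hπ⟩
      | true =>
        have hq : q = .A := by
          rw [← hr.quant_eq hd hk]
          exact (congrArg Block.quant e).symm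
        subst hq
        obtain ⟨f, hf, hmf⟩ := ha.all _ hP π hπ
        obtain ⟨f', hf', -, h, -⟩ := hthread _ Δ (.descend d) hP
          (e ▸ .expand_descend _ _ _ _ _ d hd) hk π hπ f hf hmf
        exact ⟨f', hf', by rwa [π.advance_of_not_isModal hm] at h⟩
  · rintro Δ k Δ' ⟨hΔ, hc, hk⟩
    rw [(a.path Δ).advance_of_not_isModal hm]
    refine ⟨(ha.ex Δ hΔ).1, ?_⟩
    generalize hb : (⟨.E, Δ⟩ : Block P) = b at hc
    generalize hb' : (⟨.E, Δ'⟩ : Block P) = b' at hc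
    cases hc with
    | expand_copy =>
      have := hb.trans hb'.symm
      injection this with _ e
      subst e
      exact (ha.ex Δ hΔ).2
    | expand_descend _ _ _ _ _ d hd =>
      injection hb with hq hb
      injection hb' with _ hb'
      subst hb hb'
      rintro f (hf | ⟨-, hf⟩)
      · exact (hE hq.symm d hd hk f hf).1
      · exact (ha.ex _ hΔ).2 f (.inr hf)
  · rintro Δ k Δ' ⟨hΔ, hc, hk⟩ f f' hf φ ψ e e'
    generalize hb : (⟨.E, Δ⟩ : Block P) = b at hc
    generalize (⟨.E, Δ'⟩ : Block P) = b' at hc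
    cases hf with
    | copy => exact (Formula.ne_next_self _ e').elim
    | side => exact (Formula.ne_next_self _ e').elim
    | modal => simp at e
    | principal _ _ _ _ _ d _ hψ =>
      cases hc with
      | expand_descend _ _ _ _ _ _ hd =>
        injection hb with hq hb
        subst hb
        exact (hE hq.symm d hd hk f' hψ).2 φ ψ e e'
  · rintro Δ (hΔ | ⟨d, hd, e⟩) hno f hf
    · exact (hno ⟨Δ, .copy, hΔ.1, .expand_copy _ _ _ _ _ _ hΔ.2, trivial⟩).elim
    · have hq : d.quant = .E := (congrArg Block.quant e).symm
      cases hk : d.keeps with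
      | true =>
        have hq' := hr.quant_eq hd hk
        rw [hq] at hq'
        subst hq'
        exact (hno ⟨insert χ Γ, .descend d, hP, e ▸ .expand_descend _ _ _ _ _ d hd, hk⟩).elim
      | false =>
        injection e with _ e
        rw [e] at hf
        rcases hf with hf | ⟨hk', -⟩
        · exact hπ₀' d hd hk hq f hf
        · simp [hk] at hk'
  · rcases hr.nonempty with ⟨ℓ, hℓ⟩ | ⟨d, hd, h⟩
    · exact .inl ⟨ℓ, .inr hℓ⟩
    · refine .inr ⟨d.block Γ, .inr ⟨d, hd, rfl⟩, fun e => ?_⟩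
      injection e with e₁ e₂
      rcases h with h | ⟨f, hf⟩
      · rw [h] at e₁
        simp at e₁
      · have : f ∈ (∅ : Set (Formula P)) := e₂ ▸ Or.inl hf
        exact this

theorem Memory.Fits.soundMove_modal (ha : a.Fits C) {m : Move P} {C' : Configuration P}
    (h : Step C m C') (hm : m.IsModal) {s' : S} (hs : T.step a.state s')
    (hs' : ∀ Δ, m = .modal₁ Δ → (a.path (nextSet Δ)).at 1 = s') : SoundMove a C m C' s' := by
  have hA : ∀ Γ, ⟨.A, Γ⟩ ∈ C'.blocks → ⟨.A, nextSet Γ⟩ ∈ C.blocks := by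
    intro Γ hΓ
    cases h with
    | expand => exact hm.elim
    | ett => exact hm.elim
    | modal₀ hC =>
      obtain ⟨Δ, hΔ, e⟩ := hΓ
      injection e with _ e
      exact e ▸ hΔ
    | modal₁ Δ₀ hC hΔ₀ =>
      rcases hΓ with e | ⟨Δ, hΔ, e⟩
      · simp at e
      · injection e with _ e
        exact e ▸ hΔ
  have hE : ∀ Γ, ⟨.E, Γ⟩ ∈ C'.blocks → m = .modal₁ Γ ∧ ⟨.E, nextSet Γ⟩ ∈ C.blocks := by
    intro Γ hΓ
    cases h with
    | expand => exact hm.elim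
    | ett => exact hm.elim
    | modal₀ hC =>
      obtain ⟨Δ, hΔ, e⟩ := hΓ
      simp at e
    | modal₁ Δ₀ hC hΔ₀ =>
      rcases hΓ with e | ⟨Δ, hΔ, e⟩
      · injection e with _ e
        subst e
        exact ⟨rfl, hΔ₀⟩
      · simp at e
  have hconn : ∀ q Γ k Γ', BlockConn m ⟨q, Γ⟩ k ⟨q, Γ'⟩ → k = .modal ∧ Γ = nextSet Γ' ∧
      (q = .E → m = .modal₁ Γ') := by
    rintro q Γ k Γ' hc
    generalize hb : (⟨q, Γ⟩ : Block P) = b at hc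
    generalize hb' : (⟨q, Γ'⟩ : Block P) = b' at hc
    cases hc <;> first | exact hm.elim | (cases hb; cases hb'; simp)
  obtain ⟨π₀, hπ₀⟩ := exists_path T s'
  refine ⟨fun _ => hs, fun h => (h hm).elim, ?_, ?_, ?_, ?_, ?_, ⟨π₀, hπ₀, ?_⟩, ?_⟩
  · rintro Γ Γ' k - hc - π - f hf hmf
    obtain ⟨rfl, rfl, -⟩ := hconn _ _ _ _ hc
    obtain ⟨g, hg, rfl⟩ := hf
    refine ⟨g, hg, .modal _ _, ?_, by simp⟩
    rw [π.advance_of_isModal hm]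
    exact hmf
  · have : C'.lits = ∅ := by
      cases h with
      | expand => exact hm.elim
      | ett => exact hm.elim
      | modal₀ => rfl
      | modal₁ => rfl
    simp [this]
  · intro Γ hΓ π hπ
    -- Prefixing the current state turns a path from `s'` into one to which the old `A`-block
    -- applies.
    obtain ⟨π', hπ', rfl⟩ := exists_path_cons (π' := π) (hπ.symm ▸ hs)
    obtain ⟨f, ⟨g, hg, rfl⟩, hf⟩ := ha.all _ (hA Γ hΓ) π' hπ'
    exact ⟨g, hg, hf⟩
  · rintro Γ k Γ' ⟨hΓ, hc, -⟩
    obtain ⟨-, rfl, hm'⟩ := hconn _ _ _ _ hc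
    rw [(a.path _).advance_of_isModal hm]
    exact ⟨hs' _ (hm' rfl), fun f hf => (ha.ex _ hΓ).2 (.next f) (next_mem_nextSet.2 hf)⟩
  · rintro Γ k Γ' ⟨hΓ, hc, -⟩ f f' hf φ ψ e
    obtain ⟨rfl, -, -⟩ := hconn _ _ _ _ hc
    cases hf
    simp at e
  · intro Γ hΓ hno
    obtain ⟨rfl, hΓ'⟩ := hE Γ hΓ
    exact (hno ⟨nextSet Γ, .modal, hΓ', .modal₁_E _, trivial⟩).elim
  · cases h with
    | expand => exact hm.elim
    | ett => exact hm.elim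
    | modal₁ Δ₀ hC hΔ₀ =>
      refine .inr ⟨_, .inl rfl, fun e => ?_⟩
      injection e with _ e
      obtain ⟨Γ, e' | ⟨⟨f, hf⟩, e'⟩⟩ := hC.2 _ hΔ₀
      · simp at e'
      · injection e' with _ e'
        rw [← nextSet_injective e', e] at hf
        exact hf
    | modal₀ hC =>
      obtain ⟨B, hB⟩ := hC.1
      obtain ⟨Γ, rfl⟩ := hC.2 B hB
      exact .inr ⟨_, ⟨Γ, hB, rfl⟩, by simp⟩

/-- Player 0 can keep the configuration true. -/
theorem Memory.Fits.exists_soundMove (ha : a.Fits C) (hC : C.blocks.Nonempty)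
    (h₁ : ¬ C.Modal₁Applies) : ∃ m C' s', Step C m C' ∧ SoundMove a C m C' s' := by
  by_cases h0 : (⟨.E, ∅⟩ : Block P) ∈ C.blocks
  · exact ⟨_, _, _, .ett C h0, ha.soundMove_ett⟩
  by_cases hχ : ∃ B ∈ C.blocks, ∃ χ ∈ B.body, χ.isNext = false
  · obtain ⟨⟨q, Γ⟩, hB, χ, hχΓ, hχ⟩ := hχ
    obtain ⟨Γ, hχ', rfl⟩ : ∃ Δ, χ ∉ Δ ∧ Γ = insert χ Δ :=
      ⟨Γ \ {χ}, by simp, by simp [Set.insert_eq_of_mem hχΓ]⟩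
    cases q with
    | A =>
      obtain ⟨ds, ls, hr, hls, hk, hs⟩ := Rule.exists_sound_A T hχ a.state
      exact ⟨_, _, _, .expand C _ χ Γ ds ls hr hχ' hB,
        ha.soundMove_expand hr hB hls (by simp) (fun _ => hk) hs⟩
    | E =>
      obtain ⟨hπ, hm⟩ := ha.ex _ hB
      have hmχ := hm χ (.inl rfl)
      obtain ⟨ds, ls, hr, hk, hs⟩ := Rule.exists_sound_E hχ hmχ
      refine ⟨_, _, _, .expand C _ χ Γ ds ls hr hχ' hB,
        ha.soundMove_expand hr hB (fun ℓ hℓ π hπ' => ?_) (fun _ => hk) (by simp)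
          fun d hd hd' => ?_⟩
      · obtain ⟨rfl, hlit⟩ := hr.lits hℓ
        exact (models_congr_of_at_eq (hπ.trans hπ'.symm) (.inl hlit)).1 hmχ
      · rcases hs d hd hd' with ⟨φ, rfl, rfl⟩ | ⟨φ, rfl, rfl⟩
        · obtain ⟨π', hπ', h⟩ := hmχ
          exact .inl ⟨φ, rfl, rfl, π', hπ'.trans hπ, h⟩
        · exact .inr ⟨φ, rfl, rfl, fun π' hπ' => hmχ π' (hπ'.trans hπ.symm)⟩
  · push Not at hχ
    have hform : ∀ B ∈ C.blocks, ∃ Γ : Set (Formula P), B.body = nextSet Γ := fun B hB => by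
      refine ⟨{f | .next f ∈ B.body}, Set.ext fun f => ⟨fun hf => ?_, ?_⟩⟩
      · have := hχ B hB f hf
        cases f <;> simp [Formula.isNext] at this
        exact ⟨_, hf, rfl⟩
      · rintro ⟨g, hg, rfl⟩
        exact hg
    -- All formulas now begin with `X` and `E ∅` is absent, so a single `E`-block would make the
    -- node one of player 1.
    have hA : ∀ B ∈ C.blocks, B.quant = .A := by
      intro B hB
      by_contra hq
      refine h₁ ⟨⟨B, hB, by cases h : B.quant <;> simp_all⟩, fun B' hB' => ?_⟩
      obtain ⟨Γ, hΓ⟩ := hform B' hB'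
      obtain ⟨q, b⟩ := B'
      simp only at hΓ
      subst hΓ
      cases q with
      | A => exact ⟨Γ, .inl rfl⟩
      | E =>
        refine ⟨Γ, .inr ⟨Set.nonempty_iff_ne_empty.2 ?_, rfl⟩⟩
        rintro rfl
        exact h0 (by simpa [nextSet] using hB')
    have h0 : C.Modal₀Applies := ⟨hC, fun B hB => by
      obtain ⟨Γ, hΓ⟩ := hform B hB
      have := hA B hB
      obtain ⟨q, b⟩ := B
      simp only at hΓ this
      exact ⟨Γ, by rw [hΓ, this]⟩⟩
    obtain ⟨s', hs'⟩ := T.total a.state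
    have hstep := Step.modal₀ C h0
    exact ⟨_, _, s', hstep, ha.soundMove_modal hstep trivial hs' (by simp)⟩

end SoundMoves

/-! ### Traces in plays that follow the model -/

section Plays

variable {P : Type} {ϑ : Formula P}

theorem Trace.exists_thread {ρ : (satArena ϑ).Play} (ξ : Trace ρ) (i : ℕ) {f : ℕ → Formula P}
    (hf : ∀ j, f j ∈ (ξ.block (i + j)).body)
    (hc : ∀ j, FormulaConn (ρ.move (i + j)) (ξ.link (i + j)) (f j) (f (j + 1))) :
    ∃ t : ξ.Thread, ∀ j, t.form (i + j) = f j := by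
  induction i generalizing f with
  | zero =>
    simp only [Nat.zero_add] at hf hc
    exact ⟨⟨f, hf, hc⟩, fun j => by rw [Nat.zero_add]⟩
  | succ i ih =>
    obtain ⟨g, hg, hgc⟩ := (ξ.conn i).exists_pred (hf 0)
    obtain ⟨t, ht⟩ := ih (f := consSeq g f)
      (by
        rintro (_ | j)
        · exact hg
        · have := hf j
          rwa [Nat.add_right_comm] at this)
      (by
        rintro (_ | j)
        · exact hgc
        · have := hc j
          rwa [Nat.add_right_comm] at this)
    exact ⟨t, fun j => by rw [Nat.add_right_comm]; exact ht (j + 1)⟩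

/-- A trace is eventually not affected by the introduction of new blocks. -/
theorem Trace.eventually_keeps {ρ : (satArena ϑ).Play} (hρ : ρ.length = ⊤) (ξ : Trace ρ) :
    ∃ i, ∀ j ≥ i, (ξ.link j).Keeps := by
  classical
  have hstep : ∀ i, Step (ρ.pos i).1 (ρ.move i) (ρ.pos (i + 1)).1 := fun i =>
    ρ.step i (by rw [hρ]; exact ENat.natCast_lt_top i)
  have hdepth : ∀ i f', f' ∈ (ξ.block (i + 1)).body → ∃ f ∈ (ξ.block i).body,
      f'.depth ≤ f.depth ∧ (¬ (ξ.link i).Keeps → f'.depth < f.depth) := by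
    intro i f' hf'
    obtain ⟨f, hf, hfc⟩ := (ξ.conn i).exists_pred hf'
    refine ⟨f, hf, ?_⟩
    have hs := hstep i
    have hc := ξ.conn i
    generalize ξ.link i = k at *
    generalize ρ.move i = m at *
    generalize ξ.block i = B at *
    generalize ξ.block (i + 1) = B' at *
    generalize (ρ.pos i).1 = C at *
    generalize (ρ.pos (i + 1)).1 = C' at *
    cases hfc with
    | copy => exact ⟨le_rfl, fun h => (h trivial).elim⟩
    | modal => exact ⟨le_rfl, fun h => (h trivial).elim⟩
    | side _ _ _ _ _ _ hk => exact ⟨le_rfl, fun h => (h hk).elim⟩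
    | principal _ _ _ _ _ d _ hψ =>
      cases hc with
      | expand_descend _ _ _ _ _ _ hd =>
        cases hs with
        | expand _ _ _ _ _ hr =>
          have := hr.depth_le hd hψ
          exact ⟨this.1, fun h => this.2 (by simpa [Link.Keeps] using h)⟩
  have hspawn : ∀ i, ¬ (ξ.link i).Keeps → (ξ.block i).body.Nonempty := by
    intro i hk
    have hc := ξ.conn i
    generalize ξ.link i = k at *
    generalize ξ.block i = B at *
    generalize ξ.block (i + 1) = B' at *
    generalize ρ.move i = m at *
    cases hc with
    | expand_descend => exact ⟨_, .inl rfl⟩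
    | _ => exact (hk trivial).elim
  -- Minimize a strict bound on the depths in a block. Spawning after the minimum is reached would
  -- lower the bound further; it cannot be zero there, since the spawning block has a formula.
  have hex : ∃ n, ∃ i, ∀ f ∈ (ξ.block i).body, f.depth < n :=
    ⟨ϑ.depth + 1, 0, fun f hf =>
      Nat.lt_succ_of_le ((ρ.pos 0).2.1.body_subset _ (ξ.mem 0) f hf).depth_le⟩
  obtain ⟨i, hi⟩ := Nat.find_spec hex
  have hle : ∀ j ≥ i, ∀ f ∈ (ξ.block j).body, f.depth < Nat.find hex := by
    intro j hj
    induction j, hj using Nat.le_induction with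
    | base => exact hi
    | succ j hj ih =>
      intro f' hf'
      obtain ⟨f, hf, h, -⟩ := hdepth j f' hf'
      exact h.trans_lt (ih f hf)
  refine ⟨i, fun j hj => ?_⟩
  by_contra hk
  obtain ⟨g, hg⟩ := hspawn j hk
  have hpos := hle j hj g hg
  refine Nat.find_min hex (m := Nat.find hex - 1) (by omega) ⟨j + 1, fun f' hf' => ?_⟩
  obtain ⟨f, hf, -, h⟩ := hdepth j f' hf'
  have := hle j hj f hf
  have := h hk
  omega

theorem exists_isModal {ρ : (satArena ϑ).Play} (hρ : ρ.length = ⊤) (i : ℕ) :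
    ∃ j ≥ i, (ρ.move j).IsModal := by
  by_contra hc
  push Not at hc
  have hlt : ∀ j ≥ i, (ρ.pos (j + 1)).1.measure < (ρ.pos j).1.measure := fun j hj =>
    Step.measure_lt (ρ.step j (by rw [hρ]; exact ENat.natCast_lt_top j)) (ρ.pos j).2.1 (hc j hj)
  obtain ⟨k, hk, hk'⟩ := eventually_const_of_antitone (f := fun j => (ρ.pos j).1.measure)
    fun j hj => (hlt j hj).le
  have h1 := hlt k hk
  have h2 := hk' (k + 1) (by omega)
  omega

variable {S : Type u} {T : TransitionSystem P S}

theorem Block.mk_body {B : Block P} {q : Quantifier} (h : B.quant = q) :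
    (⟨q, B.body⟩ : Block P) = B := by
  subst h
  rfl

/-- An infinite play in which player 0 keeps the configurations true contains no bad trace. -/
theorem Trace.not_isBad {ρ : (satArena ϑ).Play} (hρ : ρ.length = ⊤) {a : ℕ → Memory T}
    (ha : ∀ i, (a i).Fits (ρ.pos i).1)
    (hu : ∀ i, (a i).Update (ρ.pos i).1 (ρ.move i) (a (i + 1))) (ξ : Trace ρ) : ¬ ξ.IsBad := by
  have hstep : ∀ i, Step (ρ.pos i).1 (ρ.move i) (ρ.pos (i + 1)).1 := fun i =>
    ρ.step i (by rw [hρ]; exact ENat.natCast_lt_top i)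
  have hinf := exists_isModal hρ
  obtain ⟨i₁, hk⟩ := ξ.eventually_keeps hρ
  rintro (⟨⟨i₂, hE⟩, t, φ, ψ, -, hoften⟩ | ⟨⟨i₂, hA⟩, hno⟩)
  · have hcont : ∀ i ≥ max i₁ i₂, Continues (ρ.pos i).1 (ρ.move i) (ξ.block i).body (ξ.link i)
        (ξ.block (i + 1)).body := fun i hi => by
      refine ⟨?_, ?_, hk i (by omega)⟩
      · rw [Block.mk_body (hE i (by omega))]
        exact ξ.mem i
      · rw [Block.mk_body (hE i (by omega)), Block.mk_body (hE (i + 1) (by omega))]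
        exact ξ.conn i
    -- Once the stamp is constant, the memorized path is only advanced and never exchanged.
    obtain ⟨i₃, hi₃, hconst⟩ := eventually_const_of_antitone
      (f := fun i => (a i).birth (ξ.block i).body) (i := max i₁ i₂)
      fun i hi => ((hu i).birth_le _ _ _ (hcont i hi)).1
    have hpath : ∀ i ≥ i₃, (a (i + 1)).path (ξ.block (i + 1)).body =
        ((a i).path (ξ.block i).body).advance (ρ.move i) := fun i hi =>
      ((hu i).birth_le _ _ _ (hcont i (by omega))).2
        ((hconst (i + 1) (by omega)).trans (hconst i hi).symm)
    have hdyn := fun i => (hstep i).formula_cases (ξ.conn i) (t.conn i)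
    obtain ⟨χ, i₀, hχ, -, htail⟩ := thread_tail hinf (fun i => (hdyn i).1) (fun i => (hdyn i).2)
    have hχ' : χ = .untl φ ψ := by
      obtain ⟨j, hj, e⟩ := hoften i₀
      rcases htail j hj with e' | e'
      · exact e'.symm.trans e
      · rw [e'] at e
        simp at e
    subst hχ'
    obtain ⟨i, hi, hform⟩ := hoften (max i₀ i₃)
    have htrue := ((ha i).ex _ (hcont i (by omega)).1).2 _ (t.mem i)
    rw [hform] at htrue
    -- The `U`-formula is fulfilled at suffix `l`, yet the thread defers it there, which requires
    -- its right argument to be false.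
    obtain ⟨l, hl, -⟩ := htrue
    obtain ⟨j, hj, hfj, hfj', hπj⟩ := exists_unfolding (π := fun i => (a i).path (ξ.block i).body)
      hinf (fun i => (hdyn i).1) hχ hform (fun j hj => htail j (by omega))
      (fun j hj hm => by rw [hpath j (by omega), TransitionSystem.Path.advance_of_isModal _ hm])
      (fun j hj hm => by
        rw [hpath j (by omega), TransitionSystem.Path.advance_of_not_isModal _ hm]) l
    refine (hu j).unfold _ _ _ (hcont j (by omega)) _ _ (t.conn j) φ ψ hfj (by rw [hfj', hfj]) ?_
    exact hπj ▸ hl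
  -- The states visited by the play form a single path, and a thread of formulas true on it is
  -- selected in the given trace.
  · obtain ⟨π, hπ, hπ₁, hπ₀⟩ := exists_paths_of_stutter T (fun i => (a i).state)
      (fun i => (ρ.move i).IsModal) hinf (fun i hi => (hu i).step hi) (fun i hi => (hu i).stay hi)
    have hadv : ∀ i, π (i + 1) = (π i).advance (ρ.move i) := fun i => by
      by_cases hm : (ρ.move i).IsModal
      · rw [hπ₁ i hm, TransitionSystem.Path.advance_of_isModal _ hm]
      · rw [hπ₀ i hm, TransitionSystem.Path.advance_of_not_isModal _ hm]
    set i := max i₁ i₂ with hi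
    have hblock : ∀ j ≥ i, (⟨.A, (ξ.block j).body⟩ : Block P) = ξ.block j := fun j hj =>
      Block.mk_body (hA j (by omega))
    have hmem : ∀ j ≥ i, ⟨.A, (ξ.block j).body⟩ ∈ (ρ.pos j).1.blocks := fun j hj => by
      rw [hblock j hj]
      exact ξ.mem j
    obtain ⟨f₀, hf₀, hm₀⟩ := (ha i).all _ (hmem i le_rfl) (π i) (hπ i)
    obtain ⟨f, -, hf, hfc⟩ := exists_seq
      (p := fun j f => f ∈ (ξ.block (i + j)).body ∧ Models T (π (i + j)) f)
      (r := fun j f f' => FormulaConn (ρ.move (i + j)) (ξ.link (i + j)) f f' ∧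
        ∀ φ ψ, f = .untl φ ψ → f' = .next f → ¬ Models T (π (i + j)) ψ)
      (fun j f ⟨hf, hm⟩ => by
        obtain ⟨f', h1, h2, h3, h4⟩ := (hu (i + j)).thread _ (ξ.block (i + j + 1)).body
          (ξ.link (i + j)) (hmem (i + j) (by omega))
          (by
            rw [hblock (i + j) (by omega), hblock (i + j + 1) (by omega)]
            exact ξ.conn (i + j))
          (hk _ (by omega)) (π (i + j)) (hπ _) f hf hm
        exact ⟨f', ⟨h1, by rwa [← hadv] at h3⟩, h2, h4⟩)
      (x := f₀) ⟨hf₀, hm₀⟩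
    have hinf' : ∀ j, ∃ l ≥ j, (ρ.move (i + l)).IsModal := fun j => by
      obtain ⟨l, hl, hm⟩ := hinf (i + j)
      exact ⟨l - i, by omega, by rwa [Nat.add_sub_cancel' (by omega)]⟩
    have hdyn := fun j => (hstep (i + j)).formula_cases (ξ.conn (i + j)) (hfc j).1
    have h₁ := fun j => (hdyn j).1
    obtain ⟨χ, i₀, hχ, hi₀, htail⟩ := thread_tail (M := fun j => (ρ.move (i + j)).IsModal) hinf'
      h₁ (fun j => (hdyn j).2)
    rcases Formula.isFix_cases hχ with ⟨φ, ψ, rfl⟩ | ⟨φ, ψ, rfl⟩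
    · have htrue := (hf i₀).2
      rw [hi₀] at htrue
      obtain ⟨l, hl, -⟩ := htrue
      obtain ⟨j, hj, hfj, hfj', hπj⟩ := exists_unfolding (π := fun j => π (i + j))
        hinf' h₁ hχ hi₀ htail (fun j _ hm => hπ₁ _ hm) (fun j _ hm => hπ₀ _ hm) l
      exact (hfc j).2 φ ψ hfj (by rw [hfj', hfj]) (hπj ▸ hl)
    · obtain ⟨t, ht⟩ := ξ.exists_thread i (fun j => (hf j).1) (fun j => (hfc j).1)
      refine hno ⟨t, φ, ψ, ?_, fun j => ?_⟩
      · have := (ρ.pos (i + i₀)).2.1.body_subset _ (ξ.mem _) _ (hf i₀).1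
        rwa [hi₀] at this
      · obtain ⟨l, hl, e⟩ := infinitely_often hinf' h₁ htail j
        exact ⟨i + l, by omega, by rw [ht, e]⟩

/-- The initial memory. -/
theorem exists_memory {π : T.Path} (h : Models T π ϑ) :
    ∃ a : Memory T, a.Fits (initialGoal ϑ).1 := by
  have hE : ∀ {B : Block P}, B ∈ (initialGoal ϑ).1.blocks → B = ⟨.E, {ϑ}⟩ := fun h => h
  -- The clock starts at 1 so that the initial stamp 0 lies strictly in the past.
  refine ⟨⟨1, π.at 0, fun _ => 0, fun _ => π⟩, fun ℓ hℓ => hℓ.elim, fun Γ hΓ => ?_,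
    fun Γ hΓ => ?_, fun _ _ => Nat.one_pos, fun _ _ _ _ _ => rfl, .inr ⟨_, rfl, by simp⟩⟩
  · simpa using hE hΓ
  · have := hE hΓ
    injection this with _ e
    subst e
    exact ⟨rfl, by rintro f rfl; exact h⟩

theorem Satisfiable.exists_isWinning (h : Satisfiable.{u} ϑ) :
    ∃ σ : (satGame ϑ).Strategy, σ.IsWinning := by
  obtain ⟨S, T, hT⟩ := h
  obtain ⟨π, hπ⟩ := exists_path T T.start
  obtain ⟨a₀, ha₀⟩ := exists_memory (hT π hπ)
  have hmove : ∀ (a : Memory T) (v : Goals ϑ), a.Fits v.1 → v.1.blocks.Nonempty →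
      ¬ v.1.Modal₁Applies → ∃ m, ∃ v' : Goals ϑ, ∃ a' : Memory T, Step v.1 m v'.1 ∧
        a'.Fits v'.1 ∧ a.Update v.1 m a' := fun a v ha hne hv => by
    obtain ⟨m, C', s', hs, hm⟩ := ha.exists_soundMove hne hv
    obtain ⟨a', ha', hu⟩ := hm.exists_update ha
    refine ⟨m, ⟨C', hs.isFor v.2.1 ?_, ha'.consistent⟩, a', hs, ha', hu⟩
    rcases ha'.nonempty with h | ⟨B, hB, -⟩
    exacts [.inr h, .inl ⟨B, hB⟩]
  have : Nonempty (Move P) := ⟨.ett⟩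
  obtain ⟨σ, hσ⟩ := Game.exists_strategy (satGame ϑ) (fun a v => Memory.Fits (T := T) a v.1)
    (fun a v m a' _ => a.Update v.1 m a') ha₀
    (fun a v hv ha ⟨m, v', hs⟩ => hmove a v ha (Step.blocks_nonempty hs) hv)
    (fun a v hv ha m v' hs => by
      have hv : v.1.Modal₁Applies := not_not.1 hv
      obtain ⟨Δ, rfl, hΔ, -⟩ := Step.eq_modal₁ hs hv
      have hπ := (ha.ex _ hΔ).1
      exact (ha.soundMove_modal (s' := (a.path (nextSet Δ)).at 1) hs trivial
        (hπ ▸ (a.path (nextSet Δ)).step 0) (by rintro Δ' e; injection e with e; rw [e])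
        ).exists_update ha)
    (fun v hv m m' v' h h' => Step.modal₁_unique h h' (not_not.1 hv))
  refine ⟨σ, fun ρ hρ => ?_⟩
  obtain ⟨a, ha, hu⟩ := hσ ρ hρ
  rcases h : ρ.length with _ | n
  · have hlen : ρ.length = ⊤ := h
    refine .inr ⟨hlen, fun ⟨ξ, hξ⟩ => ?_⟩
    exact ξ.not_isBad hlen (fun i => ha i (by rw [hlen]; exact le_top))
      (fun i => hu i (by rw [hlen]; exact ENat.natCast_lt_top i)) hξ
  · have hlen : ρ.length = (n : ℕ∞) := h
    refine .inl ⟨n, hlen, ?_⟩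
    by_contra hne
    rw [← Ne, ← Set.nonempty_iff_ne_empty] at hne
    -- As long as a block is left, a move exists: by `exists_step_modal₁` at nodes of player 1, by a
    -- sound move elsewhere.
    have hfin := ρ.maximal n hlen
    by_cases hv : (ρ.pos n).1.Modal₁Applies
    · obtain ⟨B, hB, hq⟩ := hv.1
      obtain ⟨Δ, rfl | ⟨-, rfl⟩⟩ := hv.2 B hB
      · simp at hq
      · obtain ⟨v', hs⟩ := exists_step_modal₁ _ hv hB
        exact hfin _ _ hs
    · obtain ⟨m, v', -, hs, -⟩ := hmove _ _ (ha n hlen.ge) hne hv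
      exact hfin _ _ hs

end Plays

end CTLStar

theorem mainTheorem1 {P : Type} (ϑ : CTLStar.Formula P)
    (hϑ : CTLStar.IsStateFormula.{u} ϑ) :
    CTLStar.Satisfiable.{u} ϑ ↔
      ∃ σ : (CTLStar.satGame ϑ).Strategy, σ.IsWinning :=
  ⟨fun h => h.exists_isWinning, fun ⟨_, hσ⟩ => hσ.satisfiable hϑ⟩
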